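/- Let $(X,d,\mu)$ be a complete, connected metric measure space ($X$ nonempty and separable, $\mu$ Borel) with $\mu$ doubling: $0<\mu(B(x,r))<\infty$ and $\mu(B(x,2r))\le C_\mu\,\mu(B(x,r))$ for all open balls. Let $0<s<1$, and let $Q>s$ be a doubling dimension with constant $c>0$, i.e. $\mu(B(x,r))/\mu(B(x,R))\ge c\,(r/R)^Q$ for all $x\in X$ and $0<r<R$. Put $B_{x,y}=B(x,d(x,y))\cup B(y,d(x,y))$ and $\|u\|_{\dot W^{s,1}(A)}=\int_A\int_A\frac{|u(x)-u(y)|}{\mu(B_{x,y})\,d(x,y)^s}\,d\mu(x)\,d\mu(y)$. Let $\dot W^{s,1}(A)$ be the set of measurable $u:A\to[-\infty,\infty]$ with $\|u\|_{\dot W^{s,1}(A)}<\infty$, let $W^{s,1}(X)=L^1(X)\cap\dot W^{s,1}(X)$, and let $W^{s,1}_0(\Omega)$ be the set of $\eta\in W^{s,1}(X)$ with $\eta=0$ a.e. on $\Omega^c=X\setminus\Omega$. Let $\Omega\subset X$ be open. A measurable function $u:X\to[-\infty,\infty]$ is an $s$-subminimizer in $\Omega$ if $u\in\dot W^{s,1}(\Omega)$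 and, for every $\eta\in W^{s,1}_0(\Omega)$ with $\eta\le 0$, one has $F(u,u+\eta)\le 0$, where $$F(u,v)=\Big(\int_\Omega\int_\Omega+2\int_\Omega\int_{\Omega^c}\Big)\frac{|u(x)-u(y)|-|v(x)-v(y)|}{\mu(B_{x,y})\,d(x,y)^s}\,d\mu(x)\,d\mu(y).$$ For $\psi:\Omega\to[-\infty,\infty)$, a $\mathcal K_{\psi,0}(\Omega)$-solution is a minimizer of $\|\cdot\|_{\dot W^{s,1}(X)}$ in the class of all $u\in\dot W^{s,1}(X)$ with $u\ge\psi$ a.e. on $\Omega$ and $u=0$ a.e. on $X\setminus\Omega$. Let $x_0\in\Omega$, $0<r<R$ with $B(x_0,R)\subset\Omega$, and $k_0\in\mathbb R$. Assume that either (a) $u$ is an $s$-subminimizer in $\Omega$; or (b) $u$ is a $\mathcal K_{\psi,0}(\Omega)$-solution for some $\psi:\Omega\to[-\infty,\infty)$ with $\psi\le k_0$ a.e. on $B(x_0,R)$. Then there is a constant $C>0$, depending only on $s$, $C_\mu$ and $c$, such that $$\operatorname*{ess\,sup}_{B(x_0,r)}(u-k_0)\le C\Big(\frac{R}{R-r}\Big)^{Q}\,\frac{1}{\mu(B(x_0,R))}\int_{B(x_0,R)}(u-k_0)_+\,d\mu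 .$$ If moreover $\mu$ supports a $1$-Poincaré inequality, i.e. there are $C_P>0$ and $\lambda\ge1$ such that for every ball $B(x,r)$, every function $w$ integrable on balls and every upper gradient $g$ of $w$, the mean over $B(x,r)$ of $|w-w_{B(x,r)}|$ is at most $C_P\,r$ times the mean of $g$ over $B(x,\lambda r)$ (with $w_{B(x,r)}$ the mean of $w$), then one can take $C=(C'/s)^{Q/s}$, where $C'>0$ depends only on $C_\mu$, $c$, $C_P$ and $\lambda$. -/

import Mathlib

open MeasureTheory Metric Set
open scoped ENNReal

universe u

namespace NonlocalHarnack

variable {X : Type u} [MetricSpace X] [MeasurableSpace X]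

/-- `μ` is a doubling measure with doubling constant `Cμ`; all balls have positive and finite
measure. -/
structure IsDoubling (μ : Measure X) (Cμ : ℝ) : Prop where
  pos : ∀ (x : X) (r : ℝ), 0 < r → 0 < μ (ball x r)
  finite : ∀ (x : X) (r : ℝ), 0 < r → μ (ball x r) < ∞
  doubling : ∀ (x : X) (r : ℝ), 0 < r →
    μ (ball x (2 * r)) ≤ ENNReal.ofReal Cμ * μ (ball x r)

/-- `Q` is a doubling dimension of `μ`, with constant `c`: one has
`μ (B(x,r)) / μ (B(x,R)) ≥ c (r/R)^Q` for all `0 < r < R`. -/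
structure IsDoublingDimension (μ : Measure X) (Q c : ℝ) : Prop where
  dim_pos : 0 < Q
  const_pos : 0 < c
  lower_bound : ∀ (x : X) (r R : ℝ), 0 < r → r < R →
    ENNReal.ofReal (c * (r / R) ^ Q) * μ (ball x R) ≤ μ (ball x r)

/-- `B_{x,y} = B(x, d(x,y)) ∪ B(y, d(y,x))`. -/
def pairBall (x y : X) : Set X := ball x (dist x y) ∪ ball y (dist y x)

/-- The Gagliardo seminorm
`∫_A ∫_A |u(x)-u(y)| / (μ(B_{x,y}) d(x,y)^s) dμ(x) dμ(y)`.
For extended real values, `|a - b| = ∞` whenever one of `a`, `b` is infinite. -/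
noncomputable def gagliardo (μ : Measure X) (s : ℝ) (A : Set X) (u : X → EReal) : ℝ≥0∞ :=
  ∫⁻ y in A, ∫⁻ x in A,
    (u x - u y).abs / (μ (pairBall x y) * ENNReal.ofReal (dist x y ^ s)) ∂μ ∂μ

/-- The homogeneous space `Ẇ^{s,1}(A)`. -/
def MemDotW (μ : Measure X) (s : ℝ) (A : Set X) (u : X → EReal) : Prop :=
  AEMeasurable u (μ.restrict A) ∧ gagliardo μ s A u < ∞

/-- The space `W^{s,1}(A)`, with norm `‖u‖_{L¹(A)} + ‖u‖_{Ẇ^{s,1}(A)}`. -/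
def MemW (μ : Measure X) (s : ℝ) (A : Set X) (u : X → EReal) : Prop :=
  AEMeasurable u (μ.restrict A) ∧ (∫⁻ x in A, (u x).abs ∂μ) + gagliardo μ s A u < ∞

/-- The space `W^{s,1}_0(Ω)` of functions in `W^{s,1}(X)` that vanish a.e. outside `Ω`. -/
def MemWZero (μ : Measure X) (s : ℝ) (Ω : Set X) (η : X → EReal) : Prop :=
  MemW μ s univ η ∧ ∀ᵐ x ∂μ.restrict Ωᶜ, η x = 0

/-- The integrand `(|u(x)-u(y)| - |v(x)-v(y)|) / (μ(B_{x,y}) d(x,y)^s)` of the functional `F`.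
An infinite `|u(x)-u(y)|` or `|v(x)-v(y)|` is counted as `0`; for `v = u + η` with `η` in
`W^{s,1}_0(Ω)` and `u` finite a.e., this concerns a null set only. -/
noncomputable def energyDiff (μ : Measure X) (s : ℝ) (u v : X → EReal) (x y : X) : ℝ :=
  ((u x - u y).abs.toReal - (v x - v y).abs.toReal) / (μ.real (pairBall x y) * dist x y ^ s)

/-- The functional `F(u,v) = (∫_Ω ∫_Ω + 2 ∫_Ω ∫_{Ωᶜ}) ...`. When `v = u + η` with `u` in
`Ẇ^{s,1}(Ω)` and `η` in `W^{s,1}_0(Ω)`, the integrand is dominated by that of `‖η‖_{Ẇ^{s,1}(X)}`,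
so the integrals converge absolutely. -/
noncomputable def functionalF (μ : Measure X) (s : ℝ) (Ω : Set X) (u v : X → EReal) : ℝ :=
  (∫ y in Ω, ∫ x in Ω, energyDiff μ s u v x y ∂μ ∂μ) +
    2 * ∫ y in Ω, ∫ x in Ωᶜ, energyDiff μ s u v x y ∂μ ∂μ

/-- `u : X → [-∞,∞]` is an `s`-subminimizer in `Ω`. -/
structure IsSubminimizer (μ : Measure X) (s : ℝ) (Ω : Set X) (u : X → EReal) : Prop where
  aemeasurable : AEMeasurable u μ
  memDotW : MemDotW μ s Ω u
  le_zero : ∀ η : X → EReal, MemWZero μ s Ω η → (∀ x, η x ≤ 0) →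
    functionalF μ s Ω u (fun x => u x + η x) ≤ 0

/-- The class `K_{ψ,f}(Ω)`. Only the values of `ψ` in `Ω` matter. -/
def obstacleClass (μ : Measure X) (s : ℝ) (Ω : Set X) (ψ f : X → EReal) : Set (X → EReal) :=
  {u | MemDotW μ s univ u ∧ (∀ᵐ x ∂μ.restrict Ω, ψ x ≤ u x) ∧ ∀ᵐ x ∂μ.restrict Ωᶜ, u x = f x}

/-- `u` is a solution of the `K_{ψ,f}(Ω)`-obstacle problem. -/
def IsObstacleSolution (μ : Measure X) (s : ℝ) (Ω : Set X) (ψ f u : X → EReal) : Prop :=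
  u ∈ obstacleClass μ s Ω ψ f ∧
    ∀ v ∈ obstacleClass μ s Ω ψ f, gagliardo μ s univ u ≤ gagliardo μ s univ v

/-- The line integral `∫_γ g ds` over a rectifiable curve `γ : [a,b] → X`, computed in the
arc-length parametrization of `γ` on `[0, length γ]`. -/
noncomputable def curveIntegral (g : X → ℝ≥0∞) (γ : ℝ → X) (a b : ℝ) : ℝ≥0∞ :=
  ∫⁻ t in Icc 0 (variationOnFromTo γ (Icc a b) a b), g (naturalParameterization γ (Icc a b) a t)

/-- The Borel function `g : X → [0,∞]` is an upper gradient of `w`: for every rectifiable curve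
`γ : [a,b] → X`, the oscillation of `w` between its end points is at most `∫_γ g ds`. -/
def IsUpperGradient (g : X → ℝ≥0∞) (w : X → ℝ) : Prop :=
  Measurable g ∧ ∀ (a b : ℝ) (γ : ℝ → X), a ≤ b → ContinuousOn γ (Icc a b) →
    BoundedVariationOn γ (Icc a b) →
    ENNReal.ofReal |w (γ a) - w (γ b)| ≤ curveIntegral g γ a b

/-- `μ` supports a `1`-Poincaré inequality with constants `CP` and `lam`. -/
structure SupportsPoincare (μ : Measure X) (CP lam : ℝ) : Prop where
  const_pos : 0 < CP
  one_le_dilation : 1 ≤ lam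
  poincare : ∀ (w : X → ℝ) (g : X → ℝ≥0∞),
    (∀ (x : X) (r : ℝ), 0 < r → IntegrableOn w (ball x r) μ) → IsUpperGradient g w →
    ∀ (x : X) (r : ℝ), 0 < r →
      ENNReal.ofReal (⨍ y in ball x r, |w y - ⨍ z in ball x r, w z ∂μ| ∂μ) ≤
        ENNReal.ofReal (CP * r) * ⨍⁻ y in ball x (lam * r), g y ∂μ

end NonlocalHarnack

/-!
The proof is a De Giorgi iteration in `L¹`. Two inequalities drive it.

*Caccioppoli inequality.* For a level `k` and a cutoff function `φ` supported in a ball `P ⊆ Ω`, put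
`e = (u - k)₊` in `P` and `f = φ e`. For real numbers, truncation splits the oscillation exactly,
`|a - b| = |min a k - min b k| + |(a - k)₊ - (b - k)₊|`, so that
`|f(x) - f(y)| + |(u - f)(x) - (u - f)(y)| ≤ |u(x) - u(y)| + 2 (e(x) + e(y)) |φ(x) - φ(y)|`
(`abs_cutoff_mul_excess_add_le`). Minimality of `u` against `u - f` therefore bounds the energy of
`f` by twice an error term in which only `φ` oscillates. For a subminimizer the competitor is always
allowed (`energy_le_cutoffEnergy_of_isSubminimizer`; `u` may be infinite outside `Ω`), for an obstacle
solution if `k` is above the obstacle in the ball (`IsObstacleSolution.hasCaccioppoli`). The kernel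
integrated against a Lipschitz cutoff function is at most `C (1/s + 1/(1-s)) δ^{-s}`
(`lintegral_cutoff_mul_kernel_le`), and no tail of `u` enters.

*Faber–Krahn inequality.* In place of a Sobolev embedding only the following is needed: if balls of
radius `t` have at least twice the measure of the support of `f ≥ 0`, then `∫ f ≤ A t^s [f]`, where
`[f]` is the seminorm of `f`. In a doubling space it holds with `A = 2 Cμ`, because `f` vanishes on
half of each ball in question (`IsDoubling.hasFaberKrahn`). Under a `1`-Poincaré inequality and for
`s ≥ 1/2`, one has `A = C (1 - s)` (`SupportsPoincare.hasFaberKrahn`): averages of `f` at scale `h`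
are locally Lipschitz with upper gradient `C/h` times the oscillation of `f` at scale `2h`, so the
Poincaré inequality bounds `∫ f` by `C t/h` times the integrated oscillation at scale `2h`, for every
`h ≤ t`. Summing over dyadic `h` with the weights of the seminorm yields a geometric series with the
sum `1/(1 - s)`. This factor cancels the blow-up of the Caccioppoli constant as `s → 1`, which leaves
a constant of order `1/s`.

The doubling dimension turns `t` into a power `s/Q` of the relative measure of the support
(`HasFaberKrahn.lintegral_le`). For increasing levels and decreasing radii the integrals of the
excess then satisfy a recursion with a superlinear gain (`levelIntegral_le`), and decay to `0` once
the increment of the level is the right-hand side of the claim (`HasCaccioppoli.ae_le`). Finally, `Q`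
may be lowered to `max 1 (log₂ Cμ)` (`IsDoubling.exists_dimension_le`), so that the constants do not
depend on it.
-/

namespace NonlocalHarnack

/-! ### The Gagliardo kernel and the doubling condition -/

variable {X : Type u} [MetricSpace X]

theorem pairBall_comm (x y : X) : pairBall x y = pairBall y x := by
  rw [pairBall, pairBall, union_comm]

theorem abs_coe_sub_coe (a b : ℝ) : ((a : EReal) - (b : EReal)).abs = ENNReal.ofReal |a - b| := by
  rw [← EReal.coe_sub, EReal.abs_def]

variable [MeasurableSpace X]

/-- The kernel `1 / (μ(B_{x,y}) d(x,y)^s)` of the Gagliardo seminorm, with values in `[0,∞]`. On the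
diagonal it is `∞`, but there it is only ever multiplied by `0`. -/
noncomputable def kernel (μ : Measure X) (s : ℝ) (x y : X) : ℝ≥0∞ :=
  (μ (pairBall x y) * ENNReal.ofReal (dist x y ^ s))⁻¹

/-- The Gagliardo seminorm over the whole space of a real-valued function. -/
noncomputable def energy (μ : Measure X) (s : ℝ) (f : X → ℝ) : ℝ≥0∞ :=
  ∫⁻ y, ∫⁻ x, ENNReal.ofReal |f x - f y| * kernel μ s x y ∂μ ∂μ

theorem kernel_comm (μ : Measure X) (s : ℝ) (x y : X) : kernel μ s x y = kernel μ s y x := by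
  rw [kernel, kernel, pairBall_comm, dist_comm]

section Doubling

variable {μ : Measure X} {Cμ : ℝ}

theorem IsDoubling.measure_ball_two_pow_mul_le (h : IsDoubling μ Cμ) (x : X) {r : ℝ} (hr : 0 < r)
    (n : ℕ) : μ (ball x (2 ^ n * r)) ≤ ENNReal.ofReal Cμ ^ n * μ (ball x r) := by
  induction n with
  | zero => simp
  | succ n ih =>
    calc μ (ball x (2 ^ (n + 1) * r)) = μ (ball x (2 * (2 ^ n * r))) := by ring_nf
      _ ≤ ENNReal.ofReal Cμ * μ (ball x (2 ^ n * r)) := h.doubling x _ (by positivity)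
      _ ≤ ENNReal.ofReal Cμ * (ENNReal.ofReal Cμ ^ n * μ (ball x r)) := by gcongr
      _ = _ := by ring

theorem IsDoubling.one_le [Nonempty X] (h : IsDoubling μ Cμ) : 1 ≤ Cμ := by
  obtain ⟨x⟩ := ‹Nonempty X›
  by_contra! hC
  have h0 := h.pos x 1 one_pos
  have h1 : μ (ball x 1) ≤ ENNReal.ofReal Cμ * μ (ball x 1) :=
    (measure_mono (ball_subset_ball (by norm_num))).trans (h.doubling x 1 one_pos)
  have h2 : ENNReal.ofReal Cμ * μ (ball x 1) < 1 * μ (ball x 1) :=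
    ENNReal.mul_lt_mul_left h0.ne' (h.finite x 1 one_pos).ne (by simpa using hC)
  rw [one_mul] at h2
  exact absurd h2 (not_lt.2 h1)

/-- Balls of comparable radii with nearby centres have comparable measures. -/
theorem IsDoubling.measure_ball_le_of_subset (h : IsDoubling μ Cμ) {x z : X} {r R : ℝ} (hr : 0 < r)
    (n : ℕ) (hR : R + dist z x ≤ 2 ^ n * r) :
    μ (ball z R) ≤ ENNReal.ofReal Cμ ^ n * μ (ball x r) :=
  (measure_mono (ball_subset_ball' hR)).trans (h.measure_ball_two_pow_mul_le x hr n)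

theorem measure_pairBall_le (h : IsDoubling μ Cμ) {x y : X} {t : ℝ} (ht : 0 < t)
    (hxy : dist x y ≤ t) : μ (pairBall x y) ≤ ENNReal.ofReal Cμ * μ (ball y t) := by
  refine (measure_mono (union_subset ?_ ?_)).trans (h.doubling y t ht)
  · exact ball_subset_ball' (by linarith)
  · exact ball_subset_ball (by rw [dist_comm]; linarith)

theorem measure_pairBall_lt_top (h : IsDoubling μ Cμ) (x y : X) : μ (pairBall x y) < ∞ := by
  refine (measure_pairBall_le h (t := dist x y + 1) (by positivity) (by linarith)).trans_lt ?_
  exact ENNReal.mul_lt_top ENNReal.ofReal_lt_top (h.finite _ _ (by positivity))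

theorem measure_pairBall_pos (h : IsDoubling μ Cμ) {x y : X} (hxy : x ≠ y) :
    0 < μ (pairBall x y) :=
  (h.pos x (dist x y) (dist_pos.2 hxy)).trans_le (measure_mono subset_union_left)

theorem kernel_ne_top (h : IsDoubling μ Cμ) (s : ℝ) {x y : X} (hxy : x ≠ y) :
    kernel μ s x y ≠ ∞ := by
  have hd := dist_pos.2 hxy
  refine ENNReal.inv_ne_top.2 (mul_ne_zero (measure_pairBall_pos h hxy).ne' ?_)
  simpa using Real.rpow_pos_of_pos hd s

/-- Off the diagonal the kernel is the real number in the definition of `energyDiff`. -/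
theorem kernel_toReal (μ : Measure X) (s : ℝ) (x y : X) :
    (kernel μ s x y).toReal = (μ.real (pairBall x y) * dist x y ^ s)⁻¹ := by
  rw [kernel, ENNReal.toReal_inv, ENNReal.toReal_mul,
    ENNReal.toReal_ofReal (Real.rpow_nonneg dist_nonneg _), Measure.real]

theorem ofReal_sub_mul_kernel_ne_top (h : IsDoubling μ Cμ) (s : ℝ) (f : X → ℝ) (x y : X) :
    ENNReal.ofReal |f x - f y| * kernel μ s x y ≠ ∞ := by
  rcases eq_or_ne x y with rfl | hxy
  · simp
  · exact ENNReal.mul_ne_top ENNReal.ofReal_ne_top (kernel_ne_top h s hxy)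

end Doubling

section Measurability

theorem setLIntegral_ball_eq [BorelSpace X] (μ : Measure X) (g : X → ℝ≥0∞) (z : X) (r : ℝ) :
    ∫⁻ y in ball z r, g y ∂μ = ∫⁻ y, (if dist y z < r then g y else 0) ∂μ := by
  rw [← lintegral_indicator measurableSet_ball]
  rfl

variable [BorelSpace X] [SecondCountableTopology X] (μ : Measure X) [SFinite μ]

theorem measurable_measure_ball (r : ℝ) : Measurable fun x => μ (ball x r) := by
  have hs : MeasurableSet {p : X × X | dist p.2 p.1 < r} :=
    (isOpen_lt (by fun_prop) continuous_const).measurableSet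
  exact measurable_measure_prodMk_left hs

theorem measurable_measure_pairBall : Measurable fun p : X × X => μ (pairBall p.1 p.2) := by
  have hs : MeasurableSet {q : (X × X) × X |
      dist q.2 q.1.1 < dist q.1.1 q.1.2 ∨ dist q.2 q.1.2 < dist q.1.2 q.1.1} :=
    (IsOpen.union (s₁ := {q : (X × X) × X | dist q.2 q.1.1 < dist q.1.1 q.1.2})
      (s₂ := {q : (X × X) × X | dist q.2 q.1.2 < dist q.1.2 q.1.1})
      (isOpen_lt (by fun_prop) (by fun_prop))
      (isOpen_lt (by fun_prop) (by fun_prop))).measurableSet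
  exact measurable_measure_prodMk_left hs

theorem measurable_kernel (s : ℝ) : Measurable fun p : X × X => kernel μ s p.1 p.2 := by
  have h1 := measurable_measure_pairBall μ
  have h2 : Measurable fun p : X × X => dist p.1 p.2 := by fun_prop
  exact (h1.mul (h2.pow_const s).ennreal_ofReal).inv

theorem measurable_ofReal_sub_mul_kernel (s : ℝ) {f : X → ℝ} (hf : Measurable f) :
    Measurable fun p : X × X => ENNReal.ofReal |f p.1 - f p.2| * kernel μ s p.1 p.2 := by
  have h1 := measurable_kernel μ s
  have h2 : Measurable fun p : X × X => ENNReal.ofReal |f p.1 - f p.2| := by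
    have h3 : Measurable fun p : X × X => f p.1 - f p.2 :=
      (hf.comp measurable_fst).sub (hf.comp measurable_snd)
    exact (measurable_norm.comp h3).ennreal_ofReal
  exact h2.mul h1

theorem measurable_setLIntegral_ball {G : X → X → ℝ≥0∞} (hG : Measurable (Function.uncurry G))
    (r : ℝ) : Measurable fun z => ∫⁻ y in ball z r, G z y ∂μ := by
  simp_rw [setLIntegral_ball_eq]
  have hs : MeasurableSet {p : X × X | dist p.2 p.1 < r} :=
    (isOpen_lt (by fun_prop) continuous_const).measurableSet
  have : Measurable fun p : X × X => if dist p.2 p.1 < r then G p.1 p.2 else 0 :=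
    Measurable.ite hs hG measurable_const
  exact this.lintegral_prod_right'

end Measurability

end NonlocalHarnack

namespace NonlocalHarnack

/-! ### Geometric series -/

theorem two_rpow_neg_le {a : ℝ} (ha0 : 0 ≤ a) (ha1 : a ≤ 1) : (1 / 2 : ℝ) ^ a ≤ 1 - a / 2 := by
  have := rpow_one_add_le_one_add_mul_self (s := -1 / 2) (by norm_num) ha0 ha1
  norm_num at this
  norm_num
  linarith

theorem one_sub_le_two_rpow_neg {a : ℝ} (ha0 : 0 ≤ a) : 1 - a ≤ (1 / 2 : ℝ) ^ a := by
  rw [Real.rpow_def_of_pos (by norm_num), one_div, Real.log_inv]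
  have h1 := Real.add_one_le_exp (-Real.log 2 * a)
  have h2 : Real.log 2 ≤ 1 := by linarith [Real.log_two_lt_d9]
  nlinarith

theorem tsum_ofReal_pow {q : ℝ} (hq0 : 0 ≤ q) (hq1 : q < 1) :
    ∑' n : ℕ, ENNReal.ofReal (q ^ n) = ENNReal.ofReal (1 - q)⁻¹ := by
  rw [ENNReal.ofReal_inv_of_pos (by linarith), ENNReal.ofReal_sub _ hq0, ENNReal.ofReal_one,
    ← ENNReal.tsum_geometric]
  simp_rw [ENNReal.ofReal_pow hq0]

theorem tsum_ofReal_two_rpow_neg_le {a : ℝ} (ha0 : 0 < a) (ha1 : a ≤ 1) :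
    ∑' n : ℕ, ENNReal.ofReal (((1 / 2 : ℝ) ^ a) ^ n) ≤ ENNReal.ofReal (2 / a) := by
  have h1 := two_rpow_neg_le ha0.le ha1
  have h2 : (0 : ℝ) ≤ (1 / 2 : ℝ) ^ a := by positivity
  rw [tsum_ofReal_pow h2 (by linarith)]
  refine ENNReal.ofReal_le_ofReal ?_
  rw [show 2 / a = (a / 2)⁻¹ from (inv_div _ _).symm]
  exact inv_anti₀ (half_pos ha0) (by linarith)

theorem two_pow_mul_rpow_neg {δ : ℝ} (hδ : 0 < δ) (s : ℝ) (n : ℕ) :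
    (2 ^ n * δ) ^ (-s) = δ ^ (-s) * ((1 / 2 : ℝ) ^ s) ^ n := by
  rw [Real.mul_rpow (by positivity) hδ.le, ← Real.rpow_natCast, ← Real.rpow_natCast,
    ← Real.rpow_mul (by norm_num), ← Real.rpow_mul (by norm_num), one_div,
    Real.inv_rpow (by norm_num), ← Real.rpow_neg (by norm_num)]
  ring_nf

theorem half_pow_mul_div_two_pow_rpow_neg {t : ℝ} (ht : 0 < t) (s : ℝ) (n : ℕ) :
    (1 / 2) ^ n * (t / 2 ^ n) ^ (-s) = t ^ (-s) * ((1 / 2 : ℝ) ^ (1 - s)) ^ n := by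
  rw [Real.div_rpow ht.le (by positivity), ← Real.rpow_natCast, ← Real.rpow_natCast,
    ← Real.rpow_natCast, ← Real.rpow_mul (by norm_num), ← Real.rpow_mul (by norm_num), one_div,
    Real.inv_rpow (by norm_num), Real.inv_rpow (by norm_num), ← Real.rpow_neg (by norm_num),
    ← Real.rpow_neg (by norm_num), div_eq_mul_inv, ← Real.rpow_neg (by norm_num),
    mul_left_comm, ← Real.rpow_add (by norm_num)]
  ring_nf

/-! ### The kernel integrated against a cutoff function -/

variable {X : Type u} [MetricSpace X]

/-- The cutoff functions used in the iteration: `1` on `B(x₀,ρ)`, `0` off `B(x₀,ρ')`. -/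
theorem exists_cutoff (x₀ : X) {ρ ρ' : ℝ} (hρ : ρ < ρ') :
    ∃ φ : X → ℝ, Continuous φ ∧ (∀ x, 0 ≤ φ x) ∧ (∀ x, φ x ≤ 1) ∧ (∀ x ∈ ball x₀ ρ, φ x = 1) ∧
      (∀ x, x ∉ ball x₀ ρ' → φ x = 0) ∧ ∀ x y, |φ x - φ y| ≤ dist x y / (ρ' - ρ) := by
  have hd : 0 < ρ' - ρ := by linarith
  refine ⟨fun x => max 0 (min 1 ((ρ' - dist x x₀) / (ρ' - ρ))), by fun_prop, fun x => le_max_left _ _,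
    fun x => max_le zero_le_one (min_le_left _ _), fun x hx => ?_, fun x hx => ?_, fun x y => ?_⟩
  · have : 1 ≤ (ρ' - dist x x₀) / (ρ' - ρ) := (one_le_div hd).2 (by linarith [mem_ball.1 hx])
    simp [this]
  · have : (ρ' - dist x x₀) / (ρ' - ρ) ≤ 0 :=
      div_nonpos_of_nonpos_of_nonneg (by rw [mem_ball] at hx; linarith) hd.le
    exact max_eq_left ((min_le_right _ _).trans this)
  · calc |max 0 (min 1 ((ρ' - dist x x₀) / (ρ' - ρ))) - max 0 (min 1 ((ρ' - dist y x₀) / (ρ' - ρ)))|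
        ≤ |min 1 ((ρ' - dist x x₀) / (ρ' - ρ)) - min 1 ((ρ' - dist y x₀) / (ρ' - ρ))| := by
          refine (abs_max_sub_max_le_max _ _ _ _).trans ?_
          simp
      _ ≤ |(ρ' - dist x x₀) / (ρ' - ρ) - (ρ' - dist y x₀) / (ρ' - ρ)| := by
          refine (abs_min_sub_min_le_max _ _ _ _).trans ?_
          simp
      _ = |dist y x₀ - dist x x₀| / (ρ' - ρ) := by
          rw [← sub_div, abs_div, abs_of_pos hd]
          congr 2
          ring
      _ ≤ dist x y / (ρ' - ρ) := by
          gcongr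
          rw [dist_comm x y]
          exact abs_dist_sub_le y x x₀

variable [MeasurableSpace X] {μ : Measure X} {Cμ : ℝ}

theorem measurableSet_annulus [BorelSpace X] (t : ℝ) (y : X) :
    MeasurableSet {x | t ≤ dist x y ∧ dist x y ≤ 2 * t} := by
  have h1 : IsClosed {x | t ≤ dist x y} := isClosed_le continuous_const (by fun_prop)
  have h2 : IsClosed {x | dist x y ≤ 2 * t} := isClosed_le (by fun_prop) continuous_const
  exact (h1.inter h2).measurableSet

/-- On an annulus of radius `t` the kernel is comparable with `t ^ (-s) / μ(B(y,t))`. -/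
theorem setLIntegral_annulus_kernel_le (h : IsDoubling μ Cμ) [BorelSpace X] {s t : ℝ}
    (hs : 0 < s) (ht : 0 < t) (y : X) :
    ∫⁻ x in {x | t ≤ dist x y ∧ dist x y ≤ 2 * t}, kernel μ s x y ∂μ ≤
      ENNReal.ofReal (Cμ ^ 2 * t ^ (-s)) := by
  have hC : 0 ≤ Cμ := by
    have : Nonempty X := ⟨y⟩
    linarith [h.one_le]
  set m := μ (ball y t) with hm
  have hm0 : m ≠ 0 := (h.pos y t ht).ne'
  have hmt : m ≠ ∞ := (h.finite y t ht).ne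
  have hts : 0 < t ^ s := Real.rpow_pos_of_pos ht s
  have hk : ∀ x ∈ {x | t ≤ dist x y ∧ dist x y ≤ 2 * t},
      kernel μ s x y ≤ (m * ENNReal.ofReal (t ^ s))⁻¹ := by
    intro x hx
    refine ENNReal.inv_le_inv.2 (mul_le_mul' (measure_mono ?_) ?_)
    · exact (ball_subset_ball (by rw [dist_comm]; exact hx.1)).trans subset_union_right
    · exact ENNReal.ofReal_le_ofReal (Real.rpow_le_rpow ht.le hx.1 hs.le)
  calc ∫⁻ x in {x | t ≤ dist x y ∧ dist x y ≤ 2 * t}, kernel μ s x y ∂μ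
      ≤ ∫⁻ _ in {x | t ≤ dist x y ∧ dist x y ≤ 2 * t}, (m * ENNReal.ofReal (t ^ s))⁻¹ ∂μ :=
        setLIntegral_mono' (measurableSet_annulus t y) hk
    _ = (m * ENNReal.ofReal (t ^ s))⁻¹ * μ {x | t ≤ dist x y ∧ dist x y ≤ 2 * t} :=
        setLIntegral_const _ _
    _ ≤ (m * ENNReal.ofReal (t ^ s))⁻¹ * (ENNReal.ofReal Cμ ^ 2 * m) := by
        gcongr
        refine (measure_mono fun x hx => ?_).trans (h.measure_ball_two_pow_mul_le y ht 2)
        rw [mem_ball]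
        linarith [hx.2]
    _ = ENNReal.ofReal Cμ ^ 2 * (m * m⁻¹) * (ENNReal.ofReal (t ^ s))⁻¹ := by
        rw [ENNReal.mul_inv (Or.inl hm0) (Or.inl hmt)]
        ring
    _ = ENNReal.ofReal (Cμ ^ 2 * t ^ (-s)) := by
        rw [ENNReal.mul_inv_cancel hm0 hmt, mul_one, ← ENNReal.ofReal_inv_of_pos hts,
          ← ENNReal.ofReal_pow hC, ← ENNReal.ofReal_mul (by positivity), Real.rpow_neg ht.le]

/-- A function with values in `[0,1]` that is `1/δ`-Lipschitz satisfies
`∫ |φ(x) - φ(y)| k(x,y) dμ(x) ≤ C δ^{-s}`, uniformly in `y`. -/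
theorem lintegral_cutoff_mul_kernel_le (h : IsDoubling μ Cμ) [BorelSpace X] {s δ : ℝ}
    (hs : 0 < s) (hs1 : s < 1) (hδ : 0 < δ) {φ : X → ℝ} (h0 : ∀ x, 0 ≤ φ x) (h1 : ∀ x, φ x ≤ 1)
    (hφ : ∀ x y, |φ x - φ y| ≤ dist x y / δ) (y : X) :
    ∫⁻ x, ENNReal.ofReal |φ x - φ y| * kernel μ s x y ∂μ ≤
      ENNReal.ofReal (Cμ ^ 2 * (2 / s + 4 / (1 - s)) * δ ^ (-s)) := by
  set G : X → ℝ≥0∞ := fun x => ENNReal.ofReal |φ x - φ y| * kernel μ s x y with hG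
  set A : ℝ → Set X := fun t => {x | t ≤ dist x y ∧ dist x y ≤ 2 * t} with hA
  have hms : ∀ t, MeasurableSet (A t) := fun t => measurableSet_annulus t y
  have hcov : (univ : Set X) ⊆
      ({y} ∪ ⋃ n : ℕ, A (2 ^ n * δ)) ∪ ⋃ n : ℕ, A ((δ / 2) / 2 ^ n) := by
    intro x _
    rcases eq_or_ne x y with rfl | hxy
    · exact Or.inl (Or.inl rfl)
    have hd : 0 < dist x y := dist_pos.2 hxy
    rcases le_or_gt δ (dist x y) with hle | hlt
    · obtain ⟨n, hn1, hn2⟩ := exists_nat_pow_near ((one_le_div hδ).2 hle) (one_lt_two)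
      refine Or.inl (Or.inr (mem_iUnion.2 ⟨n, ?_, ?_⟩))
      · exact (le_div_iff₀ hδ).1 hn1
      · have := (div_lt_iff₀ hδ).1 hn2
        rw [pow_succ] at this
        linarith
    · obtain ⟨n, hn1, hn2⟩ := exists_nat_pow_near ((one_le_div hd).2 hlt.le) (one_lt_two)
      refine Or.inr (mem_iUnion.2 ⟨n, ?_, ?_⟩)
      · rw [div_div, ← pow_succ', div_le_iff₀ (by positivity), mul_comm]
        exact ((div_lt_iff₀ hd).1 hn2).le
      · rw [mul_div_assoc', mul_div_cancel₀ _ (two_ne_zero), le_div_iff₀ (by positivity), mul_comm]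
        exact (le_div_iff₀ hd).1 hn1
  have hC0 : 0 ≤ Cμ := by
    have : Nonempty X := ⟨y⟩
    linarith [h.one_le]
  have hle1 : ∀ x, |φ x - φ y| ≤ 1 := fun x => by
    rw [abs_le]
    constructor <;> linarith [h0 x, h1 x, h0 y, h1 y]
  -- In the annuli beyond `δ` the bound `|φ x - φ y| ≤ 1` suffices; within `δ` the Lipschitz bound
  -- is needed.
  have hfar : ∀ n : ℕ, ∫⁻ x in A (2 ^ n * δ), G x ∂μ ≤
      ENNReal.ofReal (Cμ ^ 2 * δ ^ (-s)) * ENNReal.ofReal (((1 / 2 : ℝ) ^ s) ^ n) := by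
    intro n
    calc ∫⁻ x in A (2 ^ n * δ), G x ∂μ ≤ ∫⁻ x in A (2 ^ n * δ), kernel μ s x y ∂μ := by
          refine lintegral_mono fun x => ?_
          refine mul_le_of_le_one_left' ?_
          simpa using hle1 x
      _ ≤ ENNReal.ofReal (Cμ ^ 2 * (2 ^ n * δ) ^ (-s)) :=
          setLIntegral_annulus_kernel_le h hs (by positivity) y
      _ = _ := by
          rw [← ENNReal.ofReal_mul (by positivity), two_pow_mul_rpow_neg hδ, mul_assoc]
  have hnear : ∀ n : ℕ, ∫⁻ x in A ((δ / 2) / 2 ^ n), G x ∂μ ≤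
      ENNReal.ofReal (Cμ ^ 2 * (δ / 2) ^ (-s)) *
        ENNReal.ofReal (((1 / 2 : ℝ) ^ (1 - s)) ^ n) := by
    intro n
    calc ∫⁻ x in A ((δ / 2) / 2 ^ n), G x ∂μ
        ≤ ∫⁻ x in A ((δ / 2) / 2 ^ n), ENNReal.ofReal ((1 / 2) ^ n) * kernel μ s x y ∂μ := by
          refine setLIntegral_mono' (hms _) fun x hx => ?_
          simp only [hG]
          gcongr
          refine (hφ x y).trans ?_
          rw [div_le_iff₀ hδ]
          refine hx.2.trans (le_of_eq ?_)
          rw [one_div, inv_pow]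
          field_simp
      _ = ENNReal.ofReal ((1 / 2) ^ n) * ∫⁻ x in A ((δ / 2) / 2 ^ n), kernel μ s x y ∂μ :=
          lintegral_const_mul' _ _ ENNReal.ofReal_ne_top
      _ ≤ ENNReal.ofReal ((1 / 2) ^ n) *
          ENNReal.ofReal (Cμ ^ 2 * ((δ / 2) / 2 ^ n) ^ (-s)) := by
          gcongr
          exact setLIntegral_annulus_kernel_le h hs (by positivity) y
      _ = _ := by
          rw [← ENNReal.ofReal_mul (by positivity), ← ENNReal.ofReal_mul (by positivity),
            mul_left_comm, half_pow_mul_div_two_pow_rpow_neg (by positivity), mul_assoc]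
  have hy : ∫⁻ x in {y}, G x ∂μ = 0 := by
    rw [setLIntegral_congr_fun (g := fun _ => 0) (measurableSet_singleton y)]
    · simp
    · rintro x rfl
      simp [hG]
  have h2s : (δ / 2) ^ (-s) ≤ 2 * δ ^ (-s) := by
    rw [Real.div_rpow hδ.le (by norm_num), Real.rpow_neg (by norm_num : (0 : ℝ) ≤ 2), div_inv_eq_mul,
      mul_comm]
    gcongr
    calc (2 : ℝ) ^ s ≤ 2 ^ (1 : ℝ) := Real.rpow_le_rpow_of_exponent_le (by norm_num) hs1.le
      _ = 2 := Real.rpow_one 2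
  have h1s : 0 < 1 - s := by linarith
  calc ∫⁻ x, G x ∂μ = ∫⁻ x in univ, G x ∂μ := by rw [setLIntegral_univ]
    _ ≤ ∫⁻ x in ({y} ∪ ⋃ n : ℕ, A (2 ^ n * δ)) ∪ ⋃ n : ℕ, A ((δ / 2) / 2 ^ n), G x ∂μ :=
        lintegral_mono_set hcov
    _ ≤ ((∫⁻ x in {y}, G x ∂μ) + ∑' n : ℕ, ∫⁻ x in A (2 ^ n * δ), G x ∂μ) +
          ∑' n : ℕ, ∫⁻ x in A ((δ / 2) / 2 ^ n), G x ∂μ := by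
        refine (lintegral_union_le _ _ _).trans (add_le_add ?_ (lintegral_iUnion_le _ _))
        exact (lintegral_union_le _ _ _).trans (add_le_add le_rfl (lintegral_iUnion_le _ _))
    _ ≤ (∑' n : ℕ, ENNReal.ofReal (Cμ ^ 2 * δ ^ (-s)) * ENNReal.ofReal (((1 / 2 : ℝ) ^ s) ^ n)) +
          ∑' n : ℕ, ENNReal.ofReal (Cμ ^ 2 * (δ / 2) ^ (-s)) *
            ENNReal.ofReal (((1 / 2 : ℝ) ^ (1 - s)) ^ n) := by
        rw [hy, zero_add]
        exact add_le_add (ENNReal.tsum_le_tsum hfar) (ENNReal.tsum_le_tsum hnear)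
    _ ≤ ENNReal.ofReal (Cμ ^ 2 * δ ^ (-s)) * ENNReal.ofReal (2 / s) +
          ENNReal.ofReal (Cμ ^ 2 * (2 * δ ^ (-s))) * ENNReal.ofReal (2 / (1 - s)) := by
        rw [ENNReal.tsum_mul_left, ENNReal.tsum_mul_left]
        gcongr
        · exact tsum_ofReal_two_rpow_neg_le hs hs1.le
        · exact tsum_ofReal_two_rpow_neg_le h1s (by linarith)
    _ = ENNReal.ofReal (Cμ ^ 2 * (2 / s + 4 / (1 - s)) * δ ^ (-s)) := by
        have hd : 0 < δ ^ (-s) := Real.rpow_pos_of_pos hδ _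
        rw [← ENNReal.ofReal_mul (by positivity), ← ENNReal.ofReal_mul (by positivity),
          ← ENNReal.ofReal_add (by positivity) (by positivity)]
        congr 1
        ring

end NonlocalHarnack

namespace NonlocalHarnack

/-! ### Truncation and cutoff, pointwise -/

/-- Truncation splits oscillation exactly: `|a - b| = |min a k - min b k| + |(a-k)₊ - (b-k)₊|`.
Subtracting `p (a-k)₊` and `q (b-k)₊` therefore lowers the oscillation by at least that of
`p (a-k)₊`, up to a term without oscillation of the function. -/
theorem abs_truncation_add_le {p q : ℝ} (hp0 : 0 ≤ p) (hp1 : p ≤ 1) (a b k : ℝ) :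
    |p * max (a - k) 0 - q * max (b - k) 0| +
      |(a - p * max (a - k) 0) - (b - q * max (b - k) 0)| ≤
      |a - b| + 2 * (max (b - k) 0 * |p - q|) := by
  have hsplit : |min a k - min b k| + |max (a - k) 0 - max (b - k) 0| = |a - b| := by
    rcases le_total a k with h1 | h1 <;> rcases le_total b k with h2 | h2
    · rw [min_eq_left h1, min_eq_left h2, max_eq_right (by linarith), max_eq_right (by linarith)]
      simp
    · rw [min_eq_left h1, min_eq_right h2, max_eq_right (by linarith), max_eq_left (by linarith),
        abs_of_nonpos (by linarith : a - k ≤ 0), abs_of_nonpos (by linarith : 0 - (b - k) ≤ 0),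
        abs_of_nonpos (by linarith : a - b ≤ 0)]
      ring
    · rw [min_eq_right h1, min_eq_left h2, max_eq_left (by linarith), max_eq_right (by linarith),
        abs_of_nonneg (by linarith : 0 ≤ k - b), abs_of_nonneg (by linarith : 0 ≤ a - k - 0),
        abs_of_nonneg (by linarith : 0 ≤ a - b)]
      ring
    · rw [min_eq_right h1, min_eq_right h2, max_eq_left (by linarith), max_eq_left (by linarith)]
      simp
  have ha : a = min a k + max (a - k) 0 := by
    rcases le_total a k with h | h
    · rw [min_eq_left h, max_eq_right (by linarith)]; ring
    · rw [min_eq_right h, max_eq_left (by linarith)]; ring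
  have hb : b = min b k + max (b - k) 0 := by
    rcases le_total b k with h | h
    · rw [min_eq_left h, max_eq_right (by linarith)]; ring
    · rw [min_eq_right h, max_eq_left (by linarith)]; ring
  set wa := max (a - k) 0
  set wb := max (b - k) 0
  have hwb : 0 ≤ wb := le_max_right _ _
  have h1 : |p * wa - q * wb| ≤ p * |wa - wb| + wb * |p - q| := by
    calc |p * wa - q * wb| = |p * (wa - wb) + wb * (p - q)| := by ring_nf
      _ ≤ |p * (wa - wb)| + |wb * (p - q)| := abs_add_le _ _
      _ = _ := by rw [abs_mul, abs_mul, abs_of_nonneg hp0, abs_of_nonneg hwb]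
  have h2 : |(a - p * wa) - (b - q * wb)| ≤
      |min a k - min b k| + (1 - p) * |wa - wb| + wb * |p - q| := by
    calc |(a - p * wa) - (b - q * wb)|
        = |((min a k - min b k) + (1 - p) * (wa - wb)) + -(wb * (p - q))| := by
          congr 1; linear_combination ha - hb
      _ ≤ |(min a k - min b k) + (1 - p) * (wa - wb)| + |-(wb * (p - q))| := abs_add_le _ _
      _ ≤ |min a k - min b k| + |(1 - p) * (wa - wb)| + |-(wb * (p - q))| := by
          gcongr; exact abs_add_le _ _
      _ = _ := by
          rw [abs_neg, abs_mul, abs_mul, abs_of_nonneg (by linarith : 0 ≤ 1 - p),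
            abs_of_nonneg hwb]
  linarith

section Pointwise

variable {X : Type u}

/-- The part of the excess `(U - k)₊` that lies in `P`. -/
noncomputable def excess (U : X → ℝ) (k : ℝ) (P : Set X) : X → ℝ :=
  P.indicator fun x => max (U x - k) 0

theorem excess_nonneg (U : X → ℝ) (k : ℝ) (P : Set X) (x : X) : 0 ≤ excess U k P x :=
  indicator_nonneg (fun _ _ => le_max_right _ _) x

variable {φ : X → ℝ} {P : Set X}

theorem cutoff_mul_excess (hP : ∀ x, x ∉ P → φ x = 0) (U : X → ℝ) (k : ℝ) (x : X) :
    φ x * excess U k P x = φ x * max (U x - k) 0 := by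
  by_cases hx : x ∈ P
  · simp [excess, hx]
  · simp [hP x hx]

theorem abs_cutoff_mul_excess_add_le (h0 : ∀ x, 0 ≤ φ x) (h1 : ∀ x, φ x ≤ 1)
    (hP : ∀ x, x ∉ P → φ x = 0) (U : X → ℝ) (k : ℝ) (x y : X) :
    |φ x * excess U k P x - φ y * excess U k P y| +
      |(U x - φ x * excess U k P x) - (U y - φ y * excess U k P y)| ≤
      |U x - U y| + 2 * ((excess U k P x + excess U k P y) * |φ x - φ y|) := by
  have hx0 := excess_nonneg U k P x
  have hy0 := excess_nonneg U k P y
  have hn := abs_nonneg (φ x - φ y)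
  rw [cutoff_mul_excess hP, cutoff_mul_excess hP]
  by_cases hy : y ∈ P
  · refine (abs_truncation_add_le (h0 x) (h1 x) (U x) (U y) k).trans ?_
    have : excess U k P y = max (U y - k) 0 := by simp [excess, hy]
    rw [← this]
    nlinarith
  · by_cases hx : x ∈ P
    · have h := abs_truncation_add_le (q := φ x) (h0 y) (h1 y) (U y) (U x) k
      have he : excess U k P x = max (U x - k) 0 := by simp [excess, hx]
      rw [← he, abs_sub_comm, abs_sub_comm (_ - _), abs_sub_comm (U y), abs_sub_comm (φ y)] at h
      rw [← he]
      nlinarith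
    · rw [hP x hx, hP y hy]
      simp

/-- Off `P`, in particular off `Ω`, the function `U` may be replaced by anything. -/
theorem abs_cutoff_mul_excess_le_of_notMem (h0 : ∀ x, 0 ≤ φ x)
    (hP : ∀ x, x ∉ P → φ x = 0) (U : X → ℝ) (k : ℝ) {x : X} (hx : x ∉ P) (y : X) :
    |φ x * excess U k P x - φ y * excess U k P y| ≤
      (excess U k P x + excess U k P y) * |φ x - φ y| := by
  have hx0 := excess_nonneg U k P x
  have hy0 := excess_nonneg U k P y
  rw [hP x hx, zero_mul, zero_sub, zero_sub, abs_neg, abs_neg, abs_of_nonneg (h0 y),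
    abs_of_nonneg (mul_nonneg (h0 y) hy0)]
  nlinarith [h0 y, mul_nonneg hx0 (h0 y)]

theorem abs_cutoff_mul_excess_sub_le (h0 : ∀ x, 0 ≤ φ x) (h1 : ∀ x, φ x ≤ 1)
    (hP : ∀ x, x ∉ P → φ x = 0) (U : X → ℝ) (k : ℝ) (x y : X) :
    |φ x * excess U k P x - φ y * excess U k P y| ≤
      |U x - U y| + (excess U k P x + excess U k P y) * |φ x - φ y| := by
  have hx0 := excess_nonneg U k P x
  have hn := abs_nonneg (φ x - φ y)
  by_cases hx : x ∈ P
  · by_cases hy : y ∈ P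
    · have hex : excess U k P x = max (U x - k) 0 := by simp [excess, hx]
      have hey : excess U k P y = max (U y - k) 0 := by simp [excess, hy]
      have hd : |excess U k P x - excess U k P y| ≤ |U x - U y| := by
        rw [hex, hey]
        refine (abs_max_sub_max_le_max _ _ _ _).trans ?_
        simp
      calc |φ x * excess U k P x - φ y * excess U k P y|
          = |φ y * (excess U k P x - excess U k P y) + excess U k P x * (φ x - φ y)| := by ring_nf
        _ ≤ φ y * |excess U k P x - excess U k P y| + excess U k P x * |φ x - φ y| := by
            refine (abs_add_le _ _).trans (le_of_eq ?_)
            rw [abs_mul, abs_mul, abs_of_nonneg (h0 y), abs_of_nonneg hx0]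
        _ ≤ |U x - U y| + (excess U k P x + excess U k P y) * |φ x - φ y| := by
            have := mul_le_of_le_one_left (abs_nonneg (excess U k P x - excess U k P y)) (h1 y)
            nlinarith [mul_nonneg (excess_nonneg U k P y) hn]
    · have := abs_cutoff_mul_excess_le_of_notMem h0 hP U k hy x
      rw [abs_sub_comm, add_comm (excess U k P y), abs_sub_comm (φ y)] at this
      linarith [abs_nonneg (U x - U y)]
  · have := abs_cutoff_mul_excess_le_of_notMem h0 hP U k hx y
    linarith [abs_nonneg (U x - U y)]

end Pointwise

end NonlocalHarnack

namespace NonlocalHarnack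

/-! ### Functions of finite energy and the Caccioppoli inequality for minimizers -/

theorem lintegral_lintegral_add_left {α : Type*} [MeasurableSpace α] {μ : Measure α} [SFinite μ]
    {F : α → α → ℝ≥0∞} (G : α → α → ℝ≥0∞) (hF : Measurable fun p : α × α => F p.1 p.2) :
    (∫⁻ y, ∫⁻ x, F x y ∂μ ∂μ) + ∫⁻ y, ∫⁻ x, G x y ∂μ ∂μ =
      ∫⁻ y, ∫⁻ x, (F x y + G x y) ∂μ ∂μ := by
  rw [← lintegral_add_left hF.lintegral_prod_left']
  refine lintegral_congr fun y => ?_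
  exact (lintegral_add_left (hF.comp measurable_prodMk_right) _).symm

variable {X : Type u} [MetricSpace X] [MeasurableSpace X] {μ : Measure X} {Cμ : ℝ}

section Infinite

theorem abs_sub_eq_top_of_right {a b : EReal} (hb : b = ⊤ ∨ b = ⊥) : (a - b).abs = ⊤ := by
  rcases hb with rfl | rfl
  · rw [sub_eq_add_neg, EReal.neg_top, EReal.add_bot, EReal.abs_bot]
  · rw [sub_eq_add_neg, EReal.neg_bot]
    induction a <;> simp

theorem abs_sub_eq_top_of_left {a b : EReal} (ha : a = ⊤ ∨ a = ⊥) : (a - b).abs = ⊤ := by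
  rcases ha with rfl | rfl
  · induction b
    · simp
    · rw [EReal.top_sub_coe, EReal.abs_top]
    · rw [sub_eq_add_neg, EReal.neg_top, EReal.add_bot, EReal.abs_bot]
  · rw [sub_eq_add_neg, EReal.bot_add, EReal.abs_bot]

/-- A function with finite Gagliardo seminorm on `A` is finite a.e. in `A`. -/
theorem ae_finite_of_gagliardo_lt_top (h : IsDoubling μ Cμ) {s : ℝ} {A : Set X} {u : X → EReal}
    (hu : AEMeasurable u (μ.restrict A)) (hfin : gagliardo μ s A u < ∞) :
    ∀ᵐ x ∂μ.restrict A, u x = ((u x).toReal : EReal) := by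
  have hN : NullMeasurableSet {x | u x = ⊤ ∨ u x = ⊥} (μ.restrict A) :=
    (hu.nullMeasurable (measurableSet_singleton ⊤)).union
      (hu.nullMeasurable (measurableSet_singleton ⊥))
  set N := {x | u x = ⊤ ∨ u x = ⊥} with hNdef
  have hN0 : μ.restrict A N = 0 := by
    by_contra hne
    have hA : μ.restrict A univ ≠ 0 := fun h0 => hne (measure_mono_null (subset_univ _) h0)
    have hle : ∫⁻ y in A, N.indicator (fun _ => (⊤ : ℝ≥0∞)) y ∂μ ≤ gagliardo μ s A u := by
      refine lintegral_mono fun y => ?_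
      by_cases hy : y ∈ N
      · have : ∀ x, (u x - u y).abs / (μ (pairBall x y) * ENNReal.ofReal (dist x y ^ s)) = ⊤ := by
          intro x
          rw [abs_sub_eq_top_of_right hy]
          exact ENNReal.top_div_of_ne_top
            (ENNReal.mul_ne_top (measure_pairBall_lt_top h x y).ne ENNReal.ofReal_ne_top)
        simp_rw [this]
        rw [lintegral_const, ENNReal.top_mul hA]
        exact le_top
      · simp [hy]
    rw [lintegral_indicator_const₀ hN, ENNReal.top_mul hne] at hle
    exact absurd (hle.trans_lt hfin) (lt_irrefl _)
  have : ∀ᵐ x ∂μ.restrict A, x ∉ N := measure_eq_zero_iff_ae_notMem.1 hN0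
  filter_upwards [this] with x hx
  rw [hNdef, mem_ofPred_eq, not_or] at hx
  exact (EReal.coe_toReal hx.1 hx.2).symm

theorem gagliardo_eq_of_ae_eq {s : ℝ} {A : Set X} {u : X → EReal} {U : X → ℝ}
    (hU : ∀ᵐ x ∂μ.restrict A, u x = (U x : EReal)) :
    gagliardo μ s A u =
      ∫⁻ y in A, ∫⁻ x in A, ENNReal.ofReal |U x - U y| * kernel μ s x y ∂μ ∂μ := by
  refine lintegral_congr_ae ?_
  filter_upwards [hU] with y hy
  refine lintegral_congr_ae ?_
  filter_upwards [hU] with x hx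
  rw [hx, hy, abs_coe_sub_coe, div_eq_mul_inv, kernel]

theorem gagliardo_univ_coe (s : ℝ) (f : X → ℝ) :
    gagliardo μ s univ (fun x => (f x : EReal)) = energy μ s f := by
  rw [gagliardo_eq_of_ae_eq (U := f) (by simp), energy]
  simp

end Infinite

section Remainder

/-- The error term of the Caccioppoli inequality, in which only the cutoff function oscillates. -/
noncomputable def cutoffEnergy (μ : Measure X) (s : ℝ) (φ e : X → ℝ) : ℝ≥0∞ :=
  ∫⁻ y, ∫⁻ x, ENNReal.ofReal ((e x + e y) * |φ x - φ y|) * kernel μ s x y ∂μ ∂μ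

variable [BorelSpace X] [SecondCountableTopology X] [SFinite μ]

theorem measurable_cutoffEnergy_integrand (s : ℝ) {φ e : X → ℝ} (hφ : Measurable φ)
    (he : Measurable e) : Measurable fun p : X × X =>
      ENNReal.ofReal ((e p.1 + e p.2) * |φ p.1 - φ p.2|) * kernel μ s p.1 p.2 := by
  have h1 := measurable_kernel μ s
  have h2 : Measurable fun p : X × X => φ p.1 - φ p.2 := by fun_prop
  have h3 : Measurable fun p : X × X => |φ p.1 - φ p.2| := measurable_norm.comp h2
  have h4 : Measurable fun p : X × X => e p.1 + e p.2 := by fun_prop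
  exact (h4.mul h3).ennreal_ofReal.mul h1

theorem cutoffEnergy_le {s : ℝ} {φ e : X → ℝ} (hφ : Measurable φ) (he : Measurable e)
    (he0 : ∀ x, 0 ≤ e x) {L : ℝ≥0∞}
    (hL : ∀ y, ∫⁻ x, ENNReal.ofReal |φ x - φ y| * kernel μ s x y ∂μ ≤ L) :
    cutoffEnergy μ s φ e ≤ 2 * (L * ∫⁻ x, ENNReal.ofReal (e x) ∂μ) := by
  have hK : Measurable fun p : X × X =>
      ENNReal.ofReal |φ p.1 - φ p.2| * kernel μ s p.1 p.2 := measurable_ofReal_sub_mul_kernel μ s hφ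
  have hA : Measurable fun p : X × X =>
      ENNReal.ofReal (e p.1) * (ENNReal.ofReal |φ p.1 - φ p.2| * kernel μ s p.1 p.2) :=
    (he.comp measurable_fst).ennreal_ofReal.mul hK
  have hB : Measurable fun p : X × X =>
      ENNReal.ofReal (e p.2) * (ENNReal.ofReal |φ p.1 - φ p.2| * kernel μ s p.1 p.2) :=
    (he.comp measurable_snd).ennreal_ofReal.mul hK
  have hone : ∫⁻ y, ∫⁻ x, ENNReal.ofReal (e y) *
      (ENNReal.ofReal |φ x - φ y| * kernel μ s x y) ∂μ ∂μ ≤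
        L * ∫⁻ x, ENNReal.ofReal (e x) ∂μ := by
    rw [← lintegral_const_mul _ he.ennreal_ofReal]
    refine lintegral_mono fun y => ?_
    rw [lintegral_const_mul' _ _ ENNReal.ofReal_ne_top, mul_comm]
    exact mul_le_mul_left (hL y) _
  have hswap : ∫⁻ y, ∫⁻ x, ENNReal.ofReal (e x) *
      (ENNReal.ofReal |φ x - φ y| * kernel μ s x y) ∂μ ∂μ =
      ∫⁻ y, ∫⁻ x, ENNReal.ofReal (e y) *
      (ENNReal.ofReal |φ x - φ y| * kernel μ s x y) ∂μ ∂μ := by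
    rw [lintegral_lintegral_swap (f := fun y x => ENNReal.ofReal (e x) *
      (ENNReal.ofReal |φ x - φ y| * kernel μ s x y)) (hA.comp measurable_swap).aemeasurable]
    refine lintegral_congr fun a => lintegral_congr fun b => ?_
    rw [abs_sub_comm, kernel_comm μ s]
  calc cutoffEnergy μ s φ e
      = ∫⁻ y, ∫⁻ x, (ENNReal.ofReal (e x) * (ENNReal.ofReal |φ x - φ y| * kernel μ s x y) +
          ENNReal.ofReal (e y) * (ENNReal.ofReal |φ x - φ y| * kernel μ s x y)) ∂μ ∂μ := by
        refine lintegral_congr fun y => lintegral_congr fun x => ?_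
        rw [ENNReal.ofReal_mul (add_nonneg (he0 x) (he0 y)), ENNReal.ofReal_add (he0 x) (he0 y)]
        ring
    _ = (∫⁻ y, ∫⁻ x, ENNReal.ofReal (e x) *
            (ENNReal.ofReal |φ x - φ y| * kernel μ s x y) ∂μ ∂μ) +
          ∫⁻ y, ∫⁻ x, ENNReal.ofReal (e y) *
            (ENNReal.ofReal |φ x - φ y| * kernel μ s x y) ∂μ ∂μ := by
        rw [lintegral_lintegral_add_left _ hA]
    _ ≤ _ := by
        rw [hswap, two_mul]
        exact add_le_add hone hone

/-- A priori bound, showing that the truncated function is admissible as a test function. -/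
theorem energy_cutoff_mul_excess_le {s : ℝ} {Ω P : Set X} {φ U : X → ℝ} (k : ℝ)
    (hΩ : MeasurableSet Ω) (hPΩ : P ⊆ Ω) (hPm : MeasurableSet P) (hφ : Measurable φ)
    (hU : Measurable U) (h0 : ∀ x, 0 ≤ φ x) (h1 : ∀ x, φ x ≤ 1) (hP : ∀ x, x ∉ P → φ x = 0) :
    energy μ s (fun x => φ x * excess U k P x) ≤
      (∫⁻ y in Ω, ∫⁻ x in Ω, ENNReal.ofReal |U x - U y| * kernel μ s x y ∂μ ∂μ) +
        cutoffEnergy μ s φ (excess U k P) := by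
  have he : Measurable (excess U k P) :=
    Measurable.indicator ((hU.sub_const k).max measurable_const) hPm
  have hR := measurable_cutoffEnergy_integrand (μ := μ) s hφ he
  rw [cutoffEnergy, ← lintegral_indicator hΩ, ← lintegral_add_right _ hR.lintegral_prod_left']
  refine lintegral_mono fun y => ?_
  have hRy : Measurable fun x =>
      ENNReal.ofReal ((excess U k P x + excess U k P y) * |φ x - φ y|) * kernel μ s x y :=
    hR.comp measurable_prodMk_right
  have hle : ∀ x, ENNReal.ofReal |φ x * excess U k P x - φ y * excess U k P y| * kernel μ s x y ≤
      ENNReal.ofReal |U x - U y| * kernel μ s x y +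
        ENNReal.ofReal ((excess U k P x + excess U k P y) * |φ x - φ y|) * kernel μ s x y := by
    intro x
    rw [← add_mul]
    gcongr
    exact (ENNReal.ofReal_le_ofReal (abs_cutoff_mul_excess_sub_le h0 h1 hP U k x y)).trans
      ENNReal.ofReal_add_le
  have hle' : ∀ x, (x ∉ P ∨ y ∉ P) →
      ENNReal.ofReal |φ x * excess U k P x - φ y * excess U k P y| * kernel μ s x y ≤
        ENNReal.ofReal ((excess U k P x + excess U k P y) * |φ x - φ y|) * kernel μ s x y := by
    intro x hxy
    gcongr
    rcases hxy with hx | hy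
    · exact abs_cutoff_mul_excess_le_of_notMem h0 hP U k hx y
    · have := abs_cutoff_mul_excess_le_of_notMem h0 hP U k hy x
      rwa [abs_sub_comm, add_comm (excess U k P y), abs_sub_comm (φ y)] at this
  by_cases hy : y ∈ Ω
  · rw [indicator_of_mem hy, ← lintegral_indicator hΩ, ← lintegral_add_right _ hRy]
    refine lintegral_mono fun x => ?_
    by_cases hx : x ∈ Ω
    · rw [indicator_of_mem hx]
      exact hle x
    · rw [indicator_of_notMem hx, zero_add]
      exact hle' x (Or.inl fun hxP => hx (hPΩ hxP))
  · rw [indicator_of_notMem hy, zero_add]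
    exact lintegral_mono fun x => hle' x (Or.inr fun hyP => hy (hPΩ hyP))

theorem ofReal_mul_add_le {a b c d : ℝ} (ha : 0 ≤ a) (hb : 0 ≤ b) (hd : 0 ≤ d) (hc : 0 ≤ c)
    (K : ℝ≥0∞) (habcd : a + b ≤ c + 2 * d) :
    ENNReal.ofReal a * K + ENNReal.ofReal b * K ≤
      ENNReal.ofReal c * K + 2 * (ENNReal.ofReal d * K) := by
  rw [← add_mul, ← mul_assoc, ← add_mul, ← ENNReal.ofReal_add ha hb,
    show (2 : ℝ≥0∞) = ENNReal.ofReal 2 by simp, ← ENNReal.ofReal_mul zero_le_two,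
    ← ENNReal.ofReal_add hc (by positivity)]
  gcongr

/-- Caccioppoli inequality for a function whose energy does not exceed that of its truncation. -/
theorem energy_le_cutoffEnergy_of_minimal {s : ℝ} {P : Set X} {φ U : X → ℝ} {k : ℝ}
    (hPm : MeasurableSet P) (hφ : Measurable φ) (hU : Measurable U) (h0 : ∀ x, 0 ≤ φ x)
    (h1 : ∀ x, φ x ≤ 1) (hP : ∀ x, x ∉ P → φ x = 0) (hfin : energy μ s U ≠ ∞)
    (hmin : energy μ s U ≤ energy μ s (fun x => U x - φ x * excess U k P x)) :
    energy μ s (fun x => φ x * excess U k P x) ≤ 2 * cutoffEnergy μ s φ (excess U k P) := by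
  rcases eq_or_ne (cutoffEnergy μ s φ (excess U k P)) ∞ with hR | hRfin
  · rw [hR, ENNReal.mul_top two_ne_zero]
    exact le_top
  have he : Measurable (excess U k P) :=
    Measurable.indicator ((hU.sub_const k).max measurable_const) hPm
  have hf : Measurable fun x => φ x * excess U k P x := hφ.mul he
  have hG1 := measurable_ofReal_sub_mul_kernel μ s hf
  have hGU := measurable_ofReal_sub_mul_kernel μ s hU
  have hR := measurable_cutoffEnergy_integrand (μ := μ) s hφ he
  have hsum : energy μ s (fun x => φ x * excess U k P x) +
      energy μ s (fun x => U x - φ x * excess U k P x) ≤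
      energy μ s U + 2 * cutoffEnergy μ s φ (excess U k P) := by
    have h2R : 2 * cutoffEnergy μ s φ (excess U k P) = ∫⁻ y, ∫⁻ x, 2 * (ENNReal.ofReal
        ((excess U k P x + excess U k P y) * |φ x - φ y|) * kernel μ s x y) ∂μ ∂μ := by
      rw [cutoffEnergy, ← lintegral_const_mul' _ _ ENNReal.ofNat_ne_top]
      simp_rw [← lintegral_const_mul' _ _ (ENNReal.ofNat_ne_top (n := 2))]
    rw [h2R]
    unfold energy
    rw [lintegral_lintegral_add_left (μ := μ) (F := fun x y => ENNReal.ofReal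
        |φ x * excess U k P x - φ y * excess U k P y| * kernel μ s x y) _ hG1,
      lintegral_lintegral_add_left (μ := μ) (F := fun x y => ENNReal.ofReal
        |U x - U y| * kernel μ s x y) _ hGU]
    refine lintegral_mono fun y => lintegral_mono fun x => ?_
    exact ofReal_mul_add_le (abs_nonneg _) (abs_nonneg _) (mul_nonneg
        (add_nonneg (excess_nonneg U k P x) (excess_nonneg U k P y)) (abs_nonneg _))
        (abs_nonneg _) _ (abs_cutoff_mul_excess_add_le h0 h1 hP U k x y)
  have hVfin : energy μ s (fun x => U x - φ x * excess U k P x) ≠ ∞ := by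
    refine ne_top_of_le_ne_top ?_ (le_add_self.trans hsum)
    exact ENNReal.add_ne_top.2 ⟨hfin, ENNReal.mul_ne_top ENNReal.ofNat_ne_top hRfin⟩
  rw [add_comm] at hsum
  exact (ENNReal.add_le_add_iff_left hVfin).1 (hsum.trans (add_le_add_left hmin _))

end Remainder

end NonlocalHarnack

namespace NonlocalHarnack

/-! ### The Caccioppoli inequality for subminimizers -/

/-- Holds at infinite values as well: if `a` or `b` is infinite, then both oscillations are `∞`, and
their real values `0`. -/
theorem abs_sub_neg_coe_sub_le (a b : EReal) (c d : ℝ) :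
    |(a - b).abs.toReal - ((a + ((-c : ℝ) : EReal)) - (b + ((-d : ℝ) : EReal))).abs.toReal| ≤
      |c - d| := by
  by_cases hb : b = ⊤ ∨ b = ⊥
  · have hb' : b + ((-d : ℝ) : EReal) = ⊤ ∨ b + ((-d : ℝ) : EReal) = ⊥ := by
      rcases hb with rfl | rfl
      · exact Or.inl (EReal.top_add_coe _)
      · exact Or.inr (EReal.bot_add _)
    rw [abs_sub_eq_top_of_right hb, abs_sub_eq_top_of_right hb']
    simp
  by_cases ha : a = ⊤ ∨ a = ⊥
  · have ha' : a + ((-c : ℝ) : EReal) = ⊤ ∨ a + ((-c : ℝ) : EReal) = ⊥ := by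
      rcases ha with rfl | rfl
      · exact Or.inl (EReal.top_add_coe _)
      · exact Or.inr (EReal.bot_add _)
    rw [abs_sub_eq_top_of_left ha, abs_sub_eq_top_of_left ha']
    simp
  rw [not_or] at ha hb
  lift a to ℝ using ha
  lift b to ℝ using hb
  rw [← EReal.coe_add, ← EReal.coe_add, abs_coe_sub_coe, abs_coe_sub_coe,
    ENNReal.toReal_ofReal (abs_nonneg _), ENNReal.toReal_ofReal (abs_nonneg _)]
  refine (abs_abs_sub_abs_le_abs_sub _ _).trans (le_of_eq ?_)
  congr 1
  ring

/-- Pointwise comparison of the integrand of `F(u, u - f)` with the oscillation of the truncated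
function `f`. Only one of the two points has to be in the set where `u` is finite. -/
theorem abs_cutoff_mul_excess_le_toReal {X : Type u} {Ω P : Set X} {φ U : X → ℝ} {u : X → EReal}
    (k : ℝ) (hPΩ : P ⊆ Ω) (h0 : ∀ x, 0 ≤ φ x) (h1 : ∀ x, φ x ≤ 1) (hP : ∀ x, x ∉ P → φ x = 0) {x y : X}
    (hy : u y = (U y : EReal)) (hx : u x = (U x : EReal) ∨ x ∉ Ω) :
    |φ x * excess U k P x - φ y * excess U k P y| ≤
      ((u x - u y).abs.toReal - ((u x + ((-(φ x * excess U k P x) : ℝ) : EReal)) -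
        (u y + ((-(φ y * excess U k P y) : ℝ) : EReal))).abs.toReal) +
        2 * ((excess U k P x + excess U k P y) * |φ x - φ y|) := by
  rcases hx with hx | hx
  · rw [hx, hy, ← EReal.coe_add, ← EReal.coe_add, abs_coe_sub_coe, abs_coe_sub_coe,
      ENNReal.toReal_ofReal (abs_nonneg _), ENNReal.toReal_ofReal (abs_nonneg _),
      ← sub_eq_add_neg, ← sub_eq_add_neg]
    linarith [abs_cutoff_mul_excess_add_le h0 h1 hP U k x y]
  · have h2 := abs_cutoff_mul_excess_le_of_notMem h0 hP U k (fun hxP => hx (hPΩ hxP)) y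
    have h3 := abs_sub_neg_coe_sub_le (u x) (u y) (φ x * excess U k P x) (φ y * excess U k P y)
    linarith [(abs_le.1 h3).1]

theorem measurable_ereal_abs : Measurable EReal.abs :=
  EReal.measurable_of_measurable_real (by
    simp_rw [EReal.abs_def]
    exact measurable_norm.ennreal_ofReal)

section

variable {X : Type u} [MeasurableSpace X] {μ : Measure X}

theorem aemeasurable_abs_sub {u : X → EReal} (hu : AEMeasurable u μ) (A B : Set X) :
    AEMeasurable (fun z : X × X => (u z.2 - u z.1).abs.toReal)
      ((μ.restrict A).prod (μ.restrict B)) := by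
  have h1 : AEMeasurable (fun z : X × X => u z.1) ((μ.restrict A).prod (μ.restrict B)) :=
    hu.restrict.comp_fst
  have h2 : AEMeasurable (fun z : X × X => u z.2) ((μ.restrict A).prod (μ.restrict B)) :=
    hu.restrict.comp_snd
  have h3 : AEMeasurable (fun z : X × X => u z.2 - u z.1)
      ((μ.restrict A).prod (μ.restrict B)) := by
    simp_rw [sub_eq_add_neg]
    exact h2.add (continuous_neg.measurable.comp_aemeasurable h1)
  exact (measurable_ereal_abs.comp_aemeasurable h3).ennreal_toReal

theorem setLIntegral_setLIntegral_le (G : X → X → ℝ≥0∞) (A B : Set X) :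
    ∫⁻ y in A, ∫⁻ x in B, G x y ∂μ ∂μ ≤ ∫⁻ y, ∫⁻ x, G x y ∂μ ∂μ :=
  (lintegral_mono fun _ => setLIntegral_le_lintegral _ _).trans (setLIntegral_le_lintegral _ _)

/-- A symmetric double integral whose integrand vanishes on `Ωᶜ × Ωᶜ` is an integral against the
measure of the functional `F`. -/
theorem lintegral_lintegral_eq_of_symm [SFinite μ] {G : X → X → ℝ≥0∞} {Ω : Set X}
    (hΩ : MeasurableSet Ω) (hG : Measurable fun p : X × X => G p.1 p.2) (hsymm : ∀ x y, G x y = G y x)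
    (hzero : ∀ x y, x ∉ Ω → y ∉ Ω → G x y = 0) :
    ∫⁻ y, ∫⁻ x, G x y ∂μ ∂μ =
      (∫⁻ y in Ω, ∫⁻ x in Ω, G x y ∂μ ∂μ) + 2 * ∫⁻ y in Ω, ∫⁻ x in Ωᶜ, G x y ∂μ ∂μ := by
  have hsplit : ∀ y, ∫⁻ x, G x y ∂μ = (∫⁻ x in Ω, G x y ∂μ) + ∫⁻ x in Ωᶜ, G x y ∂μ :=
    fun y => (lintegral_add_compl _ hΩ).symm
  have hm : ∀ A : Set X, Measurable fun y => ∫⁻ x in A, G x y ∂μ := fun A =>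
    hG.lintegral_prod_left'
  have hswap : ∫⁻ y in Ωᶜ, ∫⁻ x in Ω, G x y ∂μ ∂μ = ∫⁻ y in Ω, ∫⁻ x in Ωᶜ, G x y ∂μ ∂μ := by
    rw [lintegral_lintegral_swap (f := fun y x => G x y) (hG.comp measurable_swap).aemeasurable]
    simp_rw [hsymm]
  have hnull : ∫⁻ y in Ωᶜ, ∫⁻ x in Ωᶜ, G x y ∂μ ∂μ = 0 := by
    rw [setLIntegral_congr_fun (g := fun _ => 0) hΩ.compl]
    · simp
    · intro y hy
      refine (setLIntegral_congr_fun (g := fun _ => 0) hΩ.compl fun x hx => hzero x y hx hy).trans ?_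
      simp
  rw [← lintegral_add_compl _ hΩ]
  simp_rw [hsplit]
  rw [lintegral_add_left (hm Ω), lintegral_add_left (hm Ω), hswap, hnull]
  ring

end

variable {X : Type u} [MetricSpace X] [MeasurableSpace X] {μ : Measure X} {Cμ : ℝ}
variable [BorelSpace X] [SecondCountableTopology X] [SFinite μ]

/-- Integrated form of `abs_cutoff_mul_excess_le_toReal`, over `y ∈ Ω` and `x ∈ A`. -/
theorem toReal_setLIntegral_cutoff_mul_excess_le (h : IsDoubling μ Cμ) {s : ℝ} {Ω P : Set X}
    {φ U : X → ℝ} {u : X → EReal} {k : ℝ} (hu : AEMeasurable u μ)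
    (hUu : ∀ᵐ x ∂μ.restrict Ω, u x = (U x : EReal)) (hPΩ : P ⊆ Ω) (hPm : MeasurableSet P)
    (hφ : Measurable φ) (hU : Measurable U) (h0 : ∀ x, 0 ≤ φ x) (h1 : ∀ x, φ x ≤ 1)
    (hP : ∀ x, x ∉ P → φ x = 0)
    (hffin : energy μ s (fun x => φ x * excess U k P x) ≠ ∞)
    (hRfin : cutoffEnergy μ s φ (excess U k P) ≠ ∞) {A : Set X}
    (hA : ∀ᵐ x ∂μ.restrict A, u x = (U x : EReal) ∨ x ∉ Ω) :
    (∫⁻ y in Ω, ∫⁻ x in A, ENNReal.ofReal |φ x * excess U k P x - φ y * excess U k P y| *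
        kernel μ s x y ∂μ ∂μ).toReal ≤
      (∫ y in Ω, ∫ x in A, energyDiff μ s u
        (fun x => u x + ((-(φ x * excess U k P x) : ℝ) : EReal)) x y ∂μ ∂μ) +
      2 * (∫⁻ y in Ω, ∫⁻ x in A, ENNReal.ofReal ((excess U k P x + excess U k P y) *
        |φ x - φ y|) * kernel μ s x y ∂μ ∂μ).toReal := by
  set e := excess U k P with he_def
  have he : Measurable e := Measurable.indicator ((hU.sub_const k).max measurable_const) hPm
  have hf : Measurable fun x => φ x * e x := hφ.mul he
  set ν := (μ.restrict Ω).prod (μ.restrict A) with hν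
  set G : X × X → ℝ≥0∞ := fun z => ENNReal.ofReal |φ z.2 * e z.2 - φ z.1 * e z.1| *
    kernel μ s z.2 z.1 with hG
  set R : X × X → ℝ≥0∞ := fun z => ENNReal.ofReal ((e z.2 + e z.1) * |φ z.2 - φ z.1|) *
    kernel μ s z.2 z.1 with hR
  set E : X × X → ℝ := fun z => energyDiff μ s u
    (fun x => u x + ((-(φ x * e x) : ℝ) : EReal)) z.2 z.1 with hE
  have hGm : Measurable G := (measurable_ofReal_sub_mul_kernel μ s hf).comp measurable_swap
  have hRm : Measurable R := (measurable_cutoffEnergy_integrand (μ := μ) s hφ he).comp measurable_swap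
  have hGν : ∫⁻ z, G z ∂ν = ∫⁻ y in Ω, ∫⁻ x in A, ENNReal.ofReal |φ x * e x - φ y * e y| *
      kernel μ s x y ∂μ ∂μ := lintegral_prod _ hGm.aemeasurable
  have hRν : ∫⁻ z, R z ∂ν = ∫⁻ y in Ω, ∫⁻ x in A, ENNReal.ofReal ((e x + e y) * |φ x - φ y|) *
      kernel μ s x y ∂μ ∂μ := lintegral_prod _ hRm.aemeasurable
  have hGfin : ∫⁻ z, G z ∂ν ≠ ∞ := by
    rw [hGν]
    exact ne_top_of_le_ne_top hffin (setLIntegral_setLIntegral_le _ _ _)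
  have hRνfin : ∫⁻ z, R z ∂ν ≠ ∞ := by
    rw [hRν]
    exact ne_top_of_le_ne_top hRfin (setLIntegral_setLIntegral_le _ _ _)
  have hGpt : ∀ z, G z ≠ ∞ := fun z =>
    ofReal_sub_mul_kernel_ne_top h s (fun x => φ x * e x) z.2 z.1
  have hRpt : ∀ z, R z ≠ ∞ := by
    intro z
    rcases eq_or_ne z.2 z.1 with hz | hz
    · simp [hR, hz]
    · exact ENNReal.mul_ne_top ENNReal.ofReal_ne_top (kernel_ne_top h s hz)
  have hGi : Integrable (fun z => (G z).toReal) ν :=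
    integrable_toReal_of_lintegral_ne_top hGm.aemeasurable hGfin
  have hRi : Integrable (fun z => (R z).toReal) ν :=
    integrable_toReal_of_lintegral_ne_top hRm.aemeasurable hRνfin
  have hη : AEMeasurable (fun x => ((-(φ x * e x) : ℝ) : EReal)) μ :=
    hf.neg.coe_real_ereal.aemeasurable
  have hEeq : ∀ z, E z = ((u z.2 - u z.1).abs.toReal -
      ((u z.2 + ((-(φ z.2 * e z.2) : ℝ) : EReal)) -
        (u z.1 + ((-(φ z.1 * e z.1) : ℝ) : EReal))).abs.toReal) *
          (kernel μ s z.2 z.1).toReal := by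
    intro z
    rw [kernel_toReal]
    exact div_eq_mul_inv _ _
  have hEm : AEStronglyMeasurable E ν := by
    have hk := ((measurable_kernel μ s).comp measurable_swap).ennreal_toReal
    have := (((aemeasurable_abs_sub hu Ω A).sub (aemeasurable_abs_sub (hu.add hη) Ω A)).mul
      (hk.aemeasurable (μ := ν))).aestronglyMeasurable
    refine this.congr (Filter.Eventually.of_forall fun z => ?_)
    exact (hEeq z).symm
  have hEle : ∀ z, ‖E z‖ ≤ (G z).toReal := by
    intro z
    rw [hEeq, Real.norm_eq_abs, abs_mul, abs_of_nonneg ENNReal.toReal_nonneg, hG,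
      ENNReal.toReal_mul, ENNReal.toReal_ofReal (abs_nonneg _)]
    exact mul_le_mul_of_nonneg_right (abs_sub_neg_coe_sub_le _ _ _ _) ENNReal.toReal_nonneg
  have hEi : Integrable E ν := hGi.mono' hEm (Filter.Eventually.of_forall hEle)
  have hfst : ∀ᵐ z ∂ν, u z.1 = (U z.1 : EReal) := Measure.quasiMeasurePreserving_fst.ae hUu
  have hsnd : ∀ᵐ z ∂ν, u z.2 = (U z.2 : EReal) ∨ z.2 ∉ Ω := Measure.quasiMeasurePreserving_snd.ae hA
  have hle : ∀ᵐ z ∂ν, (G z).toReal ≤ E z + 2 * (R z).toReal := by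
    filter_upwards [hfst, hsnd] with z hz1 hz2
    have hn : 0 ≤ (e z.2 + e z.1) * |φ z.2 - φ z.1| := mul_nonneg
      (add_nonneg (excess_nonneg U k P z.2) (excess_nonneg U k P z.1)) (abs_nonneg _)
    rw [hEeq, hG, hR]
    simp only
    rw [ENNReal.toReal_mul, ENNReal.toReal_mul, ENNReal.toReal_ofReal (abs_nonneg _),
      ENNReal.toReal_ofReal hn, ← mul_assoc, ← add_mul]
    exact mul_le_mul_of_nonneg_right
      (abs_cutoff_mul_excess_le_toReal k hPΩ h0 h1 hP hz1 hz2) ENNReal.toReal_nonneg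
  have hint := integral_mono_ae hGi (hEi.add (hRi.const_mul 2)) hle
  rw [integral_add' hEi (hRi.const_mul 2), integral_const_mul,
    integral_toReal hGm.aemeasurable (Filter.Eventually.of_forall fun z => (hGpt z).lt_top),
    integral_toReal hRm.aemeasurable (Filter.Eventually.of_forall fun z => (hRpt z).lt_top),
    hGν, hRν, hν, integral_prod _ hEi] at hint
  exact hint

/-- Caccioppoli inequality for subminimizers. No tail term appears, because the error term involves
`u` only through its excess in `P`. -/
theorem energy_le_cutoffEnergy_of_isSubminimizer (h : IsDoubling μ Cμ) {s : ℝ} {Ω P : Set X}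
    {φ U : X → ℝ} {u : X → EReal} {k : ℝ} (hΩ : MeasurableSet Ω) (hu : IsSubminimizer μ s Ω u)
    (hUu : ∀ᵐ x ∂μ.restrict Ω, u x = (U x : EReal)) (hPΩ : P ⊆ Ω) (hPm : MeasurableSet P)
    (hφ : Measurable φ) (hU : Measurable U) (h0 : ∀ x, 0 ≤ φ x) (h1 : ∀ x, φ x ≤ 1)
    (hP : ∀ x, x ∉ P → φ x = 0)
    (hL1 : ∫⁻ x, ENNReal.ofReal (excess U k P x) ∂μ ≠ ∞)
    (hRfin : cutoffEnergy μ s φ (excess U k P) ≠ ∞) :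
    energy μ s (fun x => φ x * excess U k P x) ≤ 2 * cutoffEnergy μ s φ (excess U k P) := by
  set e := excess U k P with he_def
  have he0 : ∀ x, 0 ≤ e x := excess_nonneg U k P
  have he : Measurable e := Measurable.indicator ((hU.sub_const k).max measurable_const) hPm
  have hf : Measurable fun x => φ x * e x := hφ.mul he
  have hffin : energy μ s (fun x => φ x * e x) ≠ ∞ := by
    refine ne_top_of_le_ne_top ?_ (energy_cutoff_mul_excess_le k hΩ hPΩ hPm hφ hU h0 h1 hP)
    rw [← gagliardo_eq_of_ae_eq hUu]
    exact ENNReal.add_ne_top.2 ⟨hu.memDotW.2.ne, hRfin⟩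
  have hη : MemWZero μ s Ω (fun x => ((-(φ x * e x) : ℝ) : EReal)) := by
    refine ⟨⟨hf.neg.coe_real_ereal.aemeasurable, ?_⟩, ?_⟩
    · rw [gagliardo_univ_coe]
      refine ENNReal.add_lt_top.2 ⟨?_, ?_⟩
      · rw [setLIntegral_univ]
        refine lt_of_le_of_lt (lintegral_mono fun x => ?_) hL1.lt_top
        rw [EReal.abs_def, abs_neg, abs_of_nonneg (mul_nonneg (h0 x) (he0 x))]
        exact ENNReal.ofReal_le_ofReal (mul_le_of_le_one_left (he0 x) (h1 x))
      · refine lt_of_le_of_lt (le_of_eq ?_) hffin.lt_top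
        unfold energy
        refine lintegral_congr fun y => lintegral_congr fun x => ?_
        rw [neg_sub_neg, abs_sub_comm]
    · refine (ae_restrict_iff' hΩ.compl).2 (Filter.Eventually.of_forall fun x hx => ?_)
      simp [hP x fun hxP => hx (hPΩ hxP)]
  have hF := hu.le_zero _ hη fun x => by
    rw [← EReal.coe_zero, EReal.coe_le_coe_iff]
    linarith [mul_nonneg (h0 x) (he0 x)]
  have hΩc : ∀ᵐ x ∂μ.restrict Ωᶜ, u x = (U x : EReal) ∨ x ∉ Ω :=
    (ae_restrict_iff' hΩ.compl).2 (Filter.Eventually.of_forall fun x hx => Or.inr hx)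
  have hin := toReal_setLIntegral_cutoff_mul_excess_le h hu.aemeasurable hUu hPΩ hPm hφ hU h0 h1 hP
    hffin hRfin (hUu.mono fun x hx => Or.inl hx)
  have hout := toReal_setLIntegral_cutoff_mul_excess_le h hu.aemeasurable hUu hPΩ hPm hφ hU h0 h1 hP
    hffin hRfin hΩc
  have hGfin : ∀ A B : Set X, ∫⁻ y in A, ∫⁻ x in B, ENNReal.ofReal |φ x * e x - φ y * e y| *
      kernel μ s x y ∂μ ∂μ ≠ ∞ := fun A B =>
    ne_top_of_le_ne_top hffin (setLIntegral_setLIntegral_le _ _ _)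
  have hRfin' : ∀ A B : Set X, ∫⁻ y in A, ∫⁻ x in B, ENNReal.ofReal ((e x + e y) * |φ x - φ y|) *
      kernel μ s x y ∂μ ∂μ ≠ ∞ := fun A B =>
    ne_top_of_le_ne_top hRfin (setLIntegral_setLIntegral_le _ _ _)
  have hGeq : energy μ s (fun x => φ x * e x) = _ :=
    lintegral_lintegral_eq_of_symm (G := fun x y => ENNReal.ofReal |φ x * e x - φ y * e y| *
      kernel μ s x y) hΩ (measurable_ofReal_sub_mul_kernel μ s hf)
      (fun x y => by rw [abs_sub_comm, kernel_comm]) (fun x y hx hy => by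
        rw [hP x fun hxP => hx (hPΩ hxP), hP y fun hyP => hy (hPΩ hyP)]; simp)
  have hReq : cutoffEnergy μ s φ e = _ :=
    lintegral_lintegral_eq_of_symm (G := fun x y => ENNReal.ofReal ((e x + e y) * |φ x - φ y|) *
      kernel μ s x y) hΩ (measurable_cutoffEnergy_integrand s hφ he)
      (fun x y => by rw [abs_sub_comm, kernel_comm, add_comm]) (fun x y hx hy => by
        rw [hP x fun hxP => hx (hPΩ hxP), hP y fun hyP => hy (hPΩ hyP)]; simp)
  rw [functionalF] at hF
  rw [← ENNReal.toReal_le_toReal hffin (ENNReal.mul_ne_top ENNReal.ofNat_ne_top hRfin),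
    ENNReal.toReal_mul, hGeq, hReq,
    ENNReal.toReal_add (hGfin _ _) (ENNReal.mul_ne_top ENNReal.ofNat_ne_top (hGfin _ _)),
    ENNReal.toReal_add (hRfin' _ _) (ENNReal.mul_ne_top ENNReal.ofNat_ne_top (hRfin' _ _)),
    ENNReal.toReal_mul, ENNReal.toReal_mul]
  simp only [ENNReal.toReal_ofNat]
  linarith

end NonlocalHarnack

namespace NonlocalHarnack

/-! ### Upper gradients from local Lipschitz bounds -/

variable {X : Type u} [MetricSpace X]

/-- The arc-length function of a continuous curve of bounded variation is continuous. -/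
theorem continuousOn_variationOnFromTo {γ : ℝ → X} {a b : ℝ} (hab : a ≤ b)
    (hc : ContinuousOn γ (Icc a b)) (hv : BoundedVariationOn γ (Icc a b)) :
    ContinuousOn (variationOnFromTo γ (Icc a b) a) (Icc a b) := by
  intro x hx
  have ha : a ∈ Icc a b := left_mem_Icc.2 hab
  have hl := variationOnFromTo.tendsto_left ha hx hv.locallyBoundedVariationOn
    ((hc x hx).mono_left (nhdsWithin_mono x (inter_subset_left (t := Iio x))))
  have hr := variationOnFromTo.tendsto_right ha hx hv.locallyBoundedVariationOn
    ((hc x hx).mono_left (nhdsWithin_mono x (inter_subset_left (t := Ioi x))))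
  rw [dist_self, sub_zero] at hl
  rw [dist_self, add_zero] at hr
  have hs : Icc a b ⊆ (Icc a b ∩ Iio x) ∪ {x} ∪ (Icc a b ∩ Ioi x) := by
    intro y hy
    rcases lt_trichotomy y x with h | h | h
    · exact Or.inl (Or.inl ⟨hy, h⟩)
    · exact Or.inl (Or.inr h)
    · exact Or.inr ⟨hy, h⟩
  refine ContinuousWithinAt.mono ?_ hs
  refine ContinuousWithinAt.union (ContinuousWithinAt.union hl ?_) hr
  exact continuousWithinAt_singleton

theorem image_variationOnFromTo {γ : ℝ → X} {a b : ℝ} (hab : a ≤ b)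
    (hc : ContinuousOn γ (Icc a b)) (hv : BoundedVariationOn γ (Icc a b)) :
    Icc 0 (variationOnFromTo γ (Icc a b) a b) ⊆ variationOnFromTo γ (Icc a b) a '' Icc a b := by
  have := intermediate_value_Icc hab (continuousOn_variationOnFromTo hab hc hv)
  rwa [variationOnFromTo.self] at this

/-- The arc-length parametrization of a rectifiable curve is `1`-Lipschitz. -/
theorem dist_naturalParameterization_le {γ : ℝ → X} {a b : ℝ} (hab : a ≤ b)
    (hc : ContinuousOn γ (Icc a b)) (hv : BoundedVariationOn γ (Icc a b)) {t t' : ℝ}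
    (ht : t ∈ Icc 0 (variationOnFromTo γ (Icc a b) a b))
    (ht' : t' ∈ Icc 0 (variationOnFromTo γ (Icc a b) a b)) (htt : t ≤ t') :
    dist (naturalParameterization γ (Icc a b) a t) (naturalParameterization γ (Icc a b) a t') ≤
      t' - t := by
  have hu := has_unit_speed_naturalParameterization γ hv.locallyBoundedVariationOn
    (left_mem_Icc.2 hab) (image_variationOnFromTo hab hc hv ht)
    (image_variationOnFromTo hab hc hv ht')
  rw [NNReal.coe_one, one_mul] at hu
  have he := eVariationOn.edist_le (naturalParameterization γ (Icc a b) a)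
    (s := variationOnFromTo γ (Icc a b) a '' Icc a b ∩ Icc t t')
    ⟨image_variationOnFromTo hab hc hv ht, left_mem_Icc.2 htt⟩
    ⟨image_variationOnFromTo hab hc hv ht', right_mem_Icc.2 htt⟩
  rw [hu, edist_dist] at he
  exact (ENNReal.ofReal_le_ofReal_iff (by linarith)).1 he

variable [MeasurableSpace X]

/-- If `|w(x) - w(x')| ≤ d(x,x') g(z)` whenever `x` and `x'` are in `B(z,h)`, for a fixed scale
`h > 0`, then `g` is an upper gradient of `w`: subdivide the curve into arcs of length less than
`h`. -/
theorem isUpperGradient_of_local_lipschitz {g : X → ℝ≥0∞} {w : X → ℝ} {h : ℝ} (hh : 0 < h)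
    (hg : Measurable g)
    (hgw : ∀ z x x' : X, dist x z < h → dist x' z < h →
      ENNReal.ofReal |w x - w x'| ≤ ENNReal.ofReal (dist x x') * g z) :
    IsUpperGradient g w := by
  refine ⟨hg, fun a b γ hab hc hv => ?_⟩
  rw [curveIntegral]
  set L := variationOnFromTo γ (Icc a b) a b with hL
  set σ := naturalParameterization γ (Icc a b) a with hσ
  have hL0 : 0 ≤ L := variationOnFromTo.nonneg_of_le _ _ hab
  have hσa : σ 0 = γ a := by
    have := edist_naturalParameterization_eq_zero hv.locallyBoundedVariationOn
      (left_mem_Icc.2 hab) (left_mem_Icc.2 hab)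
    rw [variationOnFromTo.self] at this
    exact edist_eq_zero.1 this
  have hσb : σ L = γ b := edist_eq_zero.1 (edist_naturalParameterization_eq_zero
    hv.locallyBoundedVariationOn (left_mem_Icc.2 hab) (right_mem_Icc.2 hab))
  rw [← hσa, ← hσb]
  have hlip : ∀ {t t' : ℝ}, 0 ≤ t → t ≤ t' → t' ≤ L → dist (σ t) (σ t') ≤ t' - t :=
    fun h0 h1 h2 => dist_naturalParameterization_le hab hc hv ⟨h0, h1.trans h2⟩
      ⟨h0.trans h1, h2⟩ h1
  -- On an arc shorter than `h`, the hypothesis applies with every point of the arc as centre, and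
  -- averaging over the arc gives the bound.
  have hshort : ∀ {t t' : ℝ}, 0 ≤ t → t ≤ t' → t' ≤ L → t' - t < h →
      ENNReal.ofReal |w (σ t) - w (σ t')| ≤ ∫⁻ τ in Ioc t t', g (σ τ) := by
    intro t t' h0 h1 h2 h3
    rcases h1.eq_or_lt with rfl | h1'
    · simp
    have hpos : ENNReal.ofReal (t' - t) ≠ 0 := by simpa using h1'
    rw [← ENNReal.mul_le_mul_iff_right hpos ENNReal.ofReal_ne_top]
    have hm : ∀ τ ∈ Ioc t t', ENNReal.ofReal |w (σ t) - w (σ t')| ≤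
        ENNReal.ofReal (t' - t) * g (σ τ) := by
      intro τ hτ
      refine (hgw (σ τ) (σ t) (σ t') ?_ ?_).trans ?_
      · exact (hlip h0 hτ.1.le (hτ.2.trans h2)).trans_lt (by linarith [hτ.2])
      · rw [dist_comm]
        exact (hlip (h0.trans hτ.1.le) hτ.2 h2).trans_lt (by linarith [hτ.1])
      · gcongr
        exact hlip h0 h1 h2
    calc ENNReal.ofReal (t' - t) * ENNReal.ofReal |w (σ t) - w (σ t')|
        = ∫⁻ _ in Ioc t t', ENNReal.ofReal |w (σ t) - w (σ t')| := by
          rw [setLIntegral_const, Real.volume_Ioc, mul_comm]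
      _ ≤ ∫⁻ τ in Ioc t t', ENNReal.ofReal (t' - t) * g (σ τ) :=
          setLIntegral_mono' measurableSet_Ioc hm
      _ = ENNReal.ofReal (t' - t) * ∫⁻ τ in Ioc t t', g (σ τ) :=
          lintegral_const_mul' _ _ ENNReal.ofReal_ne_top
  have hind : ∀ n : ℕ, ∀ t, 0 ≤ t → t ≤ L → t ≤ n * (h / 2) →
      ENNReal.ofReal |w (σ 0) - w (σ t)| ≤ ∫⁻ τ in Ioc 0 t, g (σ τ) := by
    intro n
    induction n with
    | zero =>
      intro t h0 _ h2
      have : t = 0 := le_antisymm (by simpa using h2) h0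
      simp [this]
    | succ n ih =>
      intro t h0 h1 h2
      set t₀ := max 0 (t - h / 2) with ht₀
      have ht₀0 : 0 ≤ t₀ := le_max_left _ _
      have ht₀t : t₀ ≤ t := max_le h0 (by linarith)
      have hA := ih t₀ ht₀0 (ht₀t.trans h1) (max_le (by positivity) (by
        push_cast at h2; linarith))
      have hB := hshort ht₀0 ht₀t h1 (by have := le_max_right 0 (t - h / 2); linarith)
      calc ENNReal.ofReal |w (σ 0) - w (σ t)|
          ≤ ENNReal.ofReal (|w (σ 0) - w (σ t₀)| + |w (σ t₀) - w (σ t)|) :=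
            ENNReal.ofReal_le_ofReal (abs_sub_le _ _ _)
        _ ≤ ENNReal.ofReal |w (σ 0) - w (σ t₀)| + ENNReal.ofReal |w (σ t₀) - w (σ t)| :=
            ENNReal.ofReal_add_le
        _ ≤ (∫⁻ τ in Ioc 0 t₀, g (σ τ)) + ∫⁻ τ in Ioc t₀ t, g (σ τ) := add_le_add hA hB
        _ = ∫⁻ τ in Ioc 0 t, g (σ τ) := by
            rw [← lintegral_union measurableSet_Ioc (Ioc_disjoint_Ioc_of_le le_rfl),
              Ioc_union_Ioc_eq_Ioc ht₀0 ht₀t]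
  obtain ⟨n, hn⟩ := exists_nat_ge (L / (h / 2))
  refine (hind n L hL0 le_rfl ((div_le_iff₀ (by positivity)).1 hn)).trans ?_
  exact lintegral_mono_set Ioc_subset_Icc_self

end NonlocalHarnack

namespace NonlocalHarnack

/-! ### Faber–Krahn inequalities -/

theorem measure_le_two_mul_measure_diff {α : Type*} [MeasurableSpace α] {μ : Measure α}
    {B S : Set α} (hB : μ B ≠ ∞)
    (hBS : 2 * μ S ≤ μ B) : μ B ≤ 2 * μ (B \ S) := by
  have h1 : μ B ≤ μ (B \ S) + μ S :=
    (measure_mono (by rw [sdiff_union_self]; exact subset_union_left)).trans (measure_union_le _ _)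
  have h2 : μ B + μ B ≤ 2 * μ (B \ S) + μ B := by
    calc μ B + μ B = 2 * μ B := (two_mul _).symm
      _ ≤ 2 * (μ (B \ S) + μ S) := by gcongr
      _ = 2 * μ (B \ S) + 2 * μ S := mul_add _ _ _
      _ ≤ _ := by gcongr
  exact (ENNReal.add_le_add_iff_right hB).1 h2

variable {X : Type u} [MetricSpace X] [MeasurableSpace X] {μ : Measure X} {Cμ : ℝ}

/-- An `L¹` Faber–Krahn inequality for the Gagliardo seminorm: if all balls of radius `t` that meet
the support of `f ≥ 0` have at least twice the measure of the support, then
`∫ f ≤ A t^s [f]`, with the seminorm `[f]` of `f`. -/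
def HasFaberKrahn (μ : Measure X) (s A : ℝ) : Prop :=
  ∀ f : X → ℝ, Measurable f → (∀ x, 0 ≤ f x) → ∫⁻ x, ENNReal.ofReal (f x) ∂μ ≠ ∞ → ∀ t : ℝ, 0 < t →
    (∀ z y, y ∈ ball z t → f y ≠ 0 → 2 * μ {x | f x ≠ 0} ≤ μ (ball z t)) →
      ∫⁻ x, ENNReal.ofReal (f x) ∂μ ≤ ENNReal.ofReal (A * t ^ s) * energy μ s f

/-- In every doubling space the Faber–Krahn inequality holds with a constant independent of `s`: for
`y` in the support of `f`, the difference `f(y) - f(x)` equals `f(y)` for at least half of the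
points `x` of `B(y,t)`. -/
theorem IsDoubling.hasFaberKrahn [BorelSpace X] [SecondCountableTopology X] [SFinite μ]
    (h : IsDoubling μ Cμ) {s : ℝ} (hs : 0 < s) : HasFaberKrahn μ s (2 * Cμ) := by
  intro f hf hf0 _ t ht hS
  rw [energy, ← lintegral_const_mul' _ _ ENNReal.ofReal_ne_top]
  refine lintegral_mono fun y => ?_
  rcases eq_or_ne (f y) 0 with hfy | hfy
  · simp [hfy]
  have hC : 0 < Cμ := by
    have : Nonempty X := ⟨y⟩
    linarith [h.one_le]
  set S := {x | f x ≠ 0} with hSdef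
  have hSm : MeasurableSet S := hf (measurableSet_singleton 0).compl
  have hV0 : μ (ball y t) ≠ 0 := (h.pos y t ht).ne'
  have hVt : μ (ball y t) ≠ ∞ := (h.finite y t ht).ne
  have hts : 0 < t ^ s := Real.rpow_pos_of_pos ht s
  have hhalf := measure_le_two_mul_measure_diff hVt (hS y y (mem_ball_self ht) hfy)
  set K := (ENNReal.ofReal Cμ * μ (ball y t) * ENNReal.ofReal (t ^ s))⁻¹ with hK
  have hlow : ENNReal.ofReal (f y) * K * μ (ball y t \ S) ≤
      ∫⁻ x, ENNReal.ofReal |f x - f y| * kernel μ s x y ∂μ := by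
    rw [← setLIntegral_const]
    refine le_trans (setLIntegral_mono' (measurableSet_ball.diff hSm) fun x hx => ?_)
      (setLIntegral_le_lintegral _ _)
    have hfx : f x = 0 := by
      by_contra hne
      exact hx.2 hne
    rw [hfx, zero_sub, abs_neg, abs_of_nonneg (hf0 y)]
    gcongr
    refine ENNReal.inv_le_inv.2 (mul_le_mul' (measure_pairBall_le h ht hx.1.le) ?_)
    exact ENNReal.ofReal_le_ofReal (Real.rpow_le_rpow dist_nonneg hx.1.le hs.le)
  have hC0 : ENNReal.ofReal Cμ ≠ 0 := by simpa using hC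
  have hts0 : ENNReal.ofReal (t ^ s) ≠ 0 := by simpa using hts
  calc ENNReal.ofReal (f y)
      = ENNReal.ofReal (f y) * K * (ENNReal.ofReal Cμ * ENNReal.ofReal (t ^ s)) * μ (ball y t) := by
        have : K * (ENNReal.ofReal Cμ * μ (ball y t) * ENNReal.ofReal (t ^ s)) = 1 :=
          ENNReal.inv_mul_cancel (mul_ne_zero (mul_ne_zero hC0 hV0) hts0)
            (ENNReal.mul_ne_top (ENNReal.mul_ne_top ENNReal.ofReal_ne_top hVt)
              ENNReal.ofReal_ne_top)
        calc ENNReal.ofReal (f y) = ENNReal.ofReal (f y) * 1 := (mul_one _).symm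
          _ = _ := by rw [← this]; ring
    _ ≤ ENNReal.ofReal (f y) * K * (ENNReal.ofReal Cμ * ENNReal.ofReal (t ^ s)) *
          (2 * μ (ball y t \ S)) := by gcongr
    _ = ENNReal.ofReal (2 * Cμ * t ^ s) * (ENNReal.ofReal (f y) * K * μ (ball y t \ S)) := by
        rw [ENNReal.ofReal_mul (by positivity), ENNReal.ofReal_mul (by norm_num),
          ENNReal.ofReal_ofNat]
        ring
    _ ≤ _ := by gcongr

/-! ### Averages over balls of a fixed radius -/

section Averages

variable [BorelSpace X] [SecondCountableTopology X] [SFinite μ]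

theorem lintegral_average_eq (F : X → ℝ≥0∞) (hF : Measurable F) (t : ℝ) :
    ∫⁻ z, (μ (ball z t))⁻¹ * ∫⁻ x in ball z t, F x ∂μ ∂μ =
      ∫⁻ x, F x * ∫⁻ z in ball x t, (μ (ball z t))⁻¹ ∂μ ∂μ := by
  have hs : MeasurableSet {p : X × X | dist p.2 p.1 < t} :=
    (isOpen_lt (by fun_prop) continuous_const).measurableSet
  have hm : Measurable fun p : X × X =>
      (μ (ball p.1 t))⁻¹ * (if dist p.2 p.1 < t then F p.2 else 0) :=
    ((measurable_measure_ball μ t).inv.comp measurable_fst).mul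
      (Measurable.ite hs (hF.comp measurable_snd) measurable_const)
  have h1 : ∀ z, (μ (ball z t))⁻¹ * ∫⁻ x in ball z t, F x ∂μ =
      ∫⁻ x, (μ (ball z t))⁻¹ * (if dist x z < t then F x else 0) ∂μ := fun z => by
    rw [setLIntegral_ball_eq, lintegral_const_mul]
    exact Measurable.ite measurableSet_ball hF measurable_const
  simp_rw [h1]
  rw [lintegral_lintegral_swap hm.aemeasurable]
  refine lintegral_congr fun x => ?_
  rw [setLIntegral_ball_eq, ← lintegral_const_mul]
  · refine lintegral_congr fun z => ?_
    rw [dist_comm x z]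
    split_ifs
    · exact mul_comm _ _
    · simp
  · exact Measurable.ite measurableSet_ball (measurable_measure_ball μ t).inv measurable_const

theorem lintegral_average_le (h : IsDoubling μ Cμ) {F : X → ℝ≥0∞} (hF : Measurable F) {t : ℝ}
    (ht : 0 < t) : ∫⁻ z, (μ (ball z t))⁻¹ * ∫⁻ x in ball z t, F x ∂μ ∂μ ≤
      ENNReal.ofReal Cμ * ∫⁻ x, F x ∂μ := by
  rw [lintegral_average_eq F hF, ← lintegral_const_mul _ hF]
  refine lintegral_mono fun x => ?_
  rw [mul_comm]
  gcongr
  have hV0 : μ (ball x t) ≠ 0 := (h.pos x t ht).ne'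
  have hVt : μ (ball x t) ≠ ∞ := (h.finite x t ht).ne
  calc ∫⁻ z in ball x t, (μ (ball z t))⁻¹ ∂μ
      ≤ ∫⁻ _ in ball x t, ENNReal.ofReal Cμ * (μ (ball x t))⁻¹ ∂μ := by
        refine setLIntegral_mono' measurableSet_ball fun z hz => ?_
        have h1 : μ (ball x t) ≤ ENNReal.ofReal Cμ ^ 1 * μ (ball z t) :=
          h.measure_ball_le_of_subset ht 1 (by
            rw [dist_comm]; linarith [mem_ball.1 hz])
        rw [pow_one] at h1
        rw [ENNReal.inv_le_iff_inv_le, ENNReal.mul_inv (Or.inr (ENNReal.inv_ne_top.2 hV0))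
          (Or.inl ENNReal.ofReal_ne_top), inv_inv, mul_comm, ← div_eq_mul_inv]
        exact ENNReal.div_le_of_le_mul' h1
    _ = ENNReal.ofReal Cμ * (μ (ball x t))⁻¹ * μ (ball x t) := setLIntegral_const _ _
    _ = ENNReal.ofReal Cμ := by rw [mul_assoc, ENNReal.inv_mul_cancel hV0 hVt, mul_one]

theorem lintegral_le_lintegral_average (h : IsDoubling μ Cμ) {F : X → ℝ≥0∞} (hF : Measurable F)
    {t : ℝ} (ht : 0 < t) : ∫⁻ x, F x ∂μ ≤
      ENNReal.ofReal Cμ * ∫⁻ z, (μ (ball z t))⁻¹ * ∫⁻ x in ball z t, F x ∂μ ∂μ := by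
  rw [lintegral_average_eq F hF, ← lintegral_const_mul' _ _ ENNReal.ofReal_ne_top]
  refine lintegral_mono fun x => ?_
  have hV0 : μ (ball x t) ≠ 0 := (h.pos x t ht).ne'
  have hVt : μ (ball x t) ≠ ∞ := (h.finite x t ht).ne
  have hC : ENNReal.ofReal Cμ ≠ 0 := by
    have : Nonempty X := ⟨x⟩
    simpa using lt_of_lt_of_le one_pos h.one_le
  have h1 : (ENNReal.ofReal Cμ)⁻¹ ≤ ∫⁻ z in ball x t, (μ (ball z t))⁻¹ ∂μ := by
    calc (ENNReal.ofReal Cμ)⁻¹ = (ENNReal.ofReal Cμ * μ (ball x t))⁻¹ * μ (ball x t) := by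
          rw [ENNReal.mul_inv (Or.inl hC) (Or.inl ENNReal.ofReal_ne_top), mul_assoc,
            ENNReal.inv_mul_cancel hV0 hVt, mul_one]
      _ = ∫⁻ _ in ball x t, (ENNReal.ofReal Cμ * μ (ball x t))⁻¹ ∂μ :=
          (setLIntegral_const _ _).symm
      _ ≤ _ := by
          refine setLIntegral_mono' measurableSet_ball fun z hz => ENNReal.inv_le_inv.2 ?_
          have := h.measure_ball_le_of_subset (z := z) (R := t) ht 1 (by
            linarith [mem_ball.1 hz])
          rwa [pow_one] at this
  calc F x = ENNReal.ofReal Cμ * (F x * (ENNReal.ofReal Cμ)⁻¹) := by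
        rw [mul_left_comm, ENNReal.mul_inv_cancel hC ENNReal.ofReal_ne_top, mul_one]
    _ ≤ _ := by gcongr

end Averages

end NonlocalHarnack

namespace NonlocalHarnack

/-! ### Averages with a Lipschitz kernel -/

section Bump

variable {X : Type u} [MetricSpace X]

/-- The Lipschitz kernel `(1 - d(x,y)/h)₊`. -/
noncomputable def bump (h : ℝ) (x y : X) : ℝ := max 0 (1 - dist x y / h)

theorem bump_nonneg (h : ℝ) (x y : X) : 0 ≤ bump h x y := le_max_left _ _

theorem bump_le_one {h : ℝ} (hh : 0 < h) (x y : X) : bump h x y ≤ 1 :=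
  max_le zero_le_one (by have : 0 ≤ dist x y / h := by positivity
                         linarith)

theorem bump_eq_zero {h : ℝ} (hh : 0 < h) {x y : X} (hxy : h ≤ dist x y) : bump h x y = 0 :=
  max_eq_left (by have := (one_le_div hh).2 hxy; linarith)

theorem half_le_bump {h : ℝ} (hh : 0 < h) {x y : X} (hxy : dist x y ≤ h / 2) :
    1 / 2 ≤ bump h x y := by
  refine le_trans ?_ (le_max_right _ _)
  have : dist x y / h ≤ 1 / 2 := by
    rw [div_le_iff₀ hh]
    linarith
  linarith

theorem abs_bump_sub_le {h : ℝ} (hh : 0 < h) (x x' y : X) :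
    |bump h x y - bump h x' y| ≤ dist x x' / h := by
  refine (abs_max_sub_max_le_max _ _ _ _).trans ?_
  rw [sub_self, abs_zero, max_eq_right (abs_nonneg _)]
  calc |1 - dist x y / h - (1 - dist x' y / h)| = |dist x' y - dist x y| / h := by
        rw [show 1 - dist x y / h - (1 - dist x' y / h) = (dist x' y - dist x y) / h by ring,
          abs_div, abs_of_pos hh]
    _ ≤ dist x x' / h := by
        gcongr
        rw [dist_comm x x']
        exact abs_dist_sub_le x' x y

theorem continuous_bump (h : ℝ) : Continuous fun p : X × X => bump h p.1 p.2 := by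
  unfold bump
  fun_prop

end Bump

variable {X : Type u} [MetricSpace X] [MeasurableSpace X] {μ : Measure X} {Cμ : ℝ}

/-- The integral of `F` against the kernel `bump h x`. -/
noncomputable def bumpIntegral (μ : Measure X) (h : ℝ) (F : X → ℝ) (x : X) : ℝ :=
  ∫ y, bump h x y * F y ∂μ

/-- The average of `f` around `x` with respect to the kernel `bump h x`. Its local Lipschitz
constants are controlled by the oscillation of `f` at scale `2h`. -/
noncomputable def mollify (μ : Measure X) (h : ℝ) (f : X → ℝ) (x : X) : ℝ :=
  bumpIntegral μ h f x / bumpIntegral μ h (fun _ => 1) x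

/-- The mean of `|f - f(z)|` over `B(z,r)`. -/
noncomputable def meanOsc (μ : Measure X) (f : X → ℝ) (r : ℝ) (z : X) : ℝ≥0∞ :=
  (μ (ball z r))⁻¹ * ∫⁻ y in ball z r, ENNReal.ofReal |f y - f z| ∂μ

theorem meanOsc_eq_ofReal (hd : IsDoubling μ Cμ) {f : X → ℝ} (hf : Integrable f μ) {r : ℝ}
    (hr : 0 < r) (z : X) :
    meanOsc μ f r z =
      ENNReal.ofReal ((∫ y in ball z r, |f y - f z| ∂μ) / μ.real (ball z r)) := by
  have hi : IntegrableOn (fun y => f y - f z) (ball z r) μ :=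
    hf.integrableOn.sub (integrableOn_const (hd.finite z r hr).ne)
  have hV : 0 < μ.real (ball z r) := ENNReal.toReal_pos (hd.pos z r hr).ne' (hd.finite z r hr).ne
  rw [meanOsc, div_eq_mul_inv, ENNReal.ofReal_mul (integral_nonneg fun _ => abs_nonneg _),
    ofReal_integral_eq_lintegral_ofReal hi.abs (Filter.Eventually.of_forall fun _ => abs_nonneg _),
    ENNReal.ofReal_inv_of_pos hV, Measure.real, ENNReal.ofReal_toReal (hd.finite z r hr).ne,
    mul_comm]

theorem bumpIntegral_eq_setIntegral {h : ℝ} (hh : 0 < h) (F : X → ℝ) {x z : X}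
    (hxz : dist x z < h) :
    bumpIntegral μ h F x = ∫ y in ball z (2 * h), bump h x y * F y ∂μ := by
  refine (setIntegral_eq_integral_of_forall_compl_eq_zero fun y hy => ?_).symm
  rw [bump_eq_zero hh, zero_mul]
  rw [mem_ball, not_lt] at hy
  have := dist_triangle y x z
  rw [dist_comm y x] at this
  linarith

section Integral

variable [BorelSpace X]

theorem integrableOn_bump_mul {h : ℝ} (hh : 0 < h) {F : X → ℝ} {B : Set X}
    (hF : IntegrableOn F B μ) (x : X) : IntegrableOn (fun y => bump h x y * F y) B μ := by
  refine Integrable.bdd_mul (c := 1) hF ?_ (Filter.Eventually.of_forall fun y => ?_)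
  · exact ((continuous_bump h).comp (Continuous.prodMk_right x)).measurable.aestronglyMeasurable
  · rw [Real.norm_of_nonneg (bump_nonneg h x y)]
    exact bump_le_one hh x y

theorem abs_bumpIntegral_le {h : ℝ} (hh : 0 < h) {F : X → ℝ} {x z : X}
    (hF : IntegrableOn F (ball z (2 * h)) μ) (hxz : dist x z < h) :
    |bumpIntegral μ h F x| ≤ ∫ y in ball z (2 * h), |F y| ∂μ := by
  rw [bumpIntegral_eq_setIntegral hh F hxz]
  refine (abs_integral_le_integral_abs).trans ?_
  refine integral_mono (integrableOn_bump_mul hh hF x).abs hF.abs fun y => ?_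
  simp only
  rw [abs_mul, abs_of_nonneg (bump_nonneg h x y)]
  exact mul_le_of_le_one_left (abs_nonneg _) (bump_le_one hh x y)

theorem abs_bumpIntegral_sub_le {h : ℝ} (hh : 0 < h) {F : X → ℝ} {x x' z : X}
    (hF : IntegrableOn F (ball z (2 * h)) μ) (hxz : dist x z < h) (hxz' : dist x' z < h) :
    |bumpIntegral μ h F x - bumpIntegral μ h F x'| ≤
      dist x x' / h * ∫ y in ball z (2 * h), |F y| ∂μ := by
  rw [bumpIntegral_eq_setIntegral hh F hxz, bumpIntegral_eq_setIntegral hh F hxz',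
    ← integral_sub (integrableOn_bump_mul hh hF x) (integrableOn_bump_mul hh hF x'),
    ← integral_const_mul]
  refine (abs_integral_le_integral_abs).trans ?_
  refine integral_mono ((integrableOn_bump_mul hh hF x).sub (integrableOn_bump_mul hh hF x')).abs
    (hF.abs.const_mul _) fun y => ?_
  simp only
  rw [← sub_mul, abs_mul]
  gcongr
  exact abs_bump_sub_le hh x x' y

theorem le_bumpIntegral_one (hd : IsDoubling μ Cμ) {h : ℝ} (hh : 0 < h) {x z : X}
    (hxz : dist x z < h) :
    μ.real (ball z (2 * h)) ≤ 2 * Cμ ^ 3 * bumpIntegral μ h (fun _ => 1) x := by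
  have hC : 0 < Cμ := by
    have : Nonempty X := ⟨x⟩
    linarith [hd.one_le]
  have h1 : μ.real (ball z (2 * h)) ≤ Cμ ^ 3 * μ.real (ball x (h / 2)) := by
    have := hd.measure_ball_le_of_subset (x := x) (z := z) (R := 2 * h) (half_pos hh) 3 (by
      rw [dist_comm]; linarith)
    have h2 := ENNReal.toReal_mono (ENNReal.mul_ne_top (ENNReal.pow_ne_top ENNReal.ofReal_ne_top)
      (hd.finite x _ (half_pos hh)).ne) this
    rwa [ENNReal.toReal_mul, ENNReal.toReal_pow, ENNReal.toReal_ofReal hC.le] at h2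
  have h2 : (1 / 2) * μ.real (ball x (h / 2)) ≤ bumpIntegral μ h (fun _ => 1) x := by
    have hfin : ∀ r, 0 < r → IntegrableOn (fun _ : X => (1 : ℝ)) (ball x r) μ := fun r hr =>
      integrableOn_const (hd.finite x r hr).ne
    rw [bumpIntegral_eq_setIntegral (z := x) hh _ (by simpa using hh)]
    calc (1 / 2) * μ.real (ball x (h / 2)) = ∫ y in ball x (h / 2), (1 / 2 : ℝ) ∂μ := by
          rw [setIntegral_const, smul_eq_mul, mul_comm]
      _ ≤ ∫ y in ball x (h / 2), bump h x y * 1 ∂μ := by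
          refine setIntegral_mono_on (integrableOn_const (hd.finite x _ (half_pos hh)).ne)
            (integrableOn_bump_mul hh (hfin _ (half_pos hh)) x) measurableSet_ball fun y hy => ?_
          rw [mul_one]
          refine half_le_bump hh ?_
          rw [dist_comm]
          exact (mem_ball.1 hy).le
      _ ≤ ∫ y in ball x (2 * h), bump h x y * 1 ∂μ := by
          refine setIntegral_mono_set (integrableOn_bump_mul hh (hfin _ (by positivity)) x) ?_ ?_
          · refine Filter.Eventually.of_forall fun y => ?_
            simpa using bump_nonneg h x y
          · exact (ball_subset_ball (by linarith)).eventuallyLE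
  have h3 : 0 < Cμ ^ 3 := by positivity
  nlinarith

theorem bumpIntegral_one_pos (hd : IsDoubling μ Cμ) {h : ℝ} (hh : 0 < h) (x : X) :
    0 < bumpIntegral μ h (fun _ => 1) x := by
  have hC : 0 < Cμ := by
    have : Nonempty X := ⟨x⟩
    linarith [hd.one_le]
  have h1 := le_bumpIntegral_one hd hh (x := x) (z := x) (by simpa using hh)
  have h2 : 0 < μ.real (ball x (2 * h)) :=
    ENNReal.toReal_pos (hd.pos x _ (by positivity)).ne' (hd.finite x _ (by positivity)).ne
  have h3 : 0 < 2 * Cμ ^ 3 := by positivity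
  by_contra! hle
  nlinarith

theorem bumpIntegral_sub_const (hd : IsDoubling μ Cμ) {h : ℝ} (hh : 0 < h) {f : X → ℝ}
    (hf : Integrable f μ) (a : ℝ) (x : X) :
    bumpIntegral μ h (fun y => f y - a) x =
      bumpIntegral μ h f x - a * bumpIntegral μ h (fun _ => 1) x := by
  have hx : dist x x < h := by simpa using hh
  have hfin : IntegrableOn (fun _ : X => (1 : ℝ)) (ball x (2 * h)) μ :=
    integrableOn_const (hd.finite x _ (by positivity)).ne
  rw [bumpIntegral_eq_setIntegral hh _ hx, bumpIntegral_eq_setIntegral hh _ hx,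
    bumpIntegral_eq_setIntegral hh _ hx, ← integral_const_mul,
    ← integral_sub (integrableOn_bump_mul hh hf.integrableOn x)
      ((integrableOn_bump_mul hh hfin x).const_mul a)]
  refine integral_congr_ae (Filter.Eventually.of_forall fun y => ?_)
  simp only
  ring

/-- Local Lipschitz bound for the averages. The value `f(z)` may be subtracted from `f`, since
averaging preserves constants. -/
theorem abs_mollify_sub_le (hd : IsDoubling μ Cμ) {h : ℝ} (hh : 0 < h) {f : X → ℝ}
    (hf : Integrable f μ) {x x' z : X} (hx : dist x z < h) (hx' : dist x' z < h) :
    |mollify μ h f x - mollify μ h f x'| ≤ dist x x' * (6 * Cμ ^ 6 / h *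
      ((∫ y in ball z (2 * h), |f y - f z| ∂μ) / μ.real (ball z (2 * h)))) := by
  have hC : 1 ≤ Cμ := by
    have : Nonempty X := ⟨x⟩
    exact hd.one_le
  have hone : IntegrableOn (fun _ : X => (1 : ℝ)) (ball z (2 * h)) μ :=
    integrableOn_const (hd.finite z _ (by positivity)).ne
  have hi : IntegrableOn (fun y => f y - f z) (ball z (2 * h)) μ :=
    hf.integrableOn.sub (integrableOn_const (hd.finite z _ (by positivity)).ne)
  have hV : 0 < μ.real (ball z (2 * h)) :=
    ENNReal.toReal_pos (hd.pos z _ (by positivity)).ne' (hd.finite z _ (by positivity)).ne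
  have hDx := bumpIntegral_one_pos hd hh x
  have hDx' := bumpIntegral_one_pos hd hh x'
  have hDl := le_bumpIntegral_one hd hh hx
  have hDl' := le_bumpIntegral_one hd hh hx'
  have hN := abs_bumpIntegral_sub_le hh hi hx hx'
  have hN' := abs_bumpIntegral_le hh hi hx'
  have hD := abs_bumpIntegral_sub_le hh hone hx hx'
  rw [show (∫ y in ball z (2 * h), |(1 : ℝ)| ∂μ) = μ.real (ball z (2 * h)) by simp] at hD
  rw [bumpIntegral_sub_const hd hh hf, bumpIntegral_sub_const hd hh hf] at hN
  rw [bumpIntegral_sub_const hd hh hf] at hN'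
  rw [mollify, mollify]
  set V := μ.real (ball z (2 * h))
  set I := ∫ y in ball z (2 * h), |f y - f z| ∂μ
  set D := bumpIntegral μ h (fun _ => 1) x
  set D' := bumpIntegral μ h (fun _ => 1) x'
  set J := bumpIntegral μ h f x
  set J' := bumpIntegral μ h f x'
  set a := f z
  set θ := dist x x' / h with hθ
  have hθ0 : 0 ≤ θ := by positivity
  have hI : 0 ≤ I := integral_nonneg fun _ => abs_nonneg _
  have hinv : D⁻¹ ≤ 2 * Cμ ^ 3 / V := by
    rw [inv_le_iff_one_le_mul₀ hDx, div_mul_eq_mul_div, one_le_div hV]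
    exact hDl
  have hinv' : D'⁻¹ ≤ 2 * Cμ ^ 3 / V := by
    rw [inv_le_iff_one_le_mul₀ hDx', div_mul_eq_mul_div, one_le_div hV]
    exact hDl'
  have hsplit : J / D - J' / D' =
      ((J - a * D) - (J' - a * D')) * D⁻¹ + (J' - a * D') * (D' - D) * (D⁻¹ * D'⁻¹) := by
    field_simp
    ring
  rw [abs_sub_comm D] at hD
  calc |J / D - J' / D'|
      ≤ |((J - a * D) - (J' - a * D')) * D⁻¹| + |(J' - a * D') * (D' - D) * (D⁻¹ * D'⁻¹)| := by
        rw [hsplit]; exact abs_add_le _ _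
    _ = |(J - a * D) - (J' - a * D')| * D⁻¹ + |J' - a * D'| * |D' - D| * (D⁻¹ * D'⁻¹) := by
        rw [abs_mul, abs_mul (_ * _), abs_mul (J' - a * D'), abs_of_pos (inv_pos.2 hDx),
          abs_of_pos (mul_pos (inv_pos.2 hDx) (inv_pos.2 hDx'))]
    _ ≤ (θ * I) * (2 * Cμ ^ 3 / V) +
          I * (θ * V) * ((2 * Cμ ^ 3 / V) * (2 * Cμ ^ 3 / V)) := by
        gcongr
    _ = θ * (I / V) * (2 * Cμ ^ 3 + 4 * Cμ ^ 6) := by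
        field_simp
        ring
    _ ≤ θ * (I / V) * (6 * Cμ ^ 6) := by
        have : Cμ ^ 3 ≤ Cμ ^ 6 := pow_le_pow_right₀ hC (by norm_num)
        gcongr
        linarith
    _ = _ := by rw [hθ]; ring

theorem ofReal_abs_mollify_sub_le (hd : IsDoubling μ Cμ) {h : ℝ} (hh : 0 < h) {f : X → ℝ}
    (hf : Integrable f μ) {x x' z : X} (hx : dist x z < h) (hx' : dist x' z < h) :
    ENNReal.ofReal |mollify μ h f x - mollify μ h f x'| ≤
      ENNReal.ofReal (dist x x') * (ENNReal.ofReal (6 * Cμ ^ 6 / h) * meanOsc μ f (2 * h) z) := by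
  have hC : 1 ≤ Cμ := by
    have : Nonempty X := ⟨x⟩
    exact hd.one_le
  rw [meanOsc_eq_ofReal hd hf (by positivity), ← ENNReal.ofReal_mul (by positivity),
    ← ENNReal.ofReal_mul dist_nonneg]
  exact ENNReal.ofReal_le_ofReal (abs_mollify_sub_le hd hh hf hx hx')

theorem ofReal_abs_mollify_sub_self_le (hd : IsDoubling μ Cμ) {h : ℝ} (hh : 0 < h) {f : X → ℝ}
    (hf : Integrable f μ) (x : X) :
    ENNReal.ofReal |mollify μ h f x - f x| ≤
      ENNReal.ofReal (6 * Cμ ^ 6) * meanOsc μ f (2 * h) x := by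
  have hC : 1 ≤ Cμ := by
    have : Nonempty X := ⟨x⟩
    exact hd.one_le
  have hx : dist x x < h := by simpa using hh
  have hi : IntegrableOn (fun y => f y - f x) (ball x (2 * h)) μ :=
    hf.integrableOn.sub (integrableOn_const (hd.finite x _ (by positivity)).ne)
  have hV : 0 < μ.real (ball x (2 * h)) :=
    ENNReal.toReal_pos (hd.pos x _ (by positivity)).ne' (hd.finite x _ (by positivity)).ne
  have hDx := bumpIntegral_one_pos hd hh x
  have hDl := le_bumpIntegral_one hd hh hx
  have hN := abs_bumpIntegral_le hh hi hx
  rw [bumpIntegral_sub_const hd hh hf] at hN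
  rw [meanOsc_eq_ofReal hd hf (by positivity), ← ENNReal.ofReal_mul (by positivity)]
  refine ENNReal.ofReal_le_ofReal ?_
  rw [mollify]
  set V := μ.real (ball x (2 * h))
  set I := ∫ y in ball x (2 * h), |f y - f x| ∂μ
  set D := bumpIntegral μ h (fun _ => 1) x
  set J := bumpIntegral μ h f x
  have hI : 0 ≤ I := integral_nonneg fun _ => abs_nonneg _
  have hinv : D⁻¹ ≤ 2 * Cμ ^ 3 / V := by
    rw [inv_le_iff_one_le_mul₀ hDx, div_mul_eq_mul_div, one_le_div hV]
    exact hDl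
  calc |J / D - f x| = |J - f x * D| * D⁻¹ := by
        rw [← abs_of_pos (inv_pos.2 hDx), ← abs_mul, sub_mul, mul_assoc,
          mul_inv_cancel₀ hDx.ne', mul_one, div_eq_mul_inv]
    _ ≤ I * (2 * Cμ ^ 3 / V) := by gcongr
    _ = 2 * Cμ ^ 3 * (I / V) := by ring
    _ ≤ 6 * Cμ ^ 6 * (I / V) := by
        have : Cμ ^ 3 ≤ Cμ ^ 6 := pow_le_pow_right₀ hC (by norm_num)
        have : 0 ≤ Cμ ^ 3 := by positivity
        gcongr
        linarith

end Integral

section Measurability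

variable [BorelSpace X] [SecondCountableTopology X] [SFinite μ]

theorem measurable_bumpIntegral (h : ℝ) {F : X → ℝ} (hF : Measurable F) :
    Measurable (bumpIntegral μ h F) := by
  have : Measurable fun p : X × X => bump h p.1 p.2 * F p.2 :=
    (continuous_bump h).measurable.mul (hF.comp measurable_snd)
  exact this.stronglyMeasurable.integral_prod_right'.measurable

theorem measurable_mollify (h : ℝ) {f : X → ℝ} (hf : Measurable f) :
    Measurable (mollify μ h f) :=
  (measurable_bumpIntegral h hf).div (measurable_bumpIntegral h measurable_const)

theorem measurable_meanOsc {f : X → ℝ} (hf : Measurable f) (r : ℝ) :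
    Measurable (meanOsc μ f r) := by
  refine (measurable_measure_ball μ r).inv.mul
    (measurable_setLIntegral_ball μ (G := fun z y => ENNReal.ofReal |f y - f z|) ?_ r)
  have : Measurable fun p : X × X => f p.2 - f p.1 :=
    (hf.comp measurable_snd).sub (hf.comp measurable_fst)
  exact (measurable_norm.comp this).ennreal_ofReal

/-- The upper gradient of the average at scale `h` is the oscillation at scale `2h`, divided by
`h`. -/
theorem isUpperGradient_mollify (hd : IsDoubling μ Cμ) {h : ℝ} (hh : 0 < h) {f : X → ℝ}
    (hfm : Measurable f) (hf : Integrable f μ) :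
    IsUpperGradient (fun z => ENNReal.ofReal (6 * Cμ ^ 6 / h) * meanOsc μ f (2 * h) z)
      (mollify μ h f) :=
  isUpperGradient_of_local_lipschitz hh ((measurable_meanOsc hfm _).const_mul _)
    fun _ _ _ hx hx' => ofReal_abs_mollify_sub_le hd hh hf hx hx'

theorem lintegral_meanOsc_lt_top (hd : IsDoubling μ Cμ) {f : X → ℝ} (hfm : Measurable f)
    (hf : Integrable f μ) {r : ℝ} (hr : 0 < r) : ∫⁻ z, meanOsc μ f r z ∂μ < ∞ := by
  have hfin : ∫⁻ x, ENNReal.ofReal |f x| ∂μ < ∞ := by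
    have := hf.abs.lintegral_lt_top
    exact this
  have hm : Measurable fun x => ENNReal.ofReal |f x| := (measurable_norm.comp hfm).ennreal_ofReal
  calc ∫⁻ z, meanOsc μ f r z ∂μ
      ≤ ∫⁻ z, ((μ (ball z r))⁻¹ * ∫⁻ y in ball z r, ENNReal.ofReal |f y| ∂μ) +
          ENNReal.ofReal |f z| ∂μ := by
        refine lintegral_mono fun z => ?_
        have hV0 : μ (ball z r) ≠ 0 := (hd.pos z r hr).ne'
        have hVt : μ (ball z r) ≠ ∞ := (hd.finite z r hr).ne
        calc meanOsc μ f r z ≤ (μ (ball z r))⁻¹ *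
              ∫⁻ y in ball z r, (ENNReal.ofReal |f y| + ENNReal.ofReal |f z|) ∂μ := by
              unfold meanOsc
              gcongr with y
              rw [← ENNReal.ofReal_add (abs_nonneg _) (abs_nonneg _)]
              exact ENNReal.ofReal_le_ofReal (abs_sub _ _)
          _ = _ := by
              rw [lintegral_add_right _ measurable_const, setLIntegral_const, mul_add,
                mul_comm (ENNReal.ofReal |f z|), ← mul_assoc (μ (ball z r))⁻¹,
                ENNReal.inv_mul_cancel hV0 hVt, one_mul]
    _ ≤ ENNReal.ofReal Cμ * (∫⁻ x, ENNReal.ofReal |f x| ∂μ) + ∫⁻ x, ENNReal.ofReal |f x| ∂μ := by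
        rw [lintegral_add_right _ hm]
        gcongr
        exact lintegral_average_le hd hm hr
    _ < ∞ := ENNReal.add_lt_top.2 ⟨ENNReal.mul_lt_top ENNReal.ofReal_lt_top hfin, hfin⟩

end Measurability

end NonlocalHarnack

namespace NonlocalHarnack

/-! ### The Faber–Krahn inequality under a Poincaré inequality -/

/-- If `f ≥ 0` vanishes on at least half of `B`, then the integral of `f` over `B` is controlled by
the distance of `f` to any constant. -/
theorem setLIntegral_le_three_mul {α : Type*} [MeasurableSpace α] {μ : Measure α} {B : Set α}
    (hBm : MeasurableSet B) (hB : μ B ≠ ∞) {f : α → ℝ} (hf : Measurable f)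
    (hBS : 2 * μ {x | f x ≠ 0} ≤ μ B) (a : ℝ) :
    ∫⁻ x in B, ENNReal.ofReal (f x) ∂μ ≤ 3 * ∫⁻ x in B, ENNReal.ofReal |f x - a| ∂μ := by
  have hSm : MeasurableSet {x | f x ≠ 0} := hf (measurableSet_singleton 0).compl
  have hhalf := measure_le_two_mul_measure_diff hB hBS
  have hm : Measurable fun x => ENNReal.ofReal |f x - a| :=
    (measurable_norm.comp (hf.sub_const a)).ennreal_ofReal
  have ha : ENNReal.ofReal |a| * μ B ≤ 2 * ∫⁻ x in B, ENNReal.ofReal |f x - a| ∂μ := by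
    calc ENNReal.ofReal |a| * μ B ≤ ENNReal.ofReal |a| * (2 * μ (B \ {x | f x ≠ 0})) := by gcongr
      _ = 2 * ∫⁻ _ in B \ {x | f x ≠ 0}, ENNReal.ofReal |a| ∂μ := by
          rw [setLIntegral_const]; ring
      _ ≤ 2 * ∫⁻ x in B \ {x | f x ≠ 0}, ENNReal.ofReal |f x - a| ∂μ := by
          gcongr 2 * ?_
          refine setLIntegral_mono' (hBm.diff hSm) fun x hx => ?_
          have hfx : f x = 0 := by
            by_contra hne
            exact hx.2 hne
          rw [hfx, zero_sub, abs_neg]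
      _ ≤ _ := by
          gcongr 2 * ?_
          exact lintegral_mono_set sdiff_subset
  calc ∫⁻ x in B, ENNReal.ofReal (f x) ∂μ
      ≤ ∫⁻ x in B, (ENNReal.ofReal |f x - a| + ENNReal.ofReal |a|) ∂μ := by
        refine lintegral_mono fun x => ?_
        rw [← ENNReal.ofReal_add (abs_nonneg _) (abs_nonneg _)]
        refine ENNReal.ofReal_le_ofReal ?_
        linarith [le_abs_self (f x - a), le_abs_self a]
    _ = (∫⁻ x in B, ENNReal.ofReal |f x - a| ∂μ) + ENNReal.ofReal |a| * μ B := by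
        rw [lintegral_add_left hm, setLIntegral_const]
    _ ≤ (∫⁻ x in B, ENNReal.ofReal |f x - a| ∂μ) +
          2 * ∫⁻ x in B, ENNReal.ofReal |f x - a| ∂μ := by gcongr
    _ = _ := by ring

variable {X : Type u} [MetricSpace X] [MeasurableSpace X] {μ : Measure X} {Cμ : ℝ}

section Scales

variable [BorelSpace X] [SecondCountableTopology X] [SFinite μ]

/-- Under the Poincaré inequality, the oscillation at a small scale `2h` controls that at a large
scale `t`, with the loss `t/h` of a linear function; at the large scale the oscillation of a
function of small support is its integral. -/
theorem lintegral_le_mul_lintegral_meanOsc (hd : IsDoubling μ Cμ) (hC : 1 ≤ Cμ) {CP lam : ℝ}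
    (hP : SupportsPoincare μ CP lam) {f : X → ℝ} (hfm : Measurable f) (hf0 : ∀ x, 0 ≤ f x)
    (hfin : ∫⁻ x, ENNReal.ofReal (f x) ∂μ ≠ ∞) {t : ℝ} (ht : 0 < t)
    (hS : ∀ z y, y ∈ ball z t → f y ≠ 0 → 2 * μ {x | f x ≠ 0} ≤ μ (ball z t)) {h : ℝ}
    (hh : 0 < h) (hht : h ≤ t) :
    ∫⁻ x, ENNReal.ofReal (f x) ∂μ ≤
      ENNReal.ofReal (18 * Cμ ^ 8 * (1 + CP) * (t / h)) * ∫⁻ z, meanOsc μ f (2 * h) z ∂μ := by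
  have hCP := hP.const_pos
  have hlam : 0 < lam := lt_of_lt_of_le one_pos hP.one_le_dilation
  have hf : Integrable f μ :=
    ⟨hfm.aestronglyMeasurable, by
      rw [hasFiniteIntegral_iff_ofReal (Filter.Eventually.of_forall hf0)]; exact hfin.lt_top⟩
  set w := mollify μ h f with hw
  set ω := ∫⁻ z, meanOsc μ f (2 * h) z ∂μ with hω
  set g : X → ℝ≥0∞ := fun z => ENNReal.ofReal (6 * Cμ ^ 6 / h) * meanOsc μ f (2 * h) z with hg
  have hωfin : ω < ∞ := lintegral_meanOsc_lt_top hd hfm hf (by positivity)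
  have hwm : Measurable w := measurable_mollify h hfm
  have hgm : Measurable g := (measurable_meanOsc hfm _).const_mul _
  have hdm : Measurable fun x => ENNReal.ofReal |f x - w x| :=
    (measurable_norm.comp (hfm.sub hwm)).ennreal_ofReal
  have hdiff : ∫⁻ x, ENNReal.ofReal |f x - w x| ∂μ ≤ ENNReal.ofReal (6 * Cμ ^ 6) * ω := by
    rw [hω, ← lintegral_const_mul _ (measurable_meanOsc hfm _)]
    refine lintegral_mono fun x => ?_
    rw [abs_sub_comm]
    exact ofReal_abs_mollify_sub_self_le hd hh hf x
  have hgint : ∫⁻ z, g z ∂μ = ENNReal.ofReal (6 * Cμ ^ 6 / h) * ω :=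
    lintegral_const_mul _ (measurable_meanOsc hfm _)
  have hwi : Integrable w μ := by
    have h1 : Integrable (fun x => f x - w x) μ := by
      refine ⟨(hfm.sub hwm).aestronglyMeasurable, ?_⟩
      rw [hasFiniteIntegral_iff_norm]
      exact hdiff.trans_lt (ENNReal.mul_lt_top ENNReal.ofReal_lt_top hωfin)
    have h2 := hf.sub h1
    refine h2.congr (Filter.Eventually.of_forall fun x => ?_)
    simp
  have hpoinc := hP.poincare w g (fun x r _ => hwi.integrableOn)
    (isUpperGradient_mollify hd hh hfm hf)
  have hlocal : ∀ z, (μ (ball z t))⁻¹ * ∫⁻ x in ball z t, ENNReal.ofReal (f x) ∂μ ≤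
      3 * ((μ (ball z t))⁻¹ * (∫⁻ x in ball z t, ENNReal.ofReal |f x - w x| ∂μ) +
        ENNReal.ofReal (CP * t) *
          ((μ (ball z (lam * t)))⁻¹ * ∫⁻ x in ball z (lam * t), g x ∂μ)) := by
    intro z
    by_cases hz : ∃ y ∈ ball z t, f y ≠ 0
    · obtain ⟨y, hy, hfy⟩ := hz
      have hV0 : μ (ball z t) ≠ 0 := (hd.pos z t ht).ne'
      have hVt : μ (ball z t) ≠ ∞ := (hd.finite z t ht).ne
      set a := ⨍ x in ball z t, w x ∂μ with ha
      have hosc : (μ (ball z t))⁻¹ * ∫⁻ x in ball z t, ENNReal.ofReal |w x - a| ∂μ ≤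
          ENNReal.ofReal (CP * t) *
            ((μ (ball z (lam * t)))⁻¹ * ∫⁻ x in ball z (lam * t), g x ∂μ) := by
        have h1 := hpoinc z t ht
        have hi : IntegrableOn (fun x => w x - a) (ball z t) μ :=
          hwi.integrableOn.sub (integrableOn_const hVt)
        have hV : 0 < μ.real (ball z t) := ENNReal.toReal_pos hV0 hVt
        rw [setLAverage_eq, setAverage_eq, smul_eq_mul, ENNReal.ofReal_mul (by positivity),
          ofReal_integral_eq_lintegral_ofReal hi.abs
            (Filter.Eventually.of_forall fun _ => abs_nonneg _),
          ENNReal.ofReal_inv_of_pos hV, Measure.real, ENNReal.ofReal_toReal hVt,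
          ENNReal.div_eq_inv_mul] at h1
        exact h1
      have hthree := setLIntegral_le_three_mul measurableSet_ball hVt hfm (hS z y hy hfy) a
      have htri : ∫⁻ x in ball z t, ENNReal.ofReal |f x - a| ∂μ ≤
          (∫⁻ x in ball z t, ENNReal.ofReal |f x - w x| ∂μ) +
            ∫⁻ x in ball z t, ENNReal.ofReal |w x - a| ∂μ := by
        rw [← lintegral_add_left hdm]
        refine lintegral_mono fun x => ?_
        rw [← ENNReal.ofReal_add (abs_nonneg _) (abs_nonneg _)]
        exact ENNReal.ofReal_le_ofReal (abs_sub_le _ _ _)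
      calc (μ (ball z t))⁻¹ * ∫⁻ x in ball z t, ENNReal.ofReal (f x) ∂μ
          ≤ (μ (ball z t))⁻¹ * (3 * ((∫⁻ x in ball z t, ENNReal.ofReal |f x - w x| ∂μ) +
            ∫⁻ x in ball z t, ENNReal.ofReal |w x - a| ∂μ)) := by
            gcongr
            exact hthree.trans (by gcongr)
        _ = 3 * ((μ (ball z t))⁻¹ * (∫⁻ x in ball z t, ENNReal.ofReal |f x - w x| ∂μ) +
              (μ (ball z t))⁻¹ * ∫⁻ x in ball z t, ENNReal.ofReal |w x - a| ∂μ) := by ring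
        _ ≤ _ := by gcongr
    · push Not at hz
      rw [setLIntegral_congr_fun (g := fun _ => 0) measurableSet_ball]
      · simp
      · intro y hy
        simp [hz y hy]
  have hAm : Measurable fun z =>
      (μ (ball z t))⁻¹ * ∫⁻ x in ball z t, ENNReal.ofReal |f x - w x| ∂μ :=
    (measurable_measure_ball μ t).inv.mul (measurable_setLIntegral_ball μ
      (G := fun _ x => ENNReal.ofReal |f x - w x|) (hdm.comp measurable_snd) t)
  have hBm : Measurable fun z =>
      (μ (ball z (lam * t)))⁻¹ * ∫⁻ x in ball z (lam * t), g x ∂μ :=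
    (measurable_measure_ball μ (lam * t)).inv.mul (measurable_setLIntegral_ball μ
      (G := fun _ x => g x) (hgm.comp measurable_snd) (lam * t))
  have hC0 : 0 < Cμ := by linarith
  calc ∫⁻ x, ENNReal.ofReal (f x) ∂μ
      ≤ ENNReal.ofReal Cμ *
          ∫⁻ z, (μ (ball z t))⁻¹ * ∫⁻ x in ball z t, ENNReal.ofReal (f x) ∂μ ∂μ :=
        lintegral_le_lintegral_average hd hfm.ennreal_ofReal ht
    _ ≤ ENNReal.ofReal Cμ * ∫⁻ z, 3 * ((μ (ball z t))⁻¹ *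
          (∫⁻ x in ball z t, ENNReal.ofReal |f x - w x| ∂μ) + ENNReal.ofReal (CP * t) *
          ((μ (ball z (lam * t)))⁻¹ * ∫⁻ x in ball z (lam * t), g x ∂μ)) ∂μ := by
        gcongr ENNReal.ofReal Cμ * ?_
        exact lintegral_mono hlocal
    _ = ENNReal.ofReal Cμ * (3 * ((∫⁻ z, (μ (ball z t))⁻¹ *
          (∫⁻ x in ball z t, ENNReal.ofReal |f x - w x| ∂μ) ∂μ) + ENNReal.ofReal (CP * t) *
          ∫⁻ z, (μ (ball z (lam * t)))⁻¹ * ∫⁻ x in ball z (lam * t), g x ∂μ ∂μ)) := by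
        rw [lintegral_const_mul' _ _ ENNReal.ofNat_ne_top, lintegral_add_left hAm,
          lintegral_const_mul _ hBm]
    _ ≤ ENNReal.ofReal Cμ * (3 * ((ENNReal.ofReal Cμ * (ENNReal.ofReal (6 * Cμ ^ 6) * ω)) +
          ENNReal.ofReal (CP * t) *
            (ENNReal.ofReal Cμ * (ENNReal.ofReal (6 * Cμ ^ 6 / h) * ω)))) := by
        gcongr
        · exact (lintegral_average_le hd hdm ht).trans (by gcongr)
        · exact (lintegral_average_le hd hgm (mul_pos hlam ht)).trans (by rw [hgint])
    _ = ENNReal.ofReal (Cμ * (3 * (Cμ * (6 * Cμ ^ 6) + CP * t * (Cμ * (6 * Cμ ^ 6 / h))))) * ω := by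
        rw [ENNReal.ofReal_mul hC0.le, ENNReal.ofReal_mul (by norm_num : (0 : ℝ) ≤ 3),
          ENNReal.ofReal_add (by positivity) (by positivity), ENNReal.ofReal_mul hC0.le,
          ENNReal.ofReal_mul (by positivity : 0 ≤ CP * t), ENNReal.ofReal_mul hC0.le,
          ENNReal.ofReal_ofNat]
        ring
    _ ≤ _ := by
        refine mul_le_mul_left (ENNReal.ofReal_le_ofReal ?_) _
        have h1 : 1 ≤ t / h := (one_le_div hh).2 hht
        have h2 : 0 < 18 * Cμ ^ 8 := by positivity
        calc Cμ * (3 * (Cμ * (6 * Cμ ^ 6) + CP * t * (Cμ * (6 * Cμ ^ 6 / h))))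
            = 18 * Cμ ^ 8 * (1 + CP * (t / h)) := by ring
          _ ≤ 18 * Cμ ^ 8 * (t / h + CP * (t / h)) := by gcongr
          _ = _ := by ring

end Scales

section Summation

theorem sum_range_ite_le {q T : ℝ} (hq : 1 < q) (hT : 0 ≤ T) (n : ℕ) :
    ∑ j ∈ Finset.range n, (if q ^ j < T then q ^ j else 0) ≤ T * (q / (q - 1)) := by
  have hq1 : 0 < q - 1 := by linarith
  have hq0 : 0 < q := by linarith
  induction n with
  | zero => simpa using mul_nonneg hT (by positivity)
  | succ n ih =>
    rw [Finset.sum_range_succ]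
    by_cases h : q ^ n < T
    · have hgeom : ∑ j ∈ Finset.range n, (if q ^ j < T then q ^ j else 0) =
          (q ^ n - 1) / (q - 1) := by
        rw [← geom_sum_eq hq.ne']
        refine Finset.sum_congr rfl fun j hj => if_pos (lt_of_le_of_lt ?_ h)
        exact pow_le_pow_right₀ hq.le (Finset.mem_range.1 hj).le
      rw [hgeom, if_pos h, mul_div_assoc', ← sub_nonneg]
      have : T * q / (q - 1) - ((q ^ n - 1) / (q - 1) + q ^ n) =
          ((T - q ^ n) * q + 1) / (q - 1) := by
        field_simp
        ring
      rw [this]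
      have : 0 ≤ (T - q ^ n) * q := mul_nonneg (by linarith) hq0.le
      positivity
    · rw [if_neg h, add_zero]
      exact ih

theorem div_two_pow_rpow_neg {t : ℝ} (ht : 0 < t) (s : ℝ) (n : ℕ) :
    (t / 2 ^ n) ^ (-s) = t ^ (-s) * ((2 : ℝ) ^ s) ^ n := by
  rw [Real.div_rpow ht.le (by positivity), ← Real.rpow_natCast, ← Real.rpow_natCast,
    ← Real.rpow_mul (by norm_num), ← Real.rpow_mul (by norm_num), div_eq_mul_inv,
    ← Real.rpow_neg (by norm_num)]
  ring_nf

/-- A geometric sum over the dyadic scales `h = t / 2 ^ j` with `d < 2h`. -/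
theorem tsum_scales_le {s t d : ℝ} (hs : 1 / 2 ≤ s) (hs1 : s < 1) (ht : 0 < t) (hd : 0 < d) :
    ∑' j : ℕ, (if d < 2 * (t / 2 ^ j) then ENNReal.ofReal ((t / 2 ^ j) ^ (-s)) else 0) ≤
      ENNReal.ofReal (16 * d ^ (-s)) := by
  have hs0 : 0 < s := by linarith
  set q : ℝ := 2 ^ s with hqdef
  have hq2 : q ≤ 2 := by
    calc q ≤ 2 ^ (1 : ℝ) := Real.rpow_le_rpow_of_exponent_le (by norm_num) hs1.le
      _ = 2 := Real.rpow_one 2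
  have hq : 1 + 1 / 4 ≤ q := by
    rw [hqdef, Real.rpow_def_of_pos (by norm_num)]
    have h1 := Real.add_one_le_exp (Real.log 2 * s)
    have h2 := Real.log_two_gt_d9
    nlinarith
  have hq1 : 1 < q := by linarith
  set T : ℝ := (2 * t / d) ^ s with hT
  have hT0 : 0 ≤ T := by positivity
  refine ENNReal.tsum_le_of_sum_range_le fun n => ?_
  have hterm : ∀ j ∈ Finset.range n,
      (if d < 2 * (t / 2 ^ j) then ENNReal.ofReal ((t / 2 ^ j) ^ (-s)) else 0) =
        ENNReal.ofReal (t ^ (-s) * (if q ^ j < T then q ^ j else 0)) := by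
    intro j _
    have hiff : d < 2 * (t / 2 ^ j) ↔ q ^ j < T := by
      have hpow : ((2 : ℝ) ^ s) ^ j = ((2 : ℝ) ^ j) ^ s := by
        rw [← Real.rpow_natCast, ← Real.rpow_natCast, ← Real.rpow_mul (by norm_num),
          ← Real.rpow_mul (by norm_num), mul_comm]
      rw [hT, hqdef, hpow, Real.rpow_lt_rpow_iff (by positivity) (by positivity) hs0, lt_div_iff₀ hd,
        mul_div_assoc', lt_div_iff₀ (by positivity), mul_comm d]
    by_cases hj : q ^ j < T
    · rw [if_pos (hiff.2 hj), if_pos hj, div_two_pow_rpow_neg ht]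
    · rw [if_neg (fun hlt => hj (hiff.1 hlt)), if_neg hj]
      simp
  rw [Finset.sum_congr rfl hterm, ← ENNReal.ofReal_sum_of_nonneg]
  · refine ENNReal.ofReal_le_ofReal ?_
    rw [← Finset.mul_sum]
    have hfrac : q * (q / (q - 1)) ≤ 16 := by
      rw [mul_div_assoc', div_le_iff₀ (by linarith)]
      nlinarith
    have hTq : t ^ (-s) * T = q * d ^ (-s) := by
      rw [hT, Real.div_rpow (by positivity) hd.le, Real.mul_rpow (by norm_num) ht.le,
        Real.rpow_neg ht.le, Real.rpow_neg hd.le]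
      have : t ^ s ≠ 0 := (Real.rpow_pos_of_pos ht s).ne'
      field_simp
      exact hqdef.symm
    have hds : 0 < d ^ (-s) := Real.rpow_pos_of_pos hd _
    calc t ^ (-s) * ∑ j ∈ Finset.range n, (if q ^ j < T then q ^ j else 0)
        ≤ t ^ (-s) * (T * (q / (q - 1))) := by
          gcongr
          exact sum_range_ite_le hq1 hT0 n
      _ = (q * (q / (q - 1))) * d ^ (-s) := by rw [← mul_assoc, hTq]; ring
      _ ≤ _ := by gcongr
  · intro j _
    split_ifs <;> positivity

end Summation

section Dyadic

variable [BorelSpace X] [SecondCountableTopology X] [SFinite μ]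

/-- The Gagliardo seminorm dominates the sum of the oscillations over all dyadic scales. -/
theorem tsum_lintegral_meanOsc_le (hd : IsDoubling μ Cμ) {s t : ℝ} (hs : 1 / 2 ≤ s)
    (hs1 : s < 1) (ht : 0 < t) {f : X → ℝ} (hf : Measurable f) :
    ∑' j : ℕ, ENNReal.ofReal ((t / 2 ^ j) ^ (-s)) * ∫⁻ z, meanOsc μ f (2 * (t / 2 ^ j)) z ∂μ ≤
      ENNReal.ofReal (16 * Cμ) * energy μ s f := by
  have hosc : ∀ (j : ℕ) z, ENNReal.ofReal ((t / 2 ^ j) ^ (-s)) * meanOsc μ f (2 * (t / 2 ^ j)) z =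
      ∫⁻ y, ENNReal.ofReal ((t / 2 ^ j) ^ (-s)) * ((μ (ball z (2 * (t / 2 ^ j))))⁻¹ *
        (if dist y z < 2 * (t / 2 ^ j) then ENNReal.ofReal |f y - f z| else 0)) ∂μ := by
    intro j z
    have hm : Measurable fun y =>
        (if dist y z < 2 * (t / 2 ^ j) then ENNReal.ofReal |f y - f z| else 0) :=
      Measurable.ite measurableSet_ball (measurable_norm.comp (hf.sub_const _)).ennreal_ofReal
        measurable_const
    rw [meanOsc, setLIntegral_ball_eq, lintegral_const_mul _ (hm.const_mul _),
      lintegral_const_mul _ hm]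
  have hm : ∀ (j : ℕ) z, Measurable fun y =>
      ENNReal.ofReal ((t / 2 ^ j) ^ (-s)) * ((μ (ball z (2 * (t / 2 ^ j))))⁻¹ *
        (if dist y z < 2 * (t / 2 ^ j) then ENNReal.ofReal |f y - f z| else 0)) := fun j z =>
    ((Measurable.ite measurableSet_ball (measurable_norm.comp (hf.sub_const _)).ennreal_ofReal
        measurable_const).const_mul _).const_mul _
  calc ∑' j : ℕ, ENNReal.ofReal ((t / 2 ^ j) ^ (-s)) *
        ∫⁻ z, meanOsc μ f (2 * (t / 2 ^ j)) z ∂μ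
      = ∑' j : ℕ, ∫⁻ z, ENNReal.ofReal ((t / 2 ^ j) ^ (-s)) *
          meanOsc μ f (2 * (t / 2 ^ j)) z ∂μ := by
        refine tsum_congr fun j => ?_
        rw [lintegral_const_mul _ (measurable_meanOsc hf _)]
    _ = ∫⁻ z, ∑' j : ℕ, ENNReal.ofReal ((t / 2 ^ j) ^ (-s)) *
          meanOsc μ f (2 * (t / 2 ^ j)) z ∂μ :=
        (lintegral_tsum fun j => ((measurable_meanOsc hf _).const_mul _).aemeasurable).symm
    _ ≤ ∫⁻ z, ENNReal.ofReal (16 * Cμ) *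
          ∫⁻ y, ENNReal.ofReal |f y - f z| * kernel μ s y z ∂μ ∂μ := by
        refine lintegral_mono fun z => ?_
        simp_rw [hosc]
        rw [← lintegral_tsum fun j => (hm j z).aemeasurable,
          ← lintegral_const_mul' _ _ ENNReal.ofReal_ne_top]
        refine lintegral_mono fun y => ?_
        rcases eq_or_ne y z with rfl | hyz
        · simp
        have hdist : 0 < dist y z := dist_pos.2 hyz
        have hds : 0 < dist y z ^ s := Real.rpow_pos_of_pos hdist s
        set M := μ (pairBall y z) with hM
        have hM0 : M ≠ 0 := (measure_pairBall_pos hd hyz).ne'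
        have hMt : M ≠ ∞ := (measure_pairBall_lt_top hd y z).ne
        calc ∑' j : ℕ, ENNReal.ofReal ((t / 2 ^ j) ^ (-s)) * ((μ (ball z (2 * (t / 2 ^ j))))⁻¹ *
              (if dist y z < 2 * (t / 2 ^ j) then ENNReal.ofReal |f y - f z| else 0))
            ≤ ∑' j : ℕ, (ENNReal.ofReal |f y - f z| * (ENNReal.ofReal Cμ * M⁻¹)) *
              (if dist y z < 2 * (t / 2 ^ j) then
                ENNReal.ofReal ((t / 2 ^ j) ^ (-s)) else 0) := by
              refine ENNReal.tsum_le_tsum fun j => ?_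
              split_ifs with hj
              · have hball : (μ (ball z (2 * (t / 2 ^ j))))⁻¹ ≤ ENNReal.ofReal Cμ * M⁻¹ := by
                  have h1 := measure_pairBall_le hd (by positivity) hj.le
                  rw [ENNReal.inv_le_iff_inv_le, ENNReal.mul_inv (Or.inr (ENNReal.inv_ne_top.2 hM0))
                    (Or.inl ENNReal.ofReal_ne_top), inv_inv, mul_comm, ← div_eq_mul_inv]
                  exact ENNReal.div_le_of_le_mul' h1
                calc _ ≤ ENNReal.ofReal ((t / 2 ^ j) ^ (-s)) * ((ENNReal.ofReal Cμ * M⁻¹) *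
                      ENNReal.ofReal |f y - f z|) := by gcongr
                  _ = _ := by ring
              · simp
          _ ≤ (ENNReal.ofReal |f y - f z| * (ENNReal.ofReal Cμ * M⁻¹)) *
                ENNReal.ofReal (16 * dist y z ^ (-s)) := by
              rw [ENNReal.tsum_mul_left]
              gcongr
              exact tsum_scales_le hs hs1 ht hdist
          _ = ENNReal.ofReal (16 * Cμ) * (ENNReal.ofReal |f y - f z| * kernel μ s y z) := by
              rw [kernel, ← hM, ENNReal.mul_inv (Or.inl hM0) (Or.inl hMt),
                ← ENNReal.ofReal_inv_of_pos hds, ← Real.rpow_neg dist_nonneg,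
                ENNReal.ofReal_mul (by norm_num : (0 : ℝ) ≤ 16),
                ENNReal.ofReal_mul (by norm_num : (0 : ℝ) ≤ 16)]
              ring
    _ = _ := lintegral_const_mul' _ _ ENNReal.ofReal_ne_top

/-- With a Poincaré inequality, the constant of the Faber–Krahn inequality gains the factor `1 - s`:
all the scales below `t` contribute to the seminorm, the scale `h` in the proportion
`(h/t)^{1-s}`. -/
theorem SupportsPoincare.hasFaberKrahn (hd : IsDoubling μ Cμ) (hC : 1 ≤ Cμ) {CP lam s : ℝ}
    (hP : SupportsPoincare μ CP lam) (hs : 1 / 2 ≤ s) (hs1 : s < 1) :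
    HasFaberKrahn μ s (288 * Cμ ^ 9 * (1 + CP) * (1 - s)) := by
  intro f hfm hf0 hfin t ht hS
  have hCP := hP.const_pos
  have h1s : 0 < 1 - s := by linarith
  set I := ∫⁻ x, ENNReal.ofReal (f x) ∂μ with hI
  have hts : 0 < t ^ (-s) := Real.rpow_pos_of_pos ht _
  have hscale : ∀ j : ℕ, ENNReal.ofReal (t ^ (-s) * ((1 / 2 : ℝ) ^ (1 - s)) ^ j) * I ≤
      ENNReal.ofReal (18 * Cμ ^ 8 * (1 + CP)) * (ENNReal.ofReal ((t / 2 ^ j) ^ (-s)) *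
        ∫⁻ z, meanOsc μ f (2 * (t / 2 ^ j)) z ∂μ) := by
    intro j
    have h2 : (0 : ℝ) < 2 ^ j := by positivity
    have h1 := lintegral_le_mul_lintegral_meanOsc hd hC hP hfm hf0 hfin ht hS
      (h := t / 2 ^ j) (by positivity) (div_le_self ht.le (one_le_pow₀ one_le_two))
    rw [div_div_cancel₀ ht.ne'] at h1
    rw [← half_pow_mul_div_two_pow_rpow_neg ht]
    calc ENNReal.ofReal ((1 / 2) ^ j * (t / 2 ^ j) ^ (-s)) * I
        ≤ ENNReal.ofReal ((1 / 2) ^ j * (t / 2 ^ j) ^ (-s)) *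
          (ENNReal.ofReal (18 * Cμ ^ 8 * (1 + CP) * 2 ^ j) *
            ∫⁻ z, meanOsc μ f (2 * (t / 2 ^ j)) z ∂μ) := by gcongr
      _ = ENNReal.ofReal (18 * Cμ ^ 8 * (1 + CP) * (t / 2 ^ j) ^ (-s)) *
            ∫⁻ z, meanOsc μ f (2 * (t / 2 ^ j)) z ∂μ := by
          rw [← mul_assoc, ← ENNReal.ofReal_mul (by positivity)]
          congr 2
          rw [one_div, inv_pow]
          field_simp
      _ = _ := by
          rw [ENNReal.ofReal_mul (by positivity), mul_assoc]
  have hsum := ENNReal.tsum_le_tsum hscale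
  rw [ENNReal.tsum_mul_right, ENNReal.tsum_mul_left] at hsum
  have hgeo : ENNReal.ofReal (t ^ (-s) * (1 - s)⁻¹) ≤
      ∑' j : ℕ, ENNReal.ofReal (t ^ (-s) * ((1 / 2 : ℝ) ^ (1 - s)) ^ j) := by
    have hb := one_sub_le_two_rpow_neg h1s.le
    have hb2 := two_rpow_neg_le h1s.le (by linarith)
    have hq0 : (0 : ℝ) ≤ (1 / 2 : ℝ) ^ (1 - s) := by positivity
    simp_rw [ENNReal.ofReal_mul hts.le]
    rw [ENNReal.tsum_mul_left, tsum_ofReal_pow hq0 (by linarith)]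
    gcongr
    · linarith
    · linarith
  have hen : ENNReal.ofReal (t ^ (-s) * (1 - s)⁻¹) * I ≤
      ENNReal.ofReal (18 * Cμ ^ 8 * (1 + CP)) * (ENNReal.ofReal (16 * Cμ) * energy μ s f) := by
    calc _ ≤ _ := mul_le_mul_left hgeo I
      _ ≤ _ := hsum
      _ ≤ _ := by
        gcongr
        exact tsum_lintegral_meanOsc_le hd hs hs1 ht hfm
  have hone : (1 - s) * t ^ s * (t ^ (-s) * (1 - s)⁻¹) = 1 := by
    rw [Real.rpow_neg ht.le]
    have : t ^ s ≠ 0 := (Real.rpow_pos_of_pos ht s).ne'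
    field_simp
  calc I = ENNReal.ofReal ((1 - s) * t ^ s) * (ENNReal.ofReal (t ^ (-s) * (1 - s)⁻¹) * I) := by
        rw [← mul_assoc, ← ENNReal.ofReal_mul (by positivity), hone, ENNReal.ofReal_one, one_mul]
    _ ≤ ENNReal.ofReal ((1 - s) * t ^ s) *
          (ENNReal.ofReal (18 * Cμ ^ 8 * (1 + CP)) *
            (ENNReal.ofReal (16 * Cμ) * energy μ s f)) := by gcongr
    _ = _ := by
        rw [← mul_assoc, ← mul_assoc, ← ENNReal.ofReal_mul (by positivity),
          ← ENNReal.ofReal_mul (by positivity)]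
        congr 2
        ring

end Dyadic

end NonlocalHarnack

namespace NonlocalHarnack

/-! ### The De Giorgi iteration -/

variable {X : Type u} [MetricSpace X] [MeasurableSpace X] {μ : Measure X} {Cμ : ℝ}

/-- Caccioppoli inequality on the balls `B(x₀,ρ)`, `ρ ≤ R`, for all levels `k ≥ k₀`: the energy of
the truncated function is controlled by the energy of the cutoff function. -/
def HasCaccioppoli (μ : Measure X) (s : ℝ) (U : X → ℝ) (x₀ : X) (R k₀ : ℝ) : Prop :=
  ∀ (k ρ : ℝ) (φ : X → ℝ), k₀ ≤ k → ρ ≤ R → Measurable φ → (∀ x, 0 ≤ φ x) → (∀ x, φ x ≤ 1) →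
    (∀ x, x ∉ ball x₀ ρ → φ x = 0) →
    ∫⁻ x, ENNReal.ofReal (excess U k (ball x₀ ρ) x) ∂μ ≠ ∞ →
    cutoffEnergy μ s φ (excess U k (ball x₀ ρ)) ≠ ∞ →
      energy μ s (fun x => φ x * excess U k (ball x₀ ρ) x) ≤
        2 * cutoffEnergy μ s φ (excess U k (ball x₀ ρ))

theorem IsSubminimizer.hasCaccioppoli [BorelSpace X] [SecondCountableTopology X] [SFinite μ]
    (h : IsDoubling μ Cμ) {s : ℝ} {Ω : Set X} {U : X → ℝ} {u : X → EReal} (hΩ : MeasurableSet Ω)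
    (hu : IsSubminimizer μ s Ω u) (hU : Measurable U)
    (hUu : ∀ᵐ x ∂μ.restrict Ω, u x = (U x : EReal)) {x₀ : X} {R : ℝ} (hR : ball x₀ R ⊆ Ω) (k₀ : ℝ) :
    HasCaccioppoli μ s U x₀ R k₀ :=
  fun _ _ _ _ hρ hφ h0 h1 hP hL1 hRfin => energy_le_cutoffEnergy_of_isSubminimizer h hΩ hu hUu
    ((ball_subset_ball hρ).trans hR) measurableSet_ball hφ hU h0 h1 hP hL1 hRfin

/-- Above a level that dominates the obstacle in the ball, truncation keeps a function in the
obstacle class. -/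
theorem IsObstacleSolution.hasCaccioppoli [BorelSpace X] [SecondCountableTopology X] [SFinite μ]
    {s : ℝ} {Ω : Set X} {U : X → ℝ} {u ψ : X → EReal}
    (hΩ : MeasurableSet Ω) (hu : IsObstacleSolution μ s Ω ψ (fun _ => 0) u) (hU : Measurable U)
    (hUu : ∀ᵐ x ∂μ, u x = (U x : EReal)) {x₀ : X} {R k₀ : ℝ} (hR : ball x₀ R ⊆ Ω)
    (hψ : ∀ᵐ x ∂μ.restrict (ball x₀ R), ψ x ≤ (k₀ : EReal)) :
    HasCaccioppoli μ s U x₀ R k₀ := by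
  intro k ρ φ hk hρ hφ h0 h1 hP _ _
  have hUu' : ∀ᵐ x ∂μ.restrict univ, u x = (U x : EReal) := by rwa [Measure.restrict_univ]
  have hgu : gagliardo μ s univ u = energy μ s U := by
    rw [gagliardo_eq_of_ae_eq hUu', energy]
    simp
  have hPR : ball x₀ ρ ⊆ ball x₀ R := ball_subset_ball hρ
  have hem : Measurable (excess U k (ball x₀ ρ)) :=
    Measurable.indicator ((hU.sub_const k).max measurable_const) measurableSet_ball
  refine energy_le_cutoffEnergy_of_minimal measurableSet_ball hφ hU h0 h1 hP
    (by rw [← hgu]; exact hu.1.1.2.ne) ?_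
  by_cases hfin : energy μ s (fun x => U x - φ x * excess U k (ball x₀ ρ) x) = ∞
  · rw [hfin]
    exact le_top
  rw [← hgu, ← gagliardo_univ_coe]
  refine hu.2 _ ⟨⟨?_, ?_⟩, ?_, ?_⟩
  · exact (hU.sub (hφ.mul hem)).coe_real_ereal.aemeasurable
  · rw [gagliardo_univ_coe]
    exact Ne.lt_top hfin
  · have hψ' : ∀ᵐ x ∂μ, x ∈ ball x₀ R → ψ x ≤ (k₀ : EReal) :=
      (ae_restrict_iff' measurableSet_ball).1 hψ
    filter_upwards [hu.1.2.1, ae_restrict_of_ae hψ', ae_restrict_of_ae hUu] with x hx1 hx2 hx3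
    rw [cutoff_mul_excess hP]
    rw [hx3] at hx1
    by_cases hxP : x ∈ ball x₀ ρ
    · rcases le_total (U x) k with hUk | hUk
      · rw [max_eq_right (by linarith), mul_zero, sub_zero]
        exact hx1
      · rw [max_eq_left (by linarith)]
        refine (hx2 (hPR hxP)).trans (EReal.coe_le_coe_iff.2 ?_)
        nlinarith [mul_le_of_le_one_left (by linarith : 0 ≤ U x - k) (h1 x)]
    · rw [hP x hxP, zero_mul, sub_zero]
      exact hx1
  · filter_upwards [hu.1.2.2, ae_restrict_of_ae hUu, ae_restrict_mem hΩ.compl] with x hx1 hx2 hx3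
    rw [hP x fun hxP => hx3 (hR (hPR hxP)), zero_mul, sub_zero, ← hx2, hx1]

/-- Faber–Krahn inequality for functions supported in a ball. The doubling dimension gives the
radius `t` at which balls have twice the measure of the support; if `t > R`, then the support is a
fixed part of the ball and the lower-order term suffices. -/
theorem HasFaberKrahn.lintegral_le {s A Q c : ℝ} (hFK : HasFaberKrahn μ s A)
    (hd : IsDoubling μ Cμ) (hQ : IsDoublingDimension μ Q c) (hs : 0 < s) (hs1 : s < 1) (hsQ : s < Q)
    {x₀ : X} {R : ℝ} (hR : 0 < R) {f : X → ℝ} (hf : Measurable f) (hf0 : ∀ x, 0 ≤ f x)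
    (hfin : ∫⁻ x, ENNReal.ofReal (f x) ∂μ ≠ ∞) (hsupp : ∀ x, x ∉ ball x₀ R → f x = 0) :
    ∫⁻ x, ENNReal.ofReal (f x) ∂μ ≤ ENNReal.ofReal (3 * max 1 (2 / c)) *
      (μ {x | f x ≠ 0} / μ (ball x₀ R)) ^ (s / Q) *
        (ENNReal.ofReal (A * R ^ s) * energy μ s f + ∫⁻ x, ENNReal.ofReal (f x) ∂μ) := by
  have hc := hQ.const_pos
  have hQ0 := hQ.dim_pos
  have hV0 : μ (ball x₀ R) ≠ 0 := (hd.pos x₀ R hR).ne'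
  have hVt : μ (ball x₀ R) ≠ ∞ := (hd.finite x₀ R hR).ne
  set S := {x | f x ≠ 0} with hSdef
  have hSB : S ⊆ ball x₀ R := fun x hx => by
    by_contra hxB
    exact hx (hsupp x hxB)
  have hSt : μ S ≠ ∞ := ne_top_of_le_ne_top hVt (measure_mono hSB)
  rcases eq_or_ne (μ S) 0 with hS0 | hS0
  · have hae : ∀ᵐ x ∂μ, f x = 0 := by
      filter_upwards [measure_eq_zero_iff_ae_notMem.1 hS0] with x hx
      by_contra hne
      exact hx hne
    rw [lintegral_congr_ae (g := fun _ => 0) (by filter_upwards [hae] with x hx; simp [hx])]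
    simp
  have hmt : μ S / μ (ball x₀ R) ≠ ∞ := ENNReal.div_ne_top hSt hV0
  set m := (μ S / μ (ball x₀ R)).toReal with hm
  have hm0 : 0 < m := ENNReal.toReal_pos (ENNReal.div_ne_zero.2 ⟨hS0, hVt⟩) hmt
  have hmeq : μ S / μ (ball x₀ R) = ENNReal.ofReal m := (ENNReal.ofReal_toReal hmt).symm
  have hSm : μ S = ENNReal.ofReal m * μ (ball x₀ R) := by
    rw [← hmeq, ENNReal.div_mul_cancel hV0 hVt]
  set θ := (2 * m / c) ^ (1 / Q) with hθ
  have hθ0 : 0 < θ := by positivity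
  have hθQ : c * θ ^ Q = 2 * m := by
    rw [hθ, ← Real.rpow_mul (by positivity), one_div, inv_mul_cancel₀ hQ0.ne', Real.rpow_one]
    field_simp
  have hβ0 : 0 ≤ s / Q := by positivity
  have hβ1 : s / Q ≤ 1 := (div_le_one hQ0).2 hsQ.le
  have hθs : (3 * θ) ^ s ≤ 3 * max 1 (2 / c) * m ^ (s / Q) := by
    have h3 : (3 : ℝ) ^ s ≤ 3 := by
      calc (3 : ℝ) ^ s ≤ 3 ^ (1 : ℝ) := Real.rpow_le_rpow_of_exponent_le (by norm_num) hs1.le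
        _ = 3 := Real.rpow_one 3
    have hc' : (2 / c) ^ (s / Q) ≤ max 1 (2 / c) := by
      rcases le_total (2 / c) 1 with h | h
      · exact (Real.rpow_le_one (by positivity) h hβ0).trans (le_max_left _ _)
      · calc (2 / c) ^ (s / Q) ≤ (2 / c) ^ (1 : ℝ) := Real.rpow_le_rpow_of_exponent_le h hβ1
          _ = 2 / c := Real.rpow_one _
          _ ≤ _ := le_max_right _ _
    have hθ' : θ ^ s = (2 / c) ^ (s / Q) * m ^ (s / Q) := by
      rw [hθ, ← Real.rpow_mul (by positivity), ← Real.mul_rpow (by positivity) hm0.le]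
      congr 1 <;> ring
    rw [Real.mul_rpow (by norm_num) hθ0.le, hθ', mul_assoc]
    gcongr
  have hcoef : ENNReal.ofReal ((3 * θ) ^ s) ≤ ENNReal.ofReal (3 * max 1 (2 / c)) *
      (μ S / μ (ball x₀ R)) ^ (s / Q) := by
    rw [hmeq, ENNReal.ofReal_rpow_of_pos hm0, ← ENNReal.ofReal_mul (by positivity)]
    exact ENNReal.ofReal_le_ofReal hθs
  rcases le_or_gt (3 * θ) 1 with hθ1 | hθ1
  · have ht : 0 < R * (3 * θ) := by positivity
    have htR : R * (3 * θ) ≤ R := by nlinarith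
    have hE := hFK f hf hf0 hfin (R * (3 * θ)) ht (fun z y hy hfy => by
      have hyB : y ∈ ball x₀ R := hSB hfy
      have hzx : dist x₀ z < 2 * R := by
        have := dist_triangle x₀ y z
        rw [dist_comm x₀ y] at this
        linarith [mem_ball.1 hy, mem_ball.1 hyB]
      have hlow := hQ.lower_bound z (R * (3 * θ)) (3 * R) ht (by linarith)
      rw [show R * (3 * θ) / (3 * R) = θ by field_simp, hθQ] at hlow
      refine le_trans ?_ hlow
      rw [ENNReal.ofReal_mul (by norm_num), ENNReal.ofReal_ofNat, mul_assoc]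
      gcongr 2 * ?_
      rw [hSm]
      gcongr
      exact ball_subset_ball' (by linarith))
    refine hE.trans ?_
    rw [Real.mul_rpow hR.le (by positivity), ← mul_assoc, mul_comm _ ((3 * θ) ^ s),
      ENNReal.ofReal_mul (by positivity), mul_assoc]
    exact mul_le_mul' hcoef le_self_add
  · have h1 : (1 : ℝ≥0∞) ≤ ENNReal.ofReal ((3 * θ) ^ s) := by
      rw [ENNReal.one_le_ofReal]
      exact Real.one_le_rpow hθ1.le hs.le
    calc ∫⁻ x, ENNReal.ofReal (f x) ∂μ = 1 * ∫⁻ x, ENNReal.ofReal (f x) ∂μ := (one_mul _).symm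
      _ ≤ _ := mul_le_mul' (h1.trans hcoef) le_add_self

/-- The integral of the excess of `U` over the level `k` in `B(x₀,ρ)`. -/
noncomputable def levelIntegral (μ : Measure X) (U : X → ℝ) (x₀ : X) (k ρ : ℝ) : ℝ≥0∞ :=
  ∫⁻ x in ball x₀ ρ, ENNReal.ofReal (U x - k) ∂μ

theorem levelIntegral_mono (U : X → ℝ) (x₀ : X) {k k' ρ ρ' : ℝ} (hk : k' ≤ k) (hρ : ρ ≤ ρ') :
    levelIntegral μ U x₀ k ρ ≤ levelIntegral μ U x₀ k' ρ' :=
  (lintegral_mono_set (ball_subset_ball hρ)).trans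
    (lintegral_mono fun _ => ENNReal.ofReal_le_ofReal (by linarith))

theorem lintegral_excess_ball [BorelSpace X] (U : X → ℝ) (x₀ : X) (k ρ : ℝ) :
    ∫⁻ x, ENNReal.ofReal (excess U k (ball x₀ ρ) x) ∂μ = levelIntegral μ U x₀ k ρ := by
  rw [levelIntegral, ← lintegral_indicator measurableSet_ball]
  refine lintegral_congr fun x => ?_
  by_cases hx : x ∈ ball x₀ ρ
  · rw [excess, indicator_of_mem hx, indicator_of_mem hx, ENNReal.ofReal_max]
    simp
  · rw [excess, indicator_of_notMem hx, indicator_of_notMem hx]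
    simp

theorem measure_level_le [BorelSpace X] {U : X → ℝ} (hU : Measurable U) (x₀ : X) {k k' : ℝ}
    (hk : k' < k) (ρ : ℝ) :
    μ (ball x₀ ρ ∩ {x | k < U x}) ≤ levelIntegral μ U x₀ k' ρ / ENNReal.ofReal (k - k') := by
  have hpos : ENNReal.ofReal (k - k') ≠ 0 := by simpa using hk
  rw [ENNReal.le_div_iff_mul_le (Or.inl hpos) (Or.inl ENNReal.ofReal_ne_top), mul_comm,
    ← setLIntegral_const, levelIntegral]
  have hm : MeasurableSet (ball x₀ ρ ∩ {x | k < U x}) :=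
    measurableSet_ball.inter (measurableSet_lt measurable_const hU)
  refine (setLIntegral_mono' hm fun x hx => ?_).trans (lintegral_mono_set inter_subset_left)
  have : k < U x := hx.2
  exact ENNReal.ofReal_le_ofReal (by linarith)

/-- One step of the iteration. -/
theorem levelIntegral_le [BorelSpace X] [SecondCountableTopology X] [SFinite μ]
    {s A Q c : ℝ} (hFK : HasFaberKrahn μ s A) (hA : 0 ≤ A)
    (hd : IsDoubling μ Cμ) (hQ : IsDoublingDimension μ Q c) (hs : 0 < s) (hs1 : s < 1) (hsQ : s < Q)
    {x₀ : X} {R k₀ : ℝ} (hR : 0 < R) {U : X → ℝ} (hU : Measurable U)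
    (hcac : HasCaccioppoli μ s U x₀ R k₀) {k k' ρ ρ' : ℝ} (hk' : k₀ ≤ k') (hk : k' < k)
    (hρ : ρ < ρ') (hρ' : ρ' ≤ R) (hρ0 : 0 ≤ ρ) (hfin : levelIntegral μ U x₀ k' ρ' ≠ ∞) :
    levelIntegral μ U x₀ k ρ ≤
      ENNReal.ofReal (3 * max 1 (2 / c) * (4 * A * (Cμ ^ 2 * (2 / s + 4 / (1 - s))) + 1) *
        (R / (ρ' - ρ)) ^ s) *
      (levelIntegral μ U x₀ k' ρ' / μ (ball x₀ R) / ENNReal.ofReal (k - k')) ^ (s / Q) *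
        levelIntegral μ U x₀ k' ρ' := by
  have h1s : 0 < 1 - s := by linarith
  have hQ0 := hQ.dim_pos
  obtain ⟨φ, hφc, h0, h1, hφ1, hP, hφL⟩ := exists_cutoff x₀ hρ
  have hδ : 0 < ρ' - ρ := by linarith
  set e := excess U k (ball x₀ ρ') with he_def
  have he0 : ∀ x, 0 ≤ e x := excess_nonneg U k _
  have he : Measurable e :=
    Measurable.indicator ((hU.sub_const k).max measurable_const) measurableSet_ball
  set Λ := Cμ ^ 2 * (2 / s + 4 / (1 - s)) with hΛ
  have hΛ0 : 0 ≤ Λ := by positivity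
  have hafin : levelIntegral μ U x₀ k ρ' ≠ ∞ :=
    ne_top_of_le_ne_top hfin (levelIntegral_mono U x₀ hk.le le_rfl)
  have heint : ∫⁻ x, ENNReal.ofReal (e x) ∂μ = levelIntegral μ U x₀ k ρ' :=
    lintegral_excess_ball U x₀ k ρ'
  have hcut : cutoffEnergy μ s φ e ≤
      2 * (ENNReal.ofReal (Λ * (ρ' - ρ) ^ (-s)) * levelIntegral μ U x₀ k ρ') := by
    rw [← heint]
    exact cutoffEnergy_le hφc.measurable he he0
      fun y => lintegral_cutoff_mul_kernel_le hd hs hs1 hδ h0 h1 hφL y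
  have hcutfin : cutoffEnergy μ s φ e ≠ ∞ := ne_top_of_le_ne_top
    (ENNReal.mul_ne_top ENNReal.ofNat_ne_top (ENNReal.mul_ne_top ENNReal.ofReal_ne_top hafin)) hcut
  have hen := hcac k ρ' φ (hk'.trans hk.le) hρ' hφc.measurable h0 h1 hP (by rwa [heint]) hcutfin
  set f : X → ℝ := fun x => φ x * e x with hf_def
  have hf : Measurable f := hφc.measurable.mul he
  have hf0 : ∀ x, 0 ≤ f x := fun x => mul_nonneg (h0 x) (he0 x)
  have hfle : ∫⁻ x, ENNReal.ofReal (f x) ∂μ ≤ levelIntegral μ U x₀ k ρ' := by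
    rw [← heint]
    exact lintegral_mono fun x =>
      ENNReal.ofReal_le_ofReal (mul_le_of_le_one_left (he0 x) (h1 x))
  have hlef : levelIntegral μ U x₀ k ρ ≤ ∫⁻ x, ENNReal.ofReal (f x) ∂μ := by
    rw [levelIntegral, ← lintegral_indicator measurableSet_ball]
    refine lintegral_mono fun x => ?_
    by_cases hx : x ∈ ball x₀ ρ
    · have hx' : x ∈ ball x₀ ρ' := ball_subset_ball hρ.le hx
      rw [indicator_of_mem hx, hf_def]
      simp only
      rw [hφ1 x hx, one_mul, he_def, excess, indicator_of_mem hx']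
      exact ENNReal.ofReal_le_ofReal (le_max_left _ _)
    · rw [indicator_of_notMem hx]
      exact zero_le
  have hsupp : {x | f x ≠ 0} ⊆ ball x₀ ρ' ∩ {x | k < U x} := by
    intro x hx
    have hxP : x ∈ ball x₀ ρ' := by
      by_contra hxP
      exact hx (by simp [hf_def, hP x hxP])
    refine ⟨hxP, ?_⟩
    by_contra hUk
    refine hx ?_
    have : max (U x - k) 0 = 0 := max_eq_right (by simpa using hUk)
    simp [hf_def, he_def, excess, this]
  have hmeas : μ {x | f x ≠ 0} / μ (ball x₀ R) ≤
      levelIntegral μ U x₀ k' ρ' / μ (ball x₀ R) / ENNReal.ofReal (k - k') := by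
    calc _ ≤ levelIntegral μ U x₀ k' ρ' / ENNReal.ofReal (k - k') / μ (ball x₀ R) := by
          gcongr
          exact (measure_mono hsupp).trans (measure_level_le hU x₀ hk ρ')
      _ = _ := by rw [div_eq_mul_inv, div_eq_mul_inv, div_eq_mul_inv, div_eq_mul_inv, mul_right_comm]
  have hmain := hFK.lintegral_le hd hQ hs hs1 hsQ (x₀ := x₀) hR hf hf0
    (ne_top_of_le_ne_top hafin hfle) (fun x hx => by
      simp [hf_def, hP x fun hxP => hx (ball_subset_ball hρ' hxP)])
  have hRs : 1 ≤ (R / (ρ' - ρ)) ^ s :=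
    Real.one_le_rpow ((one_le_div hδ).2 (by linarith)) hs.le
  have hbracket : ENNReal.ofReal (A * R ^ s) * energy μ s f + ∫⁻ x, ENNReal.ofReal (f x) ∂μ ≤
      ENNReal.ofReal ((4 * A * Λ + 1) * (R / (ρ' - ρ)) ^ s) * levelIntegral μ U x₀ k ρ' := by
    calc _ ≤ ENNReal.ofReal (A * R ^ s) * (2 * (2 * (ENNReal.ofReal (Λ * (ρ' - ρ) ^ (-s)) *
            levelIntegral μ U x₀ k ρ'))) + levelIntegral μ U x₀ k ρ' := by
          gcongr
          exact hen.trans (by gcongr)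
      _ = ENNReal.ofReal (4 * A * Λ * (R / (ρ' - ρ)) ^ s + 1) * levelIntegral μ U x₀ k ρ' := by
          have hRd : R ^ s * (ρ' - ρ) ^ (-s) = (R / (ρ' - ρ)) ^ s := by
            rw [Real.div_rpow hR.le hδ.le, Real.rpow_neg hδ.le, div_eq_mul_inv]
          rw [← hRd, show 4 * A * Λ * (R ^ s * (ρ' - ρ) ^ (-s)) + 1 =
            (A * R ^ s) * (2 * (2 * (Λ * (ρ' - ρ) ^ (-s)))) + 1 by ring,
            ENNReal.ofReal_add (by positivity) zero_le_one,
            ENNReal.ofReal_mul (by positivity : 0 ≤ A * R ^ s),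
            ENNReal.ofReal_mul (by norm_num : (0 : ℝ) ≤ 2),
            ENNReal.ofReal_mul (by norm_num : (0 : ℝ) ≤ 2), ENNReal.ofReal_ofNat,
            ENNReal.ofReal_one]
          ring
      _ ≤ _ := by
          gcongr
          rw [add_mul, one_mul]
          gcongr
  calc levelIntegral μ U x₀ k ρ ≤ ∫⁻ x, ENNReal.ofReal (f x) ∂μ := hlef
    _ ≤ _ := hmain
    _ ≤ ENNReal.ofReal (3 * max 1 (2 / c)) *
        (levelIntegral μ U x₀ k' ρ' / μ (ball x₀ R) / ENNReal.ofReal (k - k')) ^ (s / Q) *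
        (ENNReal.ofReal ((4 * A * Λ + 1) * (R / (ρ' - ρ)) ^ s) * levelIntegral μ U x₀ k' ρ') := by
        gcongr
        exact hbracket.trans (by
          gcongr
          exact levelIntegral_mono U x₀ hk.le le_rfl)
    _ = _ := by
        rw [mul_assoc (3 * max 1 (2 / c)), ENNReal.ofReal_mul (by positivity : 0 ≤ 3 * max 1 (2 / c))]
        ring

/-- Geometric decay in the De Giorgi recursion, for a level increment `K` proportional to the
initial mean. -/
theorem iteration_decay {s Q M ϱ K : ℝ} (hs : 0 < s) (hs1 : s < 1) (hsQ : s < Q) (hM : 0 < M)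
    (hϱ : 0 < ϱ) {α : ℕ → ℝ} (hα : ∀ j, 0 ≤ α j) (hα0 : 0 < α 0)
    (hK : K = α 0 * (ϱ ^ Q * (M * 2 ^ (Q + 3)) ^ (Q / s)))
    (hrec : ∀ j, α (j + 1) ≤
      M * (2 ^ (j + 1) * ϱ) ^ s * (2 ^ (j + 1) * α j / K) ^ (s / Q) * α j) (j : ℕ) :
    α j ≤ α 0 * ((2 : ℝ) ^ (-(Q + 1))) ^ j := by
  have hQ : 0 < Q := hs.trans hsQ
  have hβ0 : 0 < s / Q := by positivity
  have hβ1 : s / Q ≤ 1 := (div_le_one hQ).2 hsQ.le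
  have hK0 : 0 < K := by rw [hK]; positivity
  have hκ : (α 0 / K) ^ (s / Q) = (ϱ ^ s)⁻¹ * (M * 2 ^ (Q + 3))⁻¹ := by
    have h1 : α 0 / K = (ϱ ^ Q * (M * 2 ^ (Q + 3)) ^ (Q / s))⁻¹ := by
      rw [hK]
      field_simp
    rw [h1, Real.inv_rpow (by positivity), Real.mul_rpow (by positivity) (by positivity),
      ← Real.rpow_mul hϱ.le, ← Real.rpow_mul (by positivity), mul_inv,
      show Q * (s / Q) = s by field_simp, show Q / s * (s / Q) = 1 by field_simp, Real.rpow_one]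
  induction j with
  | zero => simp
  | succ j ih =>
    set θ : ℝ := (2 : ℝ) ^ (-(Q + 1)) with hθ
    have hθ0 : 0 < θ := by positivity
    have hfac : M * (2 ^ (j + 1) * ϱ) ^ s * (2 ^ (j + 1) * α j / K) ^ (s / Q) ≤ θ := by
      calc M * (2 ^ (j + 1) * ϱ) ^ s * (2 ^ (j + 1) * α j / K) ^ (s / Q)
          ≤ M * (2 ^ (j + 1) * ϱ) ^ s * (2 ^ (j + 1) * (α 0 * θ ^ j) / K) ^ (s / Q) := by
            have := hα j
            gcongr
        _ = M * (((2 : ℝ) ^ (j + 1)) ^ s * ϱ ^ s) *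
              (((2 : ℝ) ^ (j + 1)) ^ (s / Q) * (θ ^ j) ^ (s / Q) * (α 0 / K) ^ (s / Q)) := by
            rw [show 2 ^ (j + 1) * (α 0 * θ ^ j) / K = 2 ^ (j + 1) * θ ^ j * (α 0 / K) by ring,
              Real.mul_rpow (by positivity) (by positivity),
              Real.mul_rpow (by positivity) (by positivity),
              Real.mul_rpow (by positivity) (by positivity)]
        _ = ((2 : ℝ) ^ (j + 1)) ^ s * ((2 : ℝ) ^ (j + 1)) ^ (s / Q) * (θ ^ j) ^ (s / Q) *
              (2 ^ (Q + 3))⁻¹ := by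
            rw [hκ]
            have h1 : ϱ ^ s ≠ 0 := (Real.rpow_pos_of_pos hϱ s).ne'
            field_simp
        _ = (2 : ℝ) ^ (s + s / Q - (Q + 3)) := by
            have h2 : (0 : ℝ) ≤ 2 := zero_le_two
            rw [hθ, ← Real.rpow_natCast, ← Real.rpow_natCast, ← Real.rpow_mul h2,
              ← Real.rpow_mul h2, ← Real.rpow_mul h2, ← Real.rpow_mul h2, ← Real.rpow_neg h2,
              ← Real.rpow_add two_pos, ← Real.rpow_add two_pos, ← Real.rpow_add two_pos]
            congr 1
            push_cast
            field_simp
            ring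
        _ ≤ θ := by
            rw [hθ]
            exact Real.rpow_le_rpow_of_exponent_le (by norm_num) (by linarith)
    calc α (j + 1) ≤ _ := hrec j
      _ ≤ θ * α j := mul_le_mul_of_nonneg_right hfac (hα j)
      _ ≤ θ * (α 0 * θ ^ j) := by gcongr
      _ = α 0 * θ ^ (j + 1) := by ring

/-- Local boundedness for a function that satisfies Caccioppoli inequalities. -/
theorem HasCaccioppoli.ae_le [BorelSpace X] [SecondCountableTopology X] [SFinite μ]
    {s A Q c : ℝ} (hFK : HasFaberKrahn μ s A) (hA : 0 ≤ A)
    (hd : IsDoubling μ Cμ) (hQ : IsDoublingDimension μ Q c) (hs : 0 < s) (hs1 : s < 1) (hsQ : s < Q)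
    {x₀ : X} {r R k₀ : ℝ} (hr : 0 < r) (hrR : r < R) {U : X → ℝ} (hU : Measurable U)
    (hcac : HasCaccioppoli μ s U x₀ R k₀) :
    ∀ᵐ x ∂μ.restrict (ball x₀ r), ENNReal.ofReal (U x - k₀) ≤
      ENNReal.ofReal ((3 * max 1 (2 / c) * (4 * A * (Cμ ^ 2 * (2 / s + 4 / (1 - s))) + 1) *
        2 ^ (Q + 3)) ^ (Q / s) * (R / (R - r)) ^ Q) *
          (levelIntegral μ U x₀ k₀ R / μ (ball x₀ R)) := by
  have hR : 0 < R := hr.trans hrR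
  have hRr : 0 < R - r := by linarith
  have h1s : 0 < 1 - s := by linarith
  have hQ0 := hQ.dim_pos
  have hV0 : μ (ball x₀ R) ≠ 0 := (hd.pos x₀ R hR).ne'
  have hVt : μ (ball x₀ R) ≠ ∞ := (hd.finite x₀ R hR).ne
  set M := 3 * max 1 (2 / c) * (4 * A * (Cμ ^ 2 * (2 / s + 4 / (1 - s))) + 1) with hMdef
  have hM : 0 < M := by positivity
  set ϱ := R / (R - r) with hϱdef
  have hϱ : 0 < ϱ := by positivity
  have hcoef : 0 < (M * 2 ^ (Q + 3)) ^ (Q / s) * ϱ ^ Q := by positivity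
  have hzero : ∀ k : ℝ, levelIntegral μ U x₀ k r = 0 → ∀ᵐ x ∂μ.restrict (ball x₀ r), U x ≤ k := by
    intro k hk
    have hm : Measurable fun x => ENNReal.ofReal (U x - k) := (hU.sub_const k).ennreal_ofReal
    filter_upwards [(lintegral_eq_zero_iff hm).1 hk] with x hx
    have : ENNReal.ofReal (U x - k) = 0 := hx
    rw [ENNReal.ofReal_eq_zero] at this
    linarith
  rcases eq_or_ne (levelIntegral μ U x₀ k₀ R) ∞ with hinf | hfin
  · rw [hinf, ENNReal.top_div_of_ne_top hVt, ENNReal.mul_top (by simpa using hcoef)]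
    exact Filter.Eventually.of_forall fun _ => le_top
  rcases eq_or_ne (levelIntegral μ U x₀ k₀ R) 0 with h0 | hne
  · have := hzero k₀ (le_antisymm ((levelIntegral_mono U x₀ le_rfl hrR.le).trans h0.le) zero_le)
    filter_upwards [this] with x hx
    rw [ENNReal.ofReal_of_nonpos (by linarith)]
    exact zero_le
  set K := (levelIntegral μ U x₀ k₀ R / μ (ball x₀ R)).toReal *
    (ϱ ^ Q * (M * 2 ^ (Q + 3)) ^ (Q / s)) with hK
  have hα0 : 0 < (levelIntegral μ U x₀ k₀ R / μ (ball x₀ R)).toReal :=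
    ENNReal.toReal_pos (ENNReal.div_ne_zero.2 ⟨hne, hVt⟩) (ENNReal.div_ne_top hfin hV0)
  have hK0 : 0 < K := by positivity
  -- Levels `k j` increase to `k₀ + K`, radii `ρ j` decrease to `r`.
  set k : ℕ → ℝ := fun j => k₀ + K * (1 - (1 / 2) ^ j) with hkdef
  set ρ : ℕ → ℝ := fun j => r + (R - r) * (1 / 2) ^ j with hρdef
  have hpow : ∀ j : ℕ, 0 < (1 / 2 : ℝ) ^ j ∧ (1 / 2 : ℝ) ^ j ≤ 1 := fun j =>
    ⟨by positivity, pow_le_one₀ (by norm_num) (by norm_num)⟩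
  have hk0 : ∀ j, k₀ ≤ k j := fun j => by
    have := mul_nonneg hK0.le (sub_nonneg.2 (hpow j).2)
    simp only [hkdef]
    linarith
  have hkdiff : ∀ j, k (j + 1) - k j = K / 2 ^ (j + 1) := fun j => by
    simp only [hkdef, pow_succ, one_div, inv_pow]
    field_simp
    ring
  have hρdiff : ∀ j, ρ j - ρ (j + 1) = (R - r) / 2 ^ (j + 1) := fun j => by
    simp only [hρdef, pow_succ, one_div, inv_pow]
    field_simp
    ring
  have hρR : ∀ j, ρ j ≤ R := fun j => by
    have := mul_le_of_le_one_right hRr.le (hpow j).2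
    simp only [hρdef]
    linarith
  have hρr : ∀ j, r ≤ ρ j := fun j => by
    have := mul_pos hRr (hpow j).1
    simp only [hρdef]
    linarith
  set a : ℕ → ℝ≥0∞ := fun j => levelIntegral μ U x₀ (k j) (ρ j) with hadef
  have hafin : ∀ j, a j ≠ ∞ := fun j =>
    ne_top_of_le_ne_top hfin (levelIntegral_mono U x₀ (hk0 j) (hρR j))
  have hadiv : ∀ j, a j / μ (ball x₀ R) ≠ ∞ := fun j => ENNReal.div_ne_top (hafin j) hV0
  set α : ℕ → ℝ := fun j => (a j / μ (ball x₀ R)).toReal with hαdef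
  have hα00 : α 0 = (levelIntegral μ U x₀ k₀ R / μ (ball x₀ R)).toReal := by
    simp [hαdef, hadef, hkdef, hρdef]
  have hrec : ∀ j, α (j + 1) ≤
      M * (2 ^ (j + 1) * ϱ) ^ s * (2 ^ (j + 1) * α j / K) ^ (s / Q) * α j := by
    intro j
    have h2 : (0 : ℝ) < 2 ^ (j + 1) := by positivity
    have hstep := levelIntegral_le hFK hA hd hQ hs hs1 hsQ hR hU hcac (hk0 j)
      (k := k (j + 1)) (by have := hkdiff j; have : 0 < K / 2 ^ (j + 1) := by positivity
                           linarith)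
      (ρ := ρ (j + 1)) (ρ' := ρ j)
      (by have := hρdiff j; have : 0 < (R - r) / 2 ^ (j + 1) := by positivity
          linarith) (hρR j) (hr.le.trans (hρr _)) (hafin j)
    rw [← hMdef, hkdiff, hρdiff, show R / ((R - r) / 2 ^ (j + 1)) = 2 ^ (j + 1) * ϱ by
      rw [hϱdef]; field_simp] at hstep
    have hKj : 0 < K / 2 ^ (j + 1) := by positivity
    have hdiv : a (j + 1) / μ (ball x₀ R) ≤ ENNReal.ofReal (M * (2 ^ (j + 1) * ϱ) ^ s) *
        (a j / μ (ball x₀ R) / ENNReal.ofReal (K / 2 ^ (j + 1))) ^ (s / Q) *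
          (a j / μ (ball x₀ R)) := by
      rw [← mul_div_assoc]
      exact ENNReal.div_le_div_right hstep _
    have hmono := ENNReal.toReal_mono (ENNReal.mul_ne_top (ENNReal.mul_ne_top
      ENNReal.ofReal_ne_top (ENNReal.rpow_ne_top_of_nonneg (by positivity)
        (ENNReal.div_ne_top (hadiv j) (by simpa using hKj)))) (hadiv j)) hdiv
    rw [ENNReal.toReal_mul, ENNReal.toReal_mul, ENNReal.toReal_ofReal (by positivity),
      ← ENNReal.toReal_rpow, ENNReal.toReal_div (a j / _), ENNReal.toReal_ofReal hKj.le] at hmono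
    refine hmono.trans (le_of_eq ?_)
    simp only [hαdef]
    congr 3
    field_simp
  have hdecay := iteration_decay hs hs1 hsQ hM hϱ (K := K) (α := α) (fun j => ENNReal.toReal_nonneg)
    (by rw [hα00]; exact hα0) (by rw [hα00]) hrec
  have hlim : levelIntegral μ U x₀ (k₀ + K) r = 0 := by
    set b := (levelIntegral μ U x₀ (k₀ + K) r / μ (ball x₀ R)).toReal with hb
    have hbα : ∀ j, b ≤ α j := fun j => by
      refine ENNReal.toReal_mono (hadiv j) (ENNReal.div_le_div_right
        (levelIntegral_mono U x₀ ?_ (hρr j)) _)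
      have := mul_pos hK0 (hpow j).1
      simp only [hkdef]
      linarith
    have hθ1 : (2 : ℝ) ^ (-(Q + 1)) < 1 :=
      Real.rpow_lt_one_of_one_lt_of_neg (by norm_num) (by linarith)
    have htend : Filter.Tendsto (fun j : ℕ => α 0 * ((2 : ℝ) ^ (-(Q + 1))) ^ j) Filter.atTop
        (nhds (α 0 * 0)) :=
      (tendsto_pow_atTop_nhds_zero_of_lt_one (by positivity) hθ1).const_mul _
    rw [mul_zero] at htend
    have hb0 : b ≤ 0 := ge_of_tendsto' htend fun j => (hbα j).trans (hdecay j)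
    have hbfin : levelIntegral μ U x₀ (k₀ + K) r / μ (ball x₀ R) ≠ ∞ :=
      ENNReal.div_ne_top (ne_top_of_le_ne_top hfin
        (levelIntegral_mono U x₀ (by linarith) hrR.le)) hV0
    have hb00 : b = 0 := le_antisymm hb0 ENNReal.toReal_nonneg
    rcases (ENNReal.toReal_eq_zero_iff _).1 hb00 with h | h
    · rcases ENNReal.div_eq_zero_iff.1 h with h | h
      · exact h
      · exact absurd h hVt
    · exact absurd h hbfin
  filter_upwards [hzero _ hlim] with x hx
  calc ENNReal.ofReal (U x - k₀) ≤ ENNReal.ofReal K := ENNReal.ofReal_le_ofReal (by linarith)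
    _ = _ := by
      rw [hK, ENNReal.ofReal_mul hα0.le, ENNReal.ofReal_toReal (ENNReal.div_ne_top hfin hV0),
        mul_comm, mul_comm (ϱ ^ Q)]

end NonlocalHarnack

namespace NonlocalHarnack

variable {X : Type u} [MetricSpace X] [MeasurableSpace X] {μ : Measure X} {Cμ : ℝ}

/-! ### Bounded dimension and the local bound -/

theorem IsDoublingDimension.mono_const {Q c c' : ℝ} (hQ : IsDoublingDimension μ Q c) (hc' : 0 < c')
    (hcc' : c' ≤ c) : IsDoublingDimension μ Q c' := by
  refine ⟨hQ.dim_pos, hc', fun x r R hr hrR => le_trans ?_ (hQ.lower_bound x r R hr hrR)⟩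
  have : 0 < R := hr.trans hrR
  gcongr

/-- A doubling measure has the doubling dimension `log₂ Cμ`, and hence any larger one. -/
theorem IsDoubling.isDoublingDimension [Nonempty X] (h : IsDoubling μ Cμ) :
    IsDoublingDimension μ (max 1 (Real.logb 2 Cμ)) (1 / Cμ) := by
  have hC := h.one_le
  have hC0 : 0 < Cμ := by linarith
  refine ⟨by positivity, by positivity, fun x r R hr hrR => ?_⟩
  set Q := max 1 (Real.logb 2 Cμ) with hQdef
  have hQ : 0 < Q := by positivity
  have hR : 0 < R := hr.trans hrR
  obtain ⟨n, hn, hn'⟩ := exists_nat_pow_near ((one_le_div hr).2 hrR.le) (one_lt_two (α := ℝ))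
  have hpow : Cμ ^ n ≤ (R / r) ^ Q := by
    calc Cμ ^ n = ((2 : ℝ) ^ Real.logb 2 Cμ) ^ n := by
          rw [Real.rpow_logb (by norm_num) (by norm_num) hC0]
      _ ≤ ((2 : ℝ) ^ Q) ^ n := by
          gcongr
          · norm_num
          · exact le_max_right _ _
      _ = ((2 : ℝ) ^ n) ^ Q := by
          rw [← Real.rpow_mul_natCast (by norm_num), mul_comm, Real.rpow_natCast_mul (by norm_num)]
      _ ≤ (R / r) ^ Q := by gcongr
  have hball : μ (ball x R) ≤ ENNReal.ofReal Cμ ^ (n + 1) * μ (ball x r) := by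
    refine (measure_mono (ball_subset_ball ?_)).trans (h.measure_ball_two_pow_mul_le x hr (n + 1))
    exact ((div_lt_iff₀ hr).1 hn').le
  calc ENNReal.ofReal (1 / Cμ * (r / R) ^ Q) * μ (ball x R)
      ≤ ENNReal.ofReal (1 / Cμ * (r / R) ^ Q) * (ENNReal.ofReal Cμ ^ (n + 1) * μ (ball x r)) := by
        gcongr
    _ = ENNReal.ofReal (1 / Cμ * (r / R) ^ Q * Cμ ^ (n + 1)) * μ (ball x r) := by
        rw [← mul_assoc, ← ENNReal.ofReal_pow hC0.le, ← ENNReal.ofReal_mul (by positivity)]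
    _ ≤ 1 * μ (ball x r) := by
        gcongr
        rw [← ENNReal.ofReal_one]
        refine ENNReal.ofReal_le_ofReal ?_
        calc 1 / Cμ * (r / R) ^ Q * Cμ ^ (n + 1) = (r / R) ^ Q * Cμ ^ n := by
              rw [pow_succ]
              field_simp
          _ ≤ (r / R) ^ Q * (R / r) ^ Q := by gcongr
          _ = 1 := by
              rw [← Real.mul_rpow (by positivity) (by positivity)]
              field_simp
              simp
    _ = μ (ball x r) := one_mul _

/-- The doubling dimension may be lowered to a value that is bounded in terms of `Cμ` alone, which
keeps the constants below independent of `Q`. -/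
theorem IsDoubling.exists_dimension_le [Nonempty X] (h : IsDoubling μ Cμ) {s Q c : ℝ} (hs1 : s < 1)
    (hsQ : s < Q) (hQ : IsDoublingDimension μ Q c) :
    ∃ Q', s < Q' ∧ Q' ≤ Q ∧ Q' ≤ max 1 (Real.logb 2 Cμ) ∧
      IsDoublingDimension μ Q' (min c (1 / Cμ)) := by
  have hC := h.one_le
  have hmin : 0 < min c (1 / Cμ) := lt_min hQ.const_pos (by positivity)
  rcases le_total Q (max 1 (Real.logb 2 Cμ)) with hle | hle
  · exact ⟨Q, hsQ, le_rfl, hle, hQ.mono_const hmin (min_le_left _ _)⟩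
  · exact ⟨_, hs1.trans_le (le_max_left _ _), hle, le_rfl,
      h.isDoublingDimension.mono_const hmin (min_le_right _ _)⟩

/-- A subminimizer or an obstacle solution is a.e. finite, and its real-valued version satisfies
Caccioppoli inequalities. -/
theorem exists_hasCaccioppoli [BorelSpace X] [SecondCountableTopology X] [SFinite μ]
    (hd : IsDoubling μ Cμ) {s : ℝ} {Ω : Set X} {u : X → EReal} {x₀ : X} {R k₀ : ℝ}
    (hΩ : IsOpen Ω) (hR : ball x₀ R ⊆ Ω)
    (hu : IsSubminimizer μ s Ω u ∨ ∃ ψ : X → EReal, (∀ x ∈ Ω, ψ x < ⊤) ∧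
      (∀ᵐ x ∂μ.restrict (ball x₀ R), ψ x ≤ (k₀ : EReal)) ∧
      IsObstacleSolution μ s Ω ψ (fun _ => 0) u) :
    ∃ U : X → ℝ, Measurable U ∧ (∀ᵐ x ∂μ.restrict Ω, u x = (U x : EReal)) ∧
      HasCaccioppoli μ s U x₀ R k₀ := by
  rcases hu with hu | ⟨ψ, -, hψ, hu⟩
  · have hm : AEMeasurable (fun x => (u x).toReal) μ := hu.aemeasurable.ereal_toReal
    have hUu : ∀ᵐ x ∂μ.restrict Ω, u x = (hm.mk _ x : EReal) := by
      filter_upwards [ae_finite_of_gagliardo_lt_top hd hu.memDotW.1 hu.memDotW.2,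
        ae_restrict_of_ae hm.ae_eq_mk] with x hx hx'
      rw [hx, hx']
    exact ⟨_, hm.measurable_mk, hUu,
      hu.hasCaccioppoli hd hΩ.measurableSet hm.measurable_mk hUu hR k₀⟩
  · have hu1 := hu.1.1
    have hum : AEMeasurable u μ := by simpa using hu1.1
    have hm : AEMeasurable (fun x => (u x).toReal) μ := hum.ereal_toReal
    have hUu : ∀ᵐ x ∂μ, u x = (hm.mk _ x : EReal) := by
      have hfin := ae_finite_of_gagliardo_lt_top hd hu1.1 hu1.2
      rw [Measure.restrict_univ] at hfin
      filter_upwards [hfin, hm.ae_eq_mk] with x hx hx'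
      rw [hx, hx']
    exact ⟨_, hm.measurable_mk, ae_restrict_of_ae hUu,
      hu.hasCaccioppoli hΩ.measurableSet hm.measurable_mk hUu hR hψ⟩

/-- The local bound, with the constant of the Faber–Krahn inequality in force. -/
theorem essSup_le_of_hasFaberKrahn [BorelSpace X] [SecondCountableTopology X] [SFinite μ]
    (hd : IsDoubling μ Cμ) {s A Q Q' c C : ℝ} (hFK : HasFaberKrahn μ s A) (hA : 0 ≤ A)
    (hs : 0 < s) (hs1 : s < 1) (hsQ' : s < Q') (hQ : IsDoublingDimension μ Q' c) (hQ' : Q' ≤ Q)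
    (hC : (3 * max 1 (2 / c) * (4 * A * (Cμ ^ 2 * (2 / s + 4 / (1 - s))) + 1) *
      2 ^ (Q' + 3)) ^ (Q' / s) ≤ C)
    {Ω : Set X} {u : X → EReal} {x₀ : X} {r R k₀ : ℝ} (hΩ : IsOpen Ω) (hr : 0 < r) (hrR : r < R)
    (hR : ball x₀ R ⊆ Ω)
    (hu : IsSubminimizer μ s Ω u ∨ ∃ ψ : X → EReal, (∀ x ∈ Ω, ψ x < ⊤) ∧
      (∀ᵐ x ∂μ.restrict (ball x₀ R), ψ x ≤ (k₀ : EReal)) ∧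
      IsObstacleSolution μ s Ω ψ (fun _ => 0) u) :
    essSup (fun y => u y - (k₀ : EReal)) (μ.restrict (ball x₀ r)) ≤
      ((ENNReal.ofReal (C * (R / (R - r)) ^ Q) *
        ⨍⁻ y in ball x₀ R, (u y - (k₀ : EReal)).toENNReal ∂μ : ℝ≥0∞) : EReal) := by
  obtain ⟨U, hU, hUu, hcac⟩ := exists_hasCaccioppoli hd hΩ hR hu
  have hRr : 0 < R - r := by linarith
  have hρ : 1 ≤ R / (R - r) := (one_le_div hRr).2 (by linarith)
  have hlevel : ∫⁻ y in ball x₀ R, (u y - (k₀ : EReal)).toENNReal ∂μ =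
      levelIntegral μ U x₀ k₀ R := by
    refine lintegral_congr_ae ?_
    filter_upwards [ae_restrict_of_ae_restrict_of_subset hR hUu] with x hx
    rw [hx, ← EReal.coe_sub, EReal.toENNReal_of_ne_top (EReal.coe_ne_top _), EReal.toReal_coe]
  rw [setLAverage_eq, hlevel]
  refine essSup_le_of_ae_le _ ?_
  filter_upwards [ae_restrict_of_ae_restrict_of_subset
    ((ball_subset_ball hrR.le).trans hR) hUu,
    hcac.ae_le hFK hA hd hQ hs hs1 hsQ' hr hrR hU] with x hx hle
  rw [hx, ← EReal.coe_sub]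
  refine (EReal.coe_le_coe_iff.2 (le_max_left (U x - k₀) 0)).trans ?_
  rw [← EReal.coe_ennreal_ofReal, EReal.coe_ennreal_le_coe_ennreal_iff]
  refine hle.trans ?_
  have h1s : 0 < 1 - s := by linarith
  have hQ0 := hQ.dim_pos
  have hC0 : 0 ≤ C := le_trans (by positivity) hC
  gcongr

theorem IsDoubling.isLocallyFiniteMeasure (h : IsDoubling μ Cμ) : IsLocallyFiniteMeasure μ :=
  ⟨fun x => ⟨ball x 1, ball_mem_nhds x one_pos, h.finite x 1 one_pos⟩⟩

/-- In presence of a Poincaré inequality, the product of the constants of the Faber–Krahn and the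
cutoff estimates is at most a multiple of `1 / s`: for `s < 1 / 2` the factor `1 / (1 - s)`
of the latter is bounded, and for `s ≥ 1 / 2` the factor `1 - s` of the former cancels it. -/
theorem SupportsPoincare.exists_hasFaberKrahn [BorelSpace X] [SecondCountableTopology X] [SFinite μ]
    (hd : IsDoubling μ Cμ) (hC : 1 ≤ Cμ) {CP lam s : ℝ} (hP : SupportsPoincare μ CP lam)
    (hs : 0 < s) (hs1 : s < 1) :
    ∃ A, 0 ≤ A ∧ HasFaberKrahn μ s A ∧
      A * (Cμ ^ 2 * (2 / s + 4 / (1 - s))) ≤ 1728 * Cμ ^ 11 * (1 + CP) / s := by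
  have hCP := hP.const_pos
  have h1s : 0 < 1 - s := by linarith
  have hC0 : 0 < Cμ := by linarith
  rcases lt_or_ge s (1 / 2) with h | h
  · refine ⟨2 * Cμ, by positivity, hd.hasFaberKrahn hs, ?_⟩
    have h4 : 4 / (1 - s) ≤ 4 / s := by
      gcongr
      linarith
    calc 2 * Cμ * (Cμ ^ 2 * (2 / s + 4 / (1 - s))) ≤ 2 * Cμ * (Cμ ^ 2 * (2 / s + 4 / s)) := by
          gcongr
      _ = 12 * Cμ ^ 3 * (1 + 0) / s := by ring
      _ ≤ 1728 * Cμ ^ 11 * (1 + CP) / s := by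
          gcongr
          · norm_num
          · norm_num
  · refine ⟨_, by positivity, hP.hasFaberKrahn hd hC h hs1, ?_⟩
    calc 288 * Cμ ^ 9 * (1 + CP) * (1 - s) * (Cμ ^ 2 * (2 / s + 4 / (1 - s)))
        = 288 * Cμ ^ 11 * (1 + CP) * (2 * (1 - s) + 4 * s) / s := by
          field_simp
      _ ≤ 288 * Cμ ^ 11 * (1 + CP) * 6 / s := by
          gcongr
          linarith
      _ = 1728 * Cμ ^ 11 * (1 + CP) / s := by ring

end NonlocalHarnack

theorem theorem1p1 :
    -- complete, connected, doubling spaces: `C` depends only on `s`, `Cμ` and `c`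
    (∀ s Cμ c : ℝ, 0 < s → s < 1 → 0 < Cμ → 0 < c → ∃ C : ℝ, 0 < C ∧
      ∀ (X : Type u) [MetricSpace X] [MeasurableSpace X] [BorelSpace X]
        [TopologicalSpace.SeparableSpace X] [CompleteSpace X] [ConnectedSpace X]
        (μ : Measure X) (Q : ℝ),
        NonlocalHarnack.IsDoubling μ Cμ → NonlocalHarnack.IsDoublingDimension μ Q c → s < Q →
        ∀ (Ω : Set X) (u : X → EReal) (x₀ : X) (r R k₀ : ℝ),
          IsOpen Ω → x₀ ∈ Ω → 0 < r → r < R → ball x₀ R ⊆ Ω →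
          (NonlocalHarnack.IsSubminimizer μ s Ω u ∨
            ∃ ψ : X → EReal, (∀ x ∈ Ω, ψ x < ⊤) ∧
              (∀ᵐ x ∂μ.restrict (ball x₀ R), ψ x ≤ (k₀ : EReal)) ∧
              NonlocalHarnack.IsObstacleSolution μ s Ω ψ (fun _ => 0) u) →
          essSup (fun y => u y - (k₀ : EReal)) (μ.restrict (ball x₀ r)) ≤
            ((ENNReal.ofReal (C * (R / (R - r)) ^ Q) *
              ⨍⁻ y in ball x₀ R, (u y - (k₀ : EReal)).toENNReal ∂μ : ℝ≥0∞) : EReal)) ∧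
    -- under a `1`-Poincaré inequality, `C = (C' / s) ^ (Q / s)` with `C'` independent of `s`
    (∀ Cμ c CP lam : ℝ, 0 < Cμ → 0 < c → 0 < CP → 1 ≤ lam → ∃ C' : ℝ, 0 < C' ∧
      ∀ (X : Type u) [MetricSpace X] [MeasurableSpace X] [BorelSpace X]
        [TopologicalSpace.SeparableSpace X] [CompleteSpace X] [ConnectedSpace X]
        (μ : Measure X) (s Q : ℝ), 0 < s → s < 1 →
        NonlocalHarnack.IsDoubling μ Cμ → NonlocalHarnack.IsDoublingDimension μ Q c → s < Q →
        NonlocalHarnack.SupportsPoincare μ CP lam →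
        ∀ (Ω : Set X) (u : X → EReal) (x₀ : X) (r R k₀ : ℝ),
          IsOpen Ω → x₀ ∈ Ω → 0 < r → r < R → ball x₀ R ⊆ Ω →
          (NonlocalHarnack.IsSubminimizer μ s Ω u ∨
            ∃ ψ : X → EReal, (∀ x ∈ Ω, ψ x < ⊤) ∧
              (∀ᵐ x ∂μ.restrict (ball x₀ R), ψ x ≤ (k₀ : EReal)) ∧
              NonlocalHarnack.IsObstacleSolution μ s Ω ψ (fun _ => 0) u) →
          essSup (fun y => u y - (k₀ : EReal)) (μ.restrict (ball x₀ r)) ≤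
            ((ENNReal.ofReal ((C' / s) ^ (Q / s) * (R / (R - r)) ^ Q) *
              ⨍⁻ y in ball x₀ R, (u y - (k₀ : EReal)).toENNReal ∂μ : ℝ≥0∞) : EReal)) := by
  refine ⟨fun s Cμ c hs hs1 hCμ hc => ?_, fun Cμ c CP lam hCμ hc hCP _ => ?_⟩
  · have h1s : 0 < 1 - s := by linarith
    set Q₀ := max 1 (Real.logb 2 Cμ)
    set D := 3 * max 1 (2 / min c (1 / Cμ)) *
      (4 * (2 * Cμ) * (Cμ ^ 2 * (2 / s + 4 / (1 - s))) + 1) * 2 ^ (Q₀ + 3) with hD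
    have hQ₀ : 1 ≤ Q₀ := le_max_left _ _
    have hD1 : 1 ≤ D := by
      have h1 : 1 ≤ max 1 (2 / min c (1 / Cμ)) := le_max_left _ _
      have h2 : 1 ≤ 4 * (2 * Cμ) * (Cμ ^ 2 * (2 / s + 4 / (1 - s))) + 1 :=
        le_add_of_nonneg_left (by positivity)
      have h3 : (1 : ℝ) ≤ 2 ^ (Q₀ + 3) := Real.one_le_rpow (by norm_num) (by linarith)
      exact one_le_mul_of_one_le_of_one_le (one_le_mul_of_one_le_of_one_le (by linarith) h2) h3
    refine ⟨D ^ (Q₀ / s), by positivity, ?_⟩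
    intro X _ _ _ _ _ _ μ Q hd hQ hsQ Ω u x₀ r R k₀ hΩ _ hr hrR hR hu
    have := UniformSpace.secondCountable_of_separable X
    have := hd.isLocallyFiniteMeasure
    obtain ⟨Q', hsQ', hQ', hQ'₀, hdim⟩ := hd.exists_dimension_le hs1 hsQ hQ
    refine NonlocalHarnack.essSup_le_of_hasFaberKrahn hd (hd.hasFaberKrahn hs) (by positivity) hs
      hs1 hsQ' hdim hQ' ?_ hΩ hr hrR hR hu
    calc _ ≤ D ^ (Q' / s) := by
          have := hdim.dim_pos
          rw [hD]
          gcongr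
          norm_num
      _ ≤ D ^ (Q₀ / s) := by gcongr
  · set Q₀ := max 1 (Real.logb 2 Cμ)
    set D := 3 * max 1 (2 / min c (1 / Cμ)) *
      (4 * (1728 * Cμ ^ 11 * (1 + CP)) + 1) * 2 ^ (Q₀ + 3) with hD
    have hQ₀ : 1 ≤ Q₀ := le_max_left _ _
    have hD1 : 1 ≤ D := by
      have h1 : 1 ≤ max 1 (2 / min c (1 / Cμ)) := le_max_left _ _
      have h2 : 1 ≤ 4 * (1728 * Cμ ^ 11 * (1 + CP)) + 1 := le_add_of_nonneg_left (by positivity)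
      have h3 : (1 : ℝ) ≤ 2 ^ (Q₀ + 3) := Real.one_le_rpow (by norm_num) (by linarith)
      exact one_le_mul_of_one_le_of_one_le (one_le_mul_of_one_le_of_one_le (by linarith) h2) h3
    refine ⟨D, by positivity, ?_⟩
    intro X _ _ _ _ _ _ μ s Q hs hs1 hd hQ hsQ hP Ω u x₀ r R k₀ hΩ _ hr hrR hR hu
    have := UniformSpace.secondCountable_of_separable X
    have := hd.isLocallyFiniteMeasure
    have h1s : 0 < 1 - s := by linarith
    obtain ⟨Q', hsQ', hQ', hQ'₀, hdim⟩ := hd.exists_dimension_le hs1 hsQ hQ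
    obtain ⟨A, hA, hFK, hAle⟩ := hP.exists_hasFaberKrahn hd hd.one_le hs hs1
    refine NonlocalHarnack.essSup_le_of_hasFaberKrahn hd hFK hA hs
      hs1 hsQ' hdim hQ' ?_ hΩ hr hrR hR hu
    have hQ'0 := hdim.dim_pos
    have hsum : 4 * A * (Cμ ^ 2 * (2 / s + 4 / (1 - s))) + 1 ≤
        (4 * (1728 * Cμ ^ 11 * (1 + CP)) + 1) / s := by
      have h1 : 1 ≤ 1 / s := (one_le_div hs).2 hs1.le
      calc 4 * A * (Cμ ^ 2 * (2 / s + 4 / (1 - s))) + 1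
          = 4 * (A * (Cμ ^ 2 * (2 / s + 4 / (1 - s)))) + 1 := by ring
        _ ≤ 4 * (1728 * Cμ ^ 11 * (1 + CP) / s) + 1 / s := by gcongr
        _ = _ := by ring
    calc _ ≤ (3 * max 1 (2 / min c (1 / Cμ)) * ((4 * (1728 * Cμ ^ 11 * (1 + CP)) + 1) / s) *
            2 ^ (Q₀ + 3)) ^ (Q' / s) := by
          gcongr
          norm_num
      _ = (D / s) ^ (Q' / s) := by
          rw [hD]
          ring_nf
      _ ≤ (D / s) ^ (Q / s) := by
          have h1 : 1 ≤ D / s := (one_le_div hs).2 (by linarith)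
          gcongr
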